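/- **Notation.** Write $x=(x_1,x_{2,3})=(x_1,x_2,x_3)\in\mathbb R^3$, $\rho_{s,t}(x)=(sx_1,tx_2,stx_3)$ and $A^1=\{\xi:\tfrac12<|\xi_1|\le1,\ \tfrac12<|(\xi_2,\xi_3)|\le1\}$. For $N\in\mathbb N$, $\mathcal M^1_Z$ is the class of functions $m$ on $(\mathbb R\setminus\{0\})\times(\mathbb R^2\setminus\{0\})$ all of whose partial derivatives $\partial^\alpha m$, $|\alpha|_\infty\le N$, exist and are continuous, with $$\|m\|_{\mathcal M^1_Z}=\sup_{|\alpha|_\infty\le N}\ \sup_{s,t>0}\ \sup_{\xi\in A^1}|\partial^\alpha(m\circ\rho_{s,t})(\xi)|<\infty .$$ Let $\phi^1\in C_c^\infty(\mathbb R)$ and $\phi^{23}\in C_c^\infty(\mathbb R^2)$ be real-valued and supported in $\{\frac12\le|x|\le2\}$, with $\sum_{j\in\mathbb Z}\phi^1(2^{-j}x)=1$ for $x\in\mathbb R\setminus\{0\}$ and $\sum_{k\in\mathbb Z}\phi^{23}(2^{-k}x)=1$ for $x\in\mathbb R^2\setminus\{0\}$. For $J=(J^1,J^2)\in\mathbb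 N^2$ put $$m_J(\xi)=\sum_{|j|\le J^1}\ \sum_{|k|\le J^2}\phi^1(2^{-j}\xi_1)\,\phi^{23}(2^{-k}\xi_2,2^{-j-k}\xi_3)\,m(\xi)$$ (and $m_J=0$ where $m$ is undefined), $K_J(x)=\check m_J(x)=\int m_J(\xi)e^{2\pi i x\cdot\xi}\,d\xi$ and $T_Jf=K_J*f$. Intervals are bounded and nondegenerate, rectangles are products of such intervals, and disjoint means having disjoint interiors. For an interval $I$, $c_I$ is its centre, $3I$ the concentric interval of length $3|I|$, $h^0_I=|I|^{-1/2}1_I$ and $h_I=h^1_I=|I|^{-1/2}(1_{I_l}-1_{I_r})$, where $I_l,I_r$ are the left and right halves of $I$. For $I^{2,3}=I^2\times I^3$, $h_{I^{2,3}}$ denotes any of $h^{\eta_2}_{I^2}\otimes h^{\eta_3}_{I^3}$ with $(\eta_2,\eta_3)\in\{0,1\}^2\setminus\{(0,0)\}$. Let $\langle f,g\rangle=\int fg$ and $$D_{\log}(x)=\Big(\tfrac{|x_1x_2|}{|x_3|}+\tfrac{|x_3|}{|x_1x_2|}\Big)^{-1}\log\Big(\tfrac{|x_1x_2|}{|x_3|}+\tfrac{|x_3|}{|x_1x_2|}\Big).$$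 **Definition.** Let $\alpha_1,\alpha_{23}\in(0,1]$. An operator $T$, linear on the finite linear combinations of indicators of rectangles in $\mathbb R^3$ and with $T1_I$ integrable on every rectangle for every rectangle $I$, is a *$(\log,\alpha_1,\alpha_{23})$-CZZ operator with constant $C$* if there are kernels $K$, $K_{I^1}$ (for each interval $I^1$) and $K_{I^{2,3}}$ (for each rectangle $I^{2,3}\subset\mathbb R^2$) such that the following holds. 1. *Full kernel.* If $I^1,J^1$ are disjoint and $I^{2,3},J^{2,3}$ are disjoint, then $\langle T1_I,1_J\rangle=\iint K(x,y)1_I(y)1_J(x)\,dy\,dx$, with absolute convergence, where $I=I^1\times I^{2,3}$ and $J=J^1\times J^{2,3}$. For $x_i\ne y_i$ and $|x_i'-x_i|\le\frac12|x_i-y_i|$ ($i=1,2,3$), put $$S=\frac{D_{\log}(x-y)}{\prod_{i=1}^3|x_i-y_i|},\qquad A=\Big(\tfrac{|x_1'-x_1|}{|x_1-y_1|}\Big)^{\alpha_1},\qquad B=\Big(\tfrac{|x_2'-x_2|}{|x_2-y_2|}+\tfrac{|x_3'-x_3|}{|x_3-y_3|}\Big)^{\alpha_{23}}.$$ Then $|K(x,y)|\le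 CS$, $|K((x_1',x_{2,3}),y)-K(x,y)|\le CAS$, $|K((x_1,x_{2,3}'),y)-K(x,y)|\le CBS$ and $|K(x',y)-K((x_1',x_{2,3}),y)-K((x_1,x_{2,3}'),y)+K(x,y)|\le CABS$. The kernels $K(y,x)$, $K((y_1,x_{2,3}),(x_1,y_{2,3}))$ and $K((x_1,y_{2,3}),(y_1,x_{2,3}))$ satisfy the same estimates. 2. *Partial kernels.* If $I^{2,3},J^{2,3}$ are disjoint, then $\langle T(1_{I^1}\otimes1_{I^{2,3}}),1_{I^1}\otimes1_{J^{2,3}}\rangle=\iint K_{I^1}(x_{2,3},y_{2,3})1_{I^{2,3}}(y_{2,3})1_{J^{2,3}}(x_{2,3})\,dy_{2,3}\,dx_{2,3}$, with absolute convergence. With $S_1=\frac{|I^1|}{|x_2-y_2||x_3-y_3|}D_{\log}(|I^1|,x_2-y_2,x_3-y_3)$ and the same $B$ one has $|K_{I^1}(x_{2,3},y_{2,3})|\le CS_1$ and $|K_{I^1}(x_{2,3}',y_{2,3})-K_{I^1}(x_{2,3},y_{2,3})|\le CBS_1$ if $x_i\neq y_i$ and $|x_i'-x_i|\le\frac12|x_i-y_i|$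 for $i=2,3$, and the same for the kernel $K_{I^1}(y_{2,3},x_{2,3})$. If $I^1,J^1$ are disjoint, then $\langle T(1_{I^1}\otimes1_{I^{2,3}}),1_{J^1}\otimes1_{I^{2,3}}\rangle=\iint K_{I^{2,3}}(x_1,y_1)1_{I^1}(y_1)1_{J^1}(x_1)\,dy_1\,dx_1$, with absolute convergence, and $k=K_{I^{2,3}}$ satisfies, for $u\ne v$ and $|u'-u|\le\frac12|u-v|$, $|k(u,v)|\le \frac{C|I^{2,3}|}{|u-v|}$ and both $|k(u',v)-k(u,v)|$ and $|k(v,u')-k(v,u)|$ are at most $C|I^{2,3}|\frac{|u'-u|^{\alpha_1}}{|u-v|^{1+\alpha_1}}$. 3. *Cancellation.* For all intervals $I^1,J^1$, rectangles $I^{2,3},J^{2,3}\subset\mathbb R^2$ and cancellative Haar functions, $$\langle T(1\otimes1_{I^{2,3}}),h_{I^1}\otimes1_{J^{2,3}}\rangle=\langle T(h_{I^1}\otimes1_{I^{2,3}}),1\otimes1_{J^{2,3}}\rangle=\langle T(1_{I^1}\otimes1),1_{J^1}\otimes h_{I^{2,3}}\rangle=\langle T(1_{I^1}\otimes h_{I^{2,3}}),1_{J^1}\otimes1\rangle=0.$$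 Here the pairings are defined as follows. In the third one, if $h_{I^{2,3}}$ has cancellation in $x_2$, split $1=1_{3I^2\times3I^3}+1_{(3I^2)^c\times\mathbb R}+1_{3I^2\times(3I^3)^c}$. The first term is paired directly. If $I^1,J^1$ are disjoint, the second term is paired through $\iint (K(x,y)-K((x_1,c_{I^2},x_3),y))(\cdots)\,dy\,dx$ and the third through $\iint K(x,y)(\cdots)\,dy\,dx$, where $(\cdots)$ is the product of the two functions that are paired; if $I^1=J^1$, the partial kernel $K_{I^1}$ is used in the same way in place of $K$; in general $1_{I^1}\otimes1_{J^1}$ is split into its part on $(I^1\cap J^1)^2$, where $K_{I^1\cap J^1}$ is used, and the rest, where $K$ is used. The roles of $x_2$ and $x_3$ are exchanged if $h_{I^{2,3}}$ has cancellation in $x_3$. In the first pairing one splits $1=1_{3I^1}+1_{(3I^1)^c}$ and uses $K(x,y)-K((c_{I^1},x_{2,3}),y)$ and $K_{I^{2,3}\cap J^{2,3}}$ likewise, and the other two are defined by transposition. All these integrals converge absolutely. 4. *Weak boundedness.* $|\langle T1_I,1_I\rangle|\le C|I|$ for all rectangles $I=I^1\times I^2\times I^3$ with $|I^1||I^2|=|I^3|$.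 **Proposition.** If $N$ is large enough (larger than an absolute constant), then there is a constant $C_0$, depending only on $N,\phi^1,\phi^{23}$, such that for every $m\in\mathcal M^1_Z$ and every $J\in\mathbb N^2$ the functions $m_J$ and $K_J$ are integrable and $T_Jf=K_J*f$ is a $(\log,1,1)$-CZZ operator with constant $C_0\|m\|_{\mathcal M^1_Z}$. -/

import Mathlib

open MeasureTheory

namespace Zyg

noncomputable section

/-- `ℝ³`, written as `ℝ × ℝ²`, so that a point is `(x₁, x₂, x₃) = (x₁, (x₂, x₃))`. Lebesgue measure
is the product measure. -/
abbrev R3 : Type := ℝ × ℝ × ℝ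

/-! ### Intervals, rectangles, indicators and Haar functions -/

/-- A bounded nondegenerate interval of the line, represented as `[a, b)` (so that two intervals
are disjoint exactly when their interiors are). -/
structure Intv where
  a : ℝ
  b : ℝ
  lt : a < b

namespace Intv

def set (I : Intv) : Set ℝ := Set.Ico I.a I.b

/-- The length `|I|`. -/
def len (I : Intv) : ℝ := I.b - I.a

def center (I : Intv) : ℝ := (I.a + I.b) / 2

/-- The interval `3I` with the same centre as `I` and with length `3|I|`. -/
def triple (I : Intv) : Intv :=
  ⟨2 * I.a - I.b, 2 * I.b - I.a, by have := I.lt; linarith⟩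

def ind (I : Intv) (t : ℝ) : ℂ := I.set.indicator (fun _ => 1) t

/-- The indicator of the complement of `I`. -/
def coind (I : Intv) (t : ℝ) : ℂ := (I.set)ᶜ.indicator (fun _ => 1) t

def left (I : Intv) : Intv := ⟨I.a, I.center, by have := I.lt; unfold center; linarith⟩

def right (I : Intv) : Intv := ⟨I.center, I.b, by have := I.lt; unfold center; linarith⟩

/-- The Haar functions `h_I^0 = |I|^{-1/2} 1_I` (for `false`) and
`h_I^1 = |I|^{-1/2} (1_{I_l} - 1_{I_r})` (for `true`, the cancellative one). -/
def haar (I : Intv) (η : Bool) (t : ℝ) : ℂ :=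
  ((Real.sqrt I.len)⁻¹ : ℝ) * (if η then I.left.ind t - I.right.ind t else I.ind t)

/-- The intersection, when it is a nondegenerate interval. -/
def inter (I J : Intv) : Option Intv :=
  if h : max I.a J.a < min I.b J.b then some ⟨max I.a J.a, min I.b J.b, h⟩ else none

end Intv

/-- Rectangles `I² × I³` in the plane. -/
abbrev Rect : Type := Intv × Intv

namespace Rect

def set (Q : Rect) : Set (ℝ × ℝ) := Q.1.set ×ˢ Q.2.set

def area (Q : Rect) : ℝ := Q.1.len * Q.2.len

def triple (Q : Rect) : Rect := (Q.1.triple, Q.2.triple)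

def ind (Q : Rect) (u : ℝ × ℝ) : ℂ := Q.1.ind u.1 * Q.2.ind u.2

/-- The Haar functions `h_{I²}^{η₂} ⊗ h_{I³}^{η₃}`; cancellative unless `η₂ = η₃ = 0`. -/
def haar (Q : Rect) (η₂ η₃ : Bool) (u : ℝ × ℝ) : ℂ := Q.1.haar η₂ u.1 * Q.2.haar η₃ u.2

/-- The intersection, when it is a nondegenerate rectangle. -/
def inter (P Q : Rect) : Option Rect :=
  (P.1.inter Q.1).bind fun A => (P.2.inter Q.2).map fun B => (A, B)

end Rect

/-- The tensor product `f ⊗ g` of a function of `x₁` and a function of `(x₂, x₃)`. -/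
def tens (f : ℝ → ℂ) (g : ℝ × ℝ → ℂ) (x : R3) : ℂ := f x.1 * g x.2

/-- The indicator of the rectangle `I × Q = I¹ × I² × I³`. -/
def box (I : Intv) (Q : Rect) : R3 → ℂ := tens I.ind Q.ind

/-- Finite linear combinations of indicators of rectangles. -/
def stepFun : Submodule ℂ (R3 → ℂ) :=
  Submodule.span ℂ {f | ∃ (I : Intv) (Q : Rect), f = box I Q}

/-! ### Decay factors -/

/-- `D_θ(x) = (|x₁x₂|/|x₃| + |x₃|/|x₁x₂|)^{-θ}`. -/
def Dtheta (θ : ℝ) (x₁ x₂ x₃ : ℝ) : ℝ :=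
  (|x₁ * x₂| / |x₃| + |x₃| / |x₁ * x₂|) ^ (-θ)

/-- `D_log(x) = D_1(x) log(|x₁x₂|/|x₃| + |x₃|/|x₁x₂|)`. -/
def Dlog (x₁ x₂ x₃ : ℝ) : ℝ :=
  Dtheta 1 x₁ x₂ x₃ * Real.log (|x₁ * x₂| / |x₃| + |x₃| / |x₁ * x₂|)

/-! ### Kernel estimates -/

/-- The size and Hölder estimates of a full kernel, with constant `C`, decay factor `D` and
exponents `α₁`, `α₂₃`. Values of `K` on the set `|x₁-y₁||x₂-y₂||x₃-y₃| = 0` play no role. -/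
def FullEstimates (C : ℝ) (D : ℝ → ℝ → ℝ → ℝ) (α₁ α₂₃ : ℝ) (K : R3 → R3 → ℂ) : Prop :=
  ∀ x₁ x₂ x₃ y₁ y₂ y₃ : ℝ, x₁ ≠ y₁ → x₂ ≠ y₂ → x₃ ≠ y₃ →
    let S := D (x₁ - y₁) (x₂ - y₂) (x₃ - y₃) / (|x₁ - y₁| * |x₂ - y₂| * |x₃ - y₃|)
    let y : R3 := (y₁, y₂, y₃)
    ‖K (x₁, x₂, x₃) y‖ ≤ C * S ∧
    ∀ x₁' x₂' x₃' : ℝ, |x₁' - x₁| ≤ |x₁ - y₁| / 2 → |x₂' - x₂| ≤ |x₂ - y₂| / 2 →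
      |x₃' - x₃| ≤ |x₃ - y₃| / 2 →
      let A := (|x₁' - x₁| / |x₁ - y₁|) ^ α₁
      let B := (|x₂' - x₂| / |x₂ - y₂| + |x₃' - x₃| / |x₃ - y₃|) ^ α₂₃
      ‖K (x₁', x₂, x₃) y - K (x₁, x₂, x₃) y‖ ≤ C * (A * S) ∧
      ‖K (x₁, x₂', x₃') y - K (x₁, x₂, x₃) y‖ ≤ C * (B * S) ∧
      ‖K (x₁', x₂', x₃') y - K (x₁', x₂, x₃) y - K (x₁, x₂', x₃') y + K (x₁, x₂, x₃) y‖
        ≤ C * (A * B * S)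

/-- The adjoint kernel `K^*(x,y) = K(y,x)`. -/
def adj {X : Type} (K : X → X → ℂ) (x y : X) : ℂ := K y x

/-- The partial adjoint kernel `K_1^*`. -/
def adj₁ (K : R3 → R3 → ℂ) (x y : R3) : ℂ := K (y.1, x.2) (x.1, y.2)

/-- The partial adjoint kernel `K_{2,3}^*`. -/
def adj₂₃ (K : R3 → R3 → ℂ) (x y : R3) : ℂ := K (x.1, y.2) (y.1, x.2)

/-- The estimates of the partial kernel `K_{I¹}`, where `ℓ = |I¹|`. -/
def PartialEstimates (C : ℝ) (D : ℝ → ℝ → ℝ → ℝ) (α₂₃ ℓ : ℝ) (k : ℝ × ℝ → ℝ × ℝ → ℂ) : Prop :=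
  ∀ x₂ x₃ y₂ y₃ : ℝ, x₂ ≠ y₂ → x₃ ≠ y₃ →
    let S := ℓ / (|x₂ - y₂| * |x₃ - y₃|) * D ℓ (x₂ - y₂) (x₃ - y₃)
    ‖k (x₂, x₃) (y₂, y₃)‖ ≤ C * S ∧
    ∀ x₂' x₃' : ℝ, |x₂' - x₂| ≤ |x₂ - y₂| / 2 → |x₃' - x₃| ≤ |x₃ - y₃| / 2 →
      ‖k (x₂', x₃') (y₂, y₃) - k (x₂, x₃) (y₂, y₃)‖ ≤
        C * ((|x₂' - x₂| / |x₂ - y₂| + |x₃' - x₃| / |x₃ - y₃|) ^ α₂₃ * S)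

/-- `‖k‖_{CZ_γ(ℝ)} ≤ C`: the standard Calderón–Zygmund kernel estimates on the line. -/
def CZEstimates (C γ : ℝ) (k : ℝ → ℝ → ℂ) : Prop :=
  ∀ x y : ℝ, x ≠ y →
    ‖k x y‖ ≤ C / |x - y| ∧
    ∀ x' : ℝ, |x' - x| ≤ |x - y| / 2 →
      ‖k x' y - k x y‖ ≤ C * (|x' - x| ^ γ / |x - y| ^ (1 + γ)) ∧
      ‖k y x' - k y x‖ ≤ C * (|x' - x| ^ γ / |x - y| ^ (1 + γ))

/-! ### Cancellation conditions

Here `B f g` stands for `⟨T f, g⟩`; the constant function `1` is not in the domain, so the pairings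
are defined with the help of the full kernel `K` and the partial kernels `k₁ I` (for intervals `I`)
and `k₂₃ Q` (for rectangles `Q`). Where two intervals (or rectangles) `I`, `J` overlap, one splits
`1_I ⊗ 1_J` into the square of `R = I ∩ J`, on which the partial kernel of `R` is used, and
the remaining part `(J × I) \ (R × R)`, on which the full kernel is used. -/

/-- The indicator of `(x, y) ∈ (J × I) \ (R × R)` with `R = I ∩ J`. -/
def off {X : Type} (I J : Set X) (x y : X) : ℂ :=
  ((J ×ˢ I) \ ((I ∩ J) ×ˢ (I ∩ J))).indicator (fun _ => 1) (x, y)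

/-- `h_I(x) (k(x,y) - k(c_I,y)) 1_{(3I)^c}(y)`. -/
def far₁ (k : ℝ → ℝ → ℂ) (I : Intv) (x y : ℝ) : ℂ :=
  I.haar true x * ((k x y - k I.center y) * I.triple.coind y)

/-- Cancellation in the second variable (`η₂ = 1`): the function
`h(x) [(k(x,y) - k((c_{I²},x₃),y)) 1_{(3I²)^c × ℝ}(y) + k(x,y) 1_{3I² × (3I³)^c}(y)]`. -/
def far₂ (k : ℝ × ℝ → ℝ × ℝ → ℂ) (Q : Rect) (η₃ : Bool) (x y : ℝ × ℝ) : ℂ :=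
  Q.haar true η₃ x *
    ((k x y - k (Q.1.center, x.2) y) * Q.1.triple.coind y.1
      + k x y * (Q.1.triple.ind y.1 * Q.2.triple.coind y.2))

/-- Cancellation in the third variable (`η₃ = 1`): the roles of the two variables are swapped. -/
def far₃ (k : ℝ × ℝ → ℝ × ℝ → ℂ) (Q : Rect) (η₂ : Bool) (x y : ℝ × ℝ) : ℂ :=
  Q.haar η₂ true x *
    ((k x y - k (x.1, Q.2.center) y) * Q.2.triple.coind y.2
      + k x y * (Q.2.triple.ind y.2 * Q.1.triple.coind y.1))

/-- `⟨T(1 ⊗ 1_P), h_I ⊗ 1_Q⟩ = 0` for all intervals `I` and all rectangles `P`, `Q`: all the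
integrals that define the pairing converge absolutely, and they add up to zero. -/
def Cancel₁ (B : (R3 → ℂ) → (R3 → ℂ) → ℂ) (K : R3 → R3 → ℂ) (k₂₃ : Rect → ℝ → ℝ → ℂ) : Prop :=
  ∀ (I : Intv) (P Q : Rect),
    let full : R3 × R3 → ℂ := fun p =>
      off P.set Q.set p.1.2 p.2.2 * far₁ (fun s t => K (s, p.1.2) (t, p.2.2)) I p.1.1 p.2.1
    let part : Rect → ℝ × ℝ → ℂ := fun R p => far₁ (k₂₃ R) I p.1 p.2
    Integrable full ∧ (∀ R ∈ P.inter Q, Integrable (part R)) ∧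
    B (tens I.triple.ind P.ind) (tens (I.haar true) Q.ind)
      + (∫ p, full p) + (P.inter Q).elim 0 (fun R => ∫ p, part R p) = 0

/-- `⟨T(1_I ⊗ 1), 1_J ⊗ h_Q⟩ = 0` for all intervals `I`, `J`, all rectangles `Q` and all
cancellative Haar functions `h_Q`, each of `far₂`, `far₃` being used for the Haar functions with
cancellation in the variable concerned. -/
def Cancel₂₃ (B : (R3 → ℂ) → (R3 → ℂ) → ℂ) (K : R3 → R3 → ℂ)
    (k₁ : Intv → ℝ × ℝ → ℝ × ℝ → ℂ) : Prop :=
  ∀ (I J : Intv) (Q : Rect) (η : Bool),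
    (let full : R3 × R3 → ℂ := fun p =>
      off I.set J.set p.1.1 p.2.1 * far₂ (fun s t => K (p.1.1, s) (p.2.1, t)) Q η p.1.2 p.2.2
    let part : Intv → (ℝ × ℝ) × (ℝ × ℝ) → ℂ := fun R p => far₂ (k₁ R) Q η p.1 p.2
    Integrable full ∧ (∀ R ∈ I.inter J, Integrable (part R)) ∧
    B (tens I.ind (Rect.triple Q).ind) (tens J.ind (Q.haar true η))
      + (∫ p, full p) + (I.inter J).elim 0 (fun R => ∫ p, part R p) = 0) ∧
    (let full : R3 × R3 → ℂ := fun p =>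
      off I.set J.set p.1.1 p.2.1 * far₃ (fun s t => K (p.1.1, s) (p.2.1, t)) Q η p.1.2 p.2.2
    let part : Intv → (ℝ × ℝ) × (ℝ × ℝ) → ℂ := fun R p => far₃ (k₁ R) Q η p.1 p.2
    Integrable full ∧ (∀ R ∈ I.inter J, Integrable (part R)) ∧
    B (tens I.ind (Rect.triple Q).ind) (tens J.ind (Q.haar η true))
      + (∫ p, full p) + (I.inter J).elim 0 (fun R => ∫ p, part R p) = 0)

/-! ### Calderón–Zygmund operators adapted to Zygmund dilations -/

/-- The bilinear pairing `⟨T f, g⟩ = ∫ (T f) g`. -/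
def pairing (T : (R3 → ℂ) → R3 → ℂ) (f g : R3 → ℂ) : ℂ := ∫ x, T f x * g x

/-- The kernel representations and the cancellation assumptions, for a given full kernel `K` and
given partial kernels `k₁`, `k₂₃`, with constant `C`. The pairings of the cancellation conditions
in which the constant function stands on the right are those of the transposed operator. -/
structure Kernels (C : ℝ) (D : ℝ → ℝ → ℝ → ℝ) (α₁ α₂₃ : ℝ) (T : (R3 → ℂ) → R3 → ℂ)
    (K : R3 → R3 → ℂ) (k₁ : Intv → ℝ × ℝ → ℝ × ℝ → ℂ) (k₂₃ : Rect → ℝ → ℝ → ℂ) : Prop where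
  full_rep : ∀ (I J : Intv) (P Q : Rect), Disjoint I.set J.set → Disjoint P.set Q.set →
    IntegrableOn (fun p : R3 × R3 => K p.1 p.2) ((J.set ×ˢ Q.set) ×ˢ (I.set ×ˢ P.set)) ∧
    pairing T (box I P) (box J Q) = ∫ x in J.set ×ˢ Q.set, ∫ y in I.set ×ˢ P.set, K x y
  full_est : FullEstimates C D α₁ α₂₃ K
  full_est_adj : FullEstimates C D α₁ α₂₃ (adj K)
  full_est_adj₁ : FullEstimates C D α₁ α₂₃ (adj₁ K)
  full_est_adj₂₃ : FullEstimates C D α₁ α₂₃ (adj₂₃ K)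
  part₁_rep : ∀ (I : Intv) (P Q : Rect), Disjoint P.set Q.set →
    IntegrableOn (fun p : (ℝ × ℝ) × (ℝ × ℝ) => k₁ I p.1 p.2) (Q.set ×ˢ P.set) ∧
    pairing T (box I P) (box I Q) = ∫ x in Q.set, ∫ y in P.set, k₁ I x y
  part₁_est : ∀ I : Intv, PartialEstimates C D α₂₃ I.len (k₁ I)
  part₁_est_adj : ∀ I : Intv, PartialEstimates C D α₂₃ I.len (adj (k₁ I))
  part₂₃_rep : ∀ (I J : Intv) (P : Rect), Disjoint I.set J.set →
    IntegrableOn (fun p : ℝ × ℝ => k₂₃ P p.1 p.2) (J.set ×ˢ I.set) ∧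
    pairing T (box I P) (box J P) = ∫ x in J.set, ∫ y in I.set, k₂₃ P x y
  part₂₃_est : ∀ P : Rect, CZEstimates (C * P.area) α₁ (k₂₃ P)
  cancel₁ : Cancel₁ (pairing T) K k₂₃
  cancel₁_adj : Cancel₁ (fun f g => pairing T g f) (adj K) (fun P => adj (k₂₃ P))
  cancel₂₃ : Cancel₂₃ (pairing T) K k₁
  cancel₂₃_adj : Cancel₂₃ (fun f g => pairing T g f) (adj K) (fun I => adj (k₁ I))

/-- `T` is a Calderón–Zygmund operator adapted to Zygmund dilations with decay factor `D` and
Hölder exponents `α₁`, `α₂₃`, where all the implicit constants are at most `C`. -/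
structure IsCZZWith (C : ℝ) (D : ℝ → ℝ → ℝ → ℝ) (α₁ α₂₃ : ℝ) (T : (R3 → ℂ) → R3 → ℂ) :
    Prop where
  map_add : ∀ f ∈ stepFun, ∀ g ∈ stepFun, T (f + g) = T f + T g
  map_smul : ∀ c : ℂ, ∀ f ∈ stepFun, T (c • f) = c • T f
  integrable : ∀ (I J : Intv) (P Q : Rect), IntegrableOn (T (box I P)) (J.set ×ˢ Q.set)
  kernels : ∃ K k₁ k₂₃, Kernels C D α₁ α₂₃ T K k₁ k₂₃
  weak_boundedness : ∀ (I : Intv) (P : Rect), I.len * P.1.len = P.2.len →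
    ‖pairing T (box I P) (box I P)‖ ≤ C * (I.len * P.area)

/-- `T` is a `(log, α₁, α₂₃)`-CZZ operator, with all the implicit constants at most `C`. -/
def IsLogCZZWith (C α₁ α₂₃ : ℝ) (T : (R3 → ℂ) → R3 → ℂ) : Prop :=
  IsCZZWith C Dlog α₁ α₂₃ T

/-! ### Fefferman–Pipher multipliers -/

def pd₁ (f : R3 → ℂ) (x : R3) : ℂ := deriv (fun t => f (t, x.2.1, x.2.2)) x.1

def pd₂ (f : R3 → ℂ) (x : R3) : ℂ := deriv (fun t => f (x.1, t, x.2.2)) x.2.1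

def pd₃ (f : R3 → ℂ) (x : R3) : ℂ := deriv (fun t => f (x.1, x.2.1, t)) x.2.2

/-- The mixed partial derivative `∂₁^a ∂₂^b ∂₃^c f`. -/
def pd (a b c : ℕ) (f : R3 → ℂ) : R3 → ℂ := pd₁^[a] (pd₂^[b] (pd₃^[c] f))

/-- The Euclidean norm of the plane. -/
def norm2 (u : ℝ × ℝ) : ℝ := Real.sqrt (u.1 ^ 2 + u.2 ^ 2)

/-- The open set `(ℝ \ {0}) × (ℝ² \ {(0,0)})`. -/
def dom : Set R3 := {ξ | ξ.1 ≠ 0 ∧ ξ.2 ≠ 0}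

/-- All the mixed partial derivatives `∂^α m` with `max α_i ≤ N` exist and are continuous on the
domain. (They do not depend on the order of differentiation, which is recorded here too.) -/
structure IsCN (N : ℕ) (m : R3 → ℂ) : Prop where
  cont : ∀ a b c, a ≤ N → b ≤ N → c ≤ N → ContinuousOn (pd a b c m) dom
  diff₁ : ∀ a b c, a < N → b ≤ N → c ≤ N → ∀ x ∈ dom,
    HasDerivAt (fun t => pd a b c m (t, x.2.1, x.2.2)) (pd (a + 1) b c m x) x.1
  diff₂ : ∀ a b c, a ≤ N → b < N → c ≤ N → ∀ x ∈ dom,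
    HasDerivAt (fun t => pd a b c m (x.1, t, x.2.2)) (pd a (b + 1) c m x) x.2.1
  diff₃ : ∀ a b c, a ≤ N → b ≤ N → c < N → ∀ x ∈ dom,
    HasDerivAt (fun t => pd a b c m (x.1, x.2.1, t)) (pd a b (c + 1) m x) x.2.2

/-- The Zygmund dilation `ρ_{s,t}(x) = (s x₁, t x₂, s t x₃)`. -/
def rho (s t : ℝ) (x : R3) : R3 := (s * x.1, t * x.2.1, s * t * x.2.2)

/-- `A¹ = {ξ : 1/2 < |ξ₁| ≤ 1, 1/2 < |(ξ₂,ξ₃)| ≤ 1}`. -/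
def A1 : Set R3 := {ξ | 1 / 2 < |ξ.1| ∧ |ξ.1| ≤ 1 ∧ 1 / 2 < norm2 ξ.2 ∧ norm2 ξ.2 ≤ 1}

/-- The norm of the multiplier class, with values in `[0, ∞]`: the supremum of
`|∂^α (m ∘ ρ_{s,t})(ξ)|` over `|α|_∞ ≤ N`, `s, t > 0` and `ξ ∈ A¹`. -/
def M1norm (N : ℕ) (m : R3 → ℂ) : ENNReal :=
  ⨆ (a : ℕ) (b : ℕ) (c : ℕ) (_ : a ≤ N ∧ b ≤ N ∧ c ≤ N) (s : ℝ) (t : ℝ) (_ : 0 < s ∧ 0 < t)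
    (ξ : R3) (_ : ξ ∈ A1), ‖pd a b c (m ∘ rho s t) ξ‖ₑ

/-- `m ∈ M¹_Z`; only the values of `m` on `dom` matter. -/
def IsM1 (N : ℕ) (m : R3 → ℂ) : Prop := IsCN N m ∧ M1norm N m < ⊤

/-- Smooth resolutions of unity on `ℝ \ {0}` and on `ℝ² \ {(0,0)}`. -/
structure IsResolution (φ₁ : ℝ → ℝ) (φ₂₃ : ℝ × ℝ → ℝ) : Prop where
  smooth₁ : ContDiff ℝ (⊤ : ℕ∞) φ₁
  smooth₂₃ : ContDiff ℝ (⊤ : ℕ∞) φ₂₃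
  supp₁ : ∀ x, φ₁ x ≠ 0 → 1 / 2 ≤ |x| ∧ |x| ≤ 2
  supp₂₃ : ∀ u, φ₂₃ u ≠ 0 → 1 / 2 ≤ norm2 u ∧ norm2 u ≤ 2
  sum₁ : ∀ x : ℝ, x ≠ 0 → HasSum (fun j : ℤ => φ₁ ((2 : ℝ) ^ (-j) * x)) 1
  sum₂₃ : ∀ u : ℝ × ℝ, u ≠ 0 → HasSum (fun k : ℤ => φ₂₃ ((2 : ℝ) ^ (-k) • u)) 1

/-- The piece `m_{j,k} = ((φ¹ ⊗ φ²³) ∘ ρ_{2^{-j},2^{-k}}) · m`. -/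
def piece (φ₁ : ℝ → ℝ) (φ₂₃ : ℝ × ℝ → ℝ) (m : R3 → ℂ) (j k : ℤ) (ξ : R3) : ℂ :=
  let η := rho ((2 : ℝ) ^ (-j)) ((2 : ℝ) ^ (-k)) ξ
  ((φ₁ η.1 * φ₂₃ η.2 : ℝ) : ℂ) * m ξ

/-- The truncation `m_J = ∑_{|j| ≤ J¹, |k| ≤ J²} m_{j,k}`. -/
def trunc (φ₁ : ℝ → ℝ) (φ₂₃ : ℝ × ℝ → ℝ) (m : R3 → ℂ) (J : ℕ × ℕ) (ξ : R3) : ℂ :=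
  ∑ j ∈ Finset.Icc (-(J.1 : ℤ)) J.1, ∑ k ∈ Finset.Icc (-(J.2 : ℤ)) J.2, piece φ₁ φ₂₃ m j k ξ

/-- The inverse Fourier transform on `ℝ³`. -/
def invFourier (m : R3 → ℂ) (x : R3) : ℂ :=
  ∫ ξ : R3, Complex.exp
    ((2 * Real.pi * (x.1 * ξ.1 + x.2.1 * ξ.2.1 + x.2.2 * ξ.2.2) : ℝ) * Complex.I) * m ξ

/-- The operator `f ↦ K * f`. -/
def convOp (K : R3 → ℂ) (f : R3 → ℂ) : R3 → ℂ :=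
  convolution K f (ContinuousLinearMap.mul ℂ ℂ) volume

end

end Zyg

/-!
The kernel of the truncated multiplier is a finite sum over pairs of dyadic scales. With
`Φ = φ¹ ⊗ φ²³`, the piece `m_{j,k}` is the function `Φ · (m ∘ ρ_{s,t})`, `s = 2^j`, `t = 2^k`,
composed with the inverse dilation, so that its inverse Fourier transform is
`s² t² ψ_{j,k}(ρ_{s,t} x)` with `ψ_{j,k}` the inverse Fourier transform of `Φ · (m ∘ ρ_{s,t})`.

On a neighbourhood `W` of the support of `Φ` the norm of `m` bounds the derivatives of
`m ∘ ρ_{s,t}`, uniformly in `s`, `t` (`IsM1.bddDer`); this uses the full invariance of the norm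
under the two-parameter dilations. Twelve integrations by parts give `ψ_{j,k}` decay of order four
in each variable. The support of `Φ` avoids `ξ₁ = 0` and `(ξ₂, ξ₃) = 0`, hence the symbol can be
divided by `2πi ξ₁` and by `ξ₂² + ξ₃²`: `ψ_{j,k}` is a derivative `∂₁ Θ` and also a divergence
`∂₂ Θ₂ + ∂₃ Θ₃` of functions of the same kind. These properties make up the predicate `IsBump`, and
`Adm.isBump` is the uniform statement.

All the bounds for the kernel `K_J` come from summing the bounds for single pieces over all scales.
* Full kernel: with `R = |x₃| / |x₁ x₂|` the sum over one of the two scale parameters is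
  trapezoidal, and counting its plateau produces the logarithm in `D_log`; the other sum is
  geometric (`exists_sum_zygmund_le`). If `R ≤ 1` one sums over `j` first, and if `R ≥ 1` one sums
  over `k` with `j + k` fixed.
* Partial kernels: they are the averages of the kernel over the square of an interval (`kA`) or of a
  rectangle (`kB`). Integrating the representations `ψ = ∂₁ Θ` and `ψ = ∂₂ Θ₂ + ∂₃ Θ₃` gives a gain
  when the interval is long, or the shorter side of the rectangle large, compared with the scale of
  the piece.
* Weak boundedness: the geometric mean of the two bounds by averages over intervals and rectangles
  is summable in both parameters, for every shape of the rectangle.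

The outcome is recorded in the structure `ZygKernel`, in which the sum over the scales has
disappeared (`exists_zygKernel_ksum`). Differences are covered because `IsBump` has derivatives
built in, and the adjoint kernels only change the signs of the arguments.

The cancellation conditions hold because `K_J` is integrable with vanishing means in `x₁` and in
`(x₂, x₃)`: if the kernel terms `K(c, y)`, which a function `h` with mean zero does not see, are
dropped, the three parts of the pairing add up to the pairing with the constant function `1`
(`cancellation`).
-/

set_option linter.unusedSectionVars false

namespace Zyg

noncomputable section

open Set Filter Topology

/-! ### Symbols with finitely many derivatives on a fixed annulus -/

/-- The coordinate directions of `ℝ³`. -/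
def e (i : Fin 3) : R3 := ![(1, 0, 0), (0, 1, 0), (0, 0, 1)] i

/-- The coordinates of a point of `ℝ³`. -/
def co (i : Fin 3) (x : R3) : ℝ := ![x.1, x.2.1, x.2.2] i

/-- The Euclidean scalar product of `ℝ³`. -/
def dot (x ξ : R3) : ℝ := x.1 * ξ.1 + x.2.1 * ξ.2.1 + x.2.2 * ξ.2.2

/-- The compact product of annuli on which the rescaled pieces of the multiplier live. -/
def K0 : Set R3 := {ξ | 1 / 2 ≤ |ξ.1| ∧ |ξ.1| ≤ 2 ∧ 1 / 2 ≤ norm2 ξ.2 ∧ norm2 ξ.2 ≤ 2}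

/-- An open neighbourhood of `K0` on which the multipliers have uniformly bounded derivatives. -/
def W : Set R3 := {ξ | 1 / 4 < |ξ.1| ∧ |ξ.1| < 4 ∧ 1 / 4 < norm2 ξ.2 ∧ norm2 ξ.2 < 4}

lemma continuous_norm2 : Continuous norm2 := by unfold norm2; fun_prop

lemma isClosed_K0 : IsClosed K0 := by
  have h1 : Continuous fun ξ : R3 => |ξ.1| := by fun_prop
  have h2 : Continuous fun ξ : R3 => norm2 ξ.2 := continuous_norm2.comp continuous_snd
  exact (isClosed_le continuous_const h1).inter ((isClosed_le h1 continuous_const).inter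
    ((isClosed_le continuous_const h2).inter (isClosed_le h2 continuous_const)))

lemma isOpen_W : IsOpen W := by
  have h1 : Continuous fun ξ : R3 => |ξ.1| := by fun_prop
  have h2 : Continuous fun ξ : R3 => norm2 ξ.2 := continuous_norm2.comp continuous_snd
  exact (isOpen_lt continuous_const h1).inter ((isOpen_lt h1 continuous_const).inter
    ((isOpen_lt continuous_const h2).inter (isOpen_lt h2 continuous_const)))

lemma K0_subset_W : K0 ⊆ W := fun ξ ⟨h1, h2, h3, h4⟩ =>
  ⟨by linarith, by linarith, by linarith, by linarith⟩

lemma abs_fst_le_norm2 (u : ℝ × ℝ) : |u.1| ≤ norm2 u := by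
  rw [← Real.sqrt_sq_eq_abs]; exact Real.sqrt_le_sqrt (by nlinarith [sq_nonneg u.2])

lemma abs_snd_le_norm2 (u : ℝ × ℝ) : |u.2| ≤ norm2 u := by
  rw [← Real.sqrt_sq_eq_abs]; exact Real.sqrt_le_sqrt (by nlinarith [sq_nonneg u.1])

lemma isCompact_K0 : IsCompact K0 := by
  refine Metric.isCompact_of_isClosed_isBounded isClosed_K0 ?_
  refine (Metric.isBounded_closedBall (x := (0 : R3)) (r := 2)).subset fun ξ hξ => ?_
  obtain ⟨-, h2, -, h4⟩ := hξ
  simp only [Metric.mem_closedBall, dist_zero_right, Prod.norm_def, Real.norm_eq_abs, sup_le_iff]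
  exact ⟨h2, (abs_fst_le_norm2 _).trans h4, (abs_snd_le_norm2 _).trans h4⟩

/-- `f` has continuous partial derivatives of all orders up to `n` on `U`, all bounded by `M`. -/
def BddDer (U : Set R3) : ℕ → ℝ → (R3 → ℂ) → Prop
  | 0, M, f => ContinuousOn f U ∧ ∀ x ∈ U, ‖f x‖ ≤ M
  | n + 1, M, f => (ContinuousOn f U ∧ ∀ x ∈ U, ‖f x‖ ≤ M) ∧
      ∀ i, ∃ f', (∀ x ∈ U, HasLineDerivAt ℝ f (f' x) x (e i)) ∧ BddDer U n M f'

/-- `g` vanishes off `K0` and has continuous partial derivatives of all orders up to `n` on the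
whole space, all bounded by `M`. -/
def Sym : ℕ → ℝ → (R3 → ℂ) → Prop
  | 0, M, g => Continuous g ∧ (∀ x ∉ K0, g x = 0) ∧ ∀ x, ‖g x‖ ≤ M
  | n + 1, M, g => (Continuous g ∧ (∀ x ∉ K0, g x = 0) ∧ ∀ x, ‖g x‖ ≤ M) ∧
      ∀ i, ∃ g', (∀ x, HasLineDerivAt ℝ g (g' x) x (e i)) ∧ Sym n M g'

/-- Smooth cut-off functions supported in `K0`. -/
def Adm (Φ : R3 → ℂ) : Prop := ContDiff ℝ (⊤ : ℕ∞) Φ ∧ ∀ x ∉ K0, Φ x = 0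

lemma BddDer.pred {U : Set R3} {n : ℕ} {M : ℝ} {f : R3 → ℂ} (h : BddDer U (n + 1) M f) :
    BddDer U n M f := by
  induction n generalizing f with
  | zero => exact h.1
  | succ n ih =>
    refine ⟨h.1, fun i => ?_⟩
    obtain ⟨f', h1, h2⟩ := h.2 i
    exact ⟨f', h1, ih h2⟩

lemma Sym.base {n : ℕ} {M : ℝ} {f : R3 → ℂ} (h : Sym n M f) :
    Continuous f ∧ (∀ x ∉ K0, f x = 0) ∧ ∀ x, ‖f x‖ ≤ M := by
  cases n with
  | zero => exact h
  | succ n => exact h.1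

lemma Sym.mono {n : ℕ} {M M' : ℝ} {f : R3 → ℂ} (h : Sym n M f) (hM : M ≤ M') : Sym n M' f := by
  induction n generalizing f with
  | zero => exact ⟨h.1, h.2.1, fun x => (h.2.2 x).trans hM⟩
  | succ n ih =>
    refine ⟨⟨h.1.1, h.1.2.1, fun x => (h.1.2.2 x).trans hM⟩, fun i => ?_⟩
    obtain ⟨f', h1, h2⟩ := h.2 i
    exact ⟨f', h1, ih h2⟩

lemma Sym.add {n : ℕ} {M M' : ℝ} {f g : R3 → ℂ} (hf : Sym n M f) (hg : Sym n M' g) :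
    Sym n (M + M') (fun x => f x + g x) := by
  have key : ∀ {f g : R3 → ℂ}, (Continuous f ∧ (∀ x ∉ K0, f x = 0) ∧ ∀ x, ‖f x‖ ≤ M) →
      (Continuous g ∧ (∀ x ∉ K0, g x = 0) ∧ ∀ x, ‖g x‖ ≤ M') →
      (Continuous (fun x => f x + g x) ∧ (∀ x ∉ K0, f x + g x = 0) ∧
        ∀ x, ‖f x + g x‖ ≤ M + M') := by
    intro f g hf hg
    exact ⟨hf.1.add hg.1, fun x hx => by simp [hf.2.1 x hx, hg.2.1 x hx],
      fun x => (norm_add_le _ _).trans (add_le_add (hf.2.2 x) (hg.2.2 x))⟩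
  induction n generalizing f g with
  | zero => exact key hf hg
  | succ n ih =>
    refine ⟨key hf.1 hg.1, fun i => ?_⟩
    obtain ⟨f', h1, h2⟩ := hf.2 i
    obtain ⟨g', h3, h4⟩ := hg.2 i
    exact ⟨fun x => f' x + g' x, fun x => HasDerivAt.add (h1 x) (h3 x), ih h2 h4⟩

lemma Adm.deriv {Φ : R3 → ℂ} (h : Adm Φ) (v : R3) : Adm fun x => fderiv ℝ Φ x v := by
  refine ⟨?_, fun x hx => ?_⟩
  · exact (h.1.fderiv_right (m := (⊤ : ℕ∞)) (by simp)).clm_apply contDiff_const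
  · have : Φ =ᶠ[𝓝 x] fun _ => 0 := by
      filter_upwards [isClosed_K0.isOpen_compl.mem_nhds hx] with y hy using h.2 y hy
    simp [this.fderiv_eq]

lemma Adm.bdd {Φ : R3 → ℂ} (h : Adm Φ) : ∃ C, 0 ≤ C ∧ ∀ x, ‖Φ x‖ ≤ C := by
  obtain ⟨C, hC⟩ := isCompact_K0.exists_bound_of_continuousOn h.1.continuous.continuousOn
  refine ⟨max C 0, le_max_right _ _, fun x => ?_⟩
  by_cases hx : x ∈ K0
  · exact (hC x hx).trans (le_max_left _ _)
  · simp [h.2 x hx]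

lemma Adm.eventually {Φ : R3 → ℂ} (h : Adm Φ) {x : R3} (hx : x ∉ W) : ∀ᶠ y in 𝓝 x, Φ y = 0 := by
  filter_upwards [isClosed_K0.isOpen_compl.mem_nhds fun h => hx (K0_subset_W h)] with y hy
    using h.2 y hy

/-- Multiplication by a cut-off function turns a function with bounded derivatives near `K0` into
a globally defined symbol. -/
lemma Adm.mul_bddDer (n : ℕ) {Φ : R3 → ℂ} (hΦ : Adm Φ) : ∃ C, 0 ≤ C ∧ ∀ (f : R3 → ℂ) (M : ℝ),
    0 ≤ M → BddDer W n M f → Sym n (C * M) (fun x => Φ x * f x) := by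
  have base : ∀ {Φ : R3 → ℂ}, Adm Φ → ∃ C, 0 ≤ C ∧ ∀ (f : R3 → ℂ) (M : ℝ), 0 ≤ M →
      BddDer W 0 M f → Sym 0 (C * M) (fun x => Φ x * f x) := by
    intro Φ hΦ
    obtain ⟨C, hC, hb⟩ := hΦ.bdd
    refine ⟨C, hC, fun f M hM hf => ⟨?_, fun x hx => by simp [hΦ.2 x hx], fun x => ?_⟩⟩
    · refine continuous_iff_continuousAt.2 fun x => ?_
      by_cases hx : x ∈ W
      · exact hΦ.1.continuous.continuousAt.mul (hf.1.continuousAt (isOpen_W.mem_nhds hx))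
      · have : (fun x => Φ x * f x) =ᶠ[𝓝 x] fun _ => 0 := by
          filter_upwards [hΦ.eventually hx] with y hy
          simp [hy]
        exact this.continuousAt
    · by_cases hx : x ∈ K0
      · rw [norm_mul]
        exact mul_le_mul (hb x) (hf.2 x (K0_subset_W hx)) (norm_nonneg _) hC
      · simp only [hΦ.2 x hx, zero_mul, norm_zero]; positivity
  induction n generalizing Φ with
  | zero => exact base hΦ
  | succ n ih =>
    obtain ⟨C0, hC0, h0⟩ := base hΦ
    obtain ⟨C1, hC1, h1⟩ := ih hΦ
    choose C2 hC2 h2 using fun i => ih (hΦ.deriv (e i))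
    have hs : 0 ≤ ∑ i, (C2 i + C1) := Finset.sum_nonneg fun i _ => add_nonneg (hC2 i) hC1
    refine ⟨C0 + ∑ i, (C2 i + C1), add_nonneg hC0 hs, fun f M hM hf => ⟨?_, fun i => ?_⟩⟩
    · refine Sym.mono (n := 0) (h0 f M hM hf.1) (mul_le_mul_of_nonneg_right ?_ hM)
      linarith
    · obtain ⟨f', hf1, hf2⟩ := hf.2 i
      refine ⟨fun x => fderiv ℝ Φ x (e i) * f x + Φ x * f' x, fun x => ?_, ?_⟩
      · by_cases hx : x ∈ W
        · have hd : HasLineDerivAt ℝ Φ (fderiv ℝ Φ x (e i)) x (e i) :=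
            ((hΦ.1.differentiable (by simp)) x).hasFDerivAt.hasLineDerivAt (e i)
          have := HasDerivAt.mul hd (hf1 x hx)
          simpa [HasLineDerivAt] using! this
        · have hz : (fun x => Φ x * f x) =ᶠ[𝓝 x] fun _ => 0 := by
            filter_upwards [hΦ.eventually hx] with y hy
            simp [hy]
          have h3 : fderiv ℝ Φ x (e i) = 0 := (hΦ.deriv (e i)).2 x fun h => hx (K0_subset_W h)
          have h4 : Φ x = 0 := hΦ.2 x fun h => hx (K0_subset_W h)
          have h5 : HasLineDerivAt ℝ (fun _ : R3 => (0 : ℂ)) 0 x (e i) := by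
            simpa [HasLineDerivAt] using! hasDerivAt_const (0 : ℝ) (0 : ℂ)
          simpa [h3, h4] using! hz.hasLineDerivAt_iff.2 h5
      · refine ((h2 i f M hM hf.pred).add (h1 f' M hM hf2)).mono ?_
        rw [← add_mul]
        refine mul_le_mul_of_nonneg_right ?_ hM
        have : C2 i + C1 ≤ ∑ i, (C2 i + C1) :=
          Finset.single_le_sum (f := fun i => C2 i + C1)
            (fun i _ => add_nonneg (hC2 i) hC1) (Finset.mem_univ i)
        linarith

/-! ### Decay of inverse Fourier transforms -/

/-- The character `e^{2πi x·ξ}`. -/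
def phase (x ξ : R3) : ℂ := Complex.exp ((2 * Real.pi * dot x ξ : ℝ) * Complex.I)

lemma invFourier_eq (g : R3 → ℂ) (x : R3) : invFourier g x = ∫ ξ, phase x ξ * g ξ := rfl

lemma norm_phase (x ξ : R3) : ‖phase x ξ‖ = 1 := Complex.norm_exp_ofReal_mul_I _

lemma continuous_phase : Continuous fun p : R3 × R3 => phase p.1 p.2 := by
  unfold phase dot; fun_prop

lemma dot_add_smul_left (x ξ : R3) (i : Fin 3) (t : ℝ) :
    dot (x + t • e i) ξ = dot x ξ + t * co i ξ := by
  fin_cases i <;> simp [dot, co, e] <;> ring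

lemma dot_comm (x ξ : R3) : dot x ξ = dot ξ x := by unfold dot; ring

lemma hasDerivAt_phase_left (x ξ : R3) (i : Fin 3) (t : ℝ) :
    HasDerivAt (fun t : ℝ => phase (x + t • e i) ξ)
      (((2 * Real.pi * co i ξ : ℝ) * Complex.I) * phase (x + t • e i) ξ) t := by
  unfold phase
  have h1 : HasDerivAt (fun t : ℝ => 2 * Real.pi * dot (x + t • e i) ξ)
      (2 * Real.pi * co i ξ) t := by
    simp only [dot_add_smul_left]
    simpa using (((hasDerivAt_id t).mul_const (co i ξ)).const_add (dot x ξ)).const_mul (2 * Real.pi)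
  have h2 := (h1.ofReal_comp.mul_const Complex.I).cexp
  rw [mul_comm (((2 * Real.pi * co i ξ : ℝ) : ℂ) * Complex.I)]
  exact h2

lemma hasLineDerivAt_phase (x ξ : R3) (i : Fin 3) :
    HasLineDerivAt ℝ (phase x) (((2 * Real.pi * co i x : ℝ) * Complex.I) * phase x ξ) ξ (e i) := by
  have h := hasDerivAt_phase_left ξ x i 0
  have hc : ∀ a b, phase a b = phase b a := fun a b => by unfold phase; rw [dot_comm]
  unfold HasLineDerivAt
  simpa [hc x] using! h

lemma Sym.integrable_mul {n : ℕ} {M : ℝ} {g : R3 → ℂ} (h : Sym n M g) {f : R3 → ℂ}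
    (hf : Continuous f) : Integrable fun ξ => f ξ * g ξ := by
  refine (hf.mul h.base.1).integrable_of_hasCompactSupport ?_
  refine HasCompactSupport.intro isCompact_K0 fun x hx => ?_
  simp [h.base.2.1 x hx]

lemma continuous_phase_right (x : R3) : Continuous (phase x) :=
  continuous_phase.comp (Continuous.prodMk continuous_const continuous_id)

instance : (volume : Measure (ℝ × ℝ)).IsAddHaarMeasure :=
  inferInstanceAs ((volume : Measure ℝ).prod (volume : Measure ℝ)).IsAddHaarMeasure

instance : (volume : Measure R3).IsAddHaarMeasure :=
  inferInstanceAs ((volume : Measure ℝ).prod (volume : Measure (ℝ × ℝ))).IsAddHaarMeasure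

/-- The volume of `K0`. -/
def V0 : ℝ := (volume K0).toReal

lemma V0_nonneg : 0 ≤ V0 := ENNReal.toReal_nonneg

lemma Sym.norm_invFourier_le {n : ℕ} {M : ℝ} {g : R3 → ℂ} (h : Sym n M g) (x : R3) :
    ‖invFourier g x‖ ≤ V0 * M := by
  rw [invFourier_eq, ← setIntegral_eq_integral_of_forall_compl_eq_zero (s := K0)
    (fun ξ hξ => by simp [h.base.2.1 ξ hξ]), mul_comm]
  refine norm_setIntegral_le_of_norm_le_const isCompact_K0.measure_lt_top fun ξ _ => ?_
  rw [norm_mul, norm_phase, one_mul]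
  exact h.base.2.2 ξ

/-- Integration by parts: up to a constant, multiplying the transform by `x_i` differentiates the
symbol. -/
lemma Sym.exists_mul_coord {n : ℕ} {M : ℝ} {g : R3 → ℂ} (h : Sym (n + 1) M g) (i : Fin 3) :
    ∃ g', Sym n M g' ∧
      ∀ x, invFourier g' x = -(((2 * Real.pi * co i x : ℝ) * Complex.I) * invFourier g x) := by
  obtain ⟨g', h1, h2⟩ := h.2 i
  refine ⟨g', h2, fun x => ?_⟩
  have hp := continuous_phase_right x
  have := integral_bilinear_hasLineDerivAt_right_eq_neg_left_of_integrable
    (μ := (volume : Measure R3)) (f := phase x)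
    (f' := fun ξ => ((2 * Real.pi * co i x : ℝ) * Complex.I) * phase x ξ)
    (g := g) (g' := g') (v := e i) (B := ContinuousLinearMap.mul ℝ ℂ)
    (h.integrable_mul (hp.const_mul _)) (h2.integrable_mul hp) (h.integrable_mul hp)
    (fun ξ _ => hasLineDerivAt_phase x ξ i) (fun ξ _ => h1 ξ)
  simp only [ContinuousLinearMap.mul_apply'] at this
  rw [invFourier_eq, invFourier_eq, this, ← integral_const_mul]
  simp only [mul_assoc]

lemma Sym.pow_mul_norm_invFourier_le {n : ℕ} {M : ℝ} {g : R3 → ℂ} (h : Sym n M g) (x : R3)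
    (i : Fin 3) : |co i x| ^ n * ‖invFourier g x‖ ≤ V0 * M := by
  induction n generalizing g with
  | zero => simpa using h.norm_invFourier_le x
  | succ n ih =>
    obtain ⟨g', h1, h2⟩ := h.exists_mul_coord i
    refine le_trans ?_ (ih h1)
    rw [h2, norm_neg, norm_mul, norm_mul, Complex.norm_I, Complex.norm_real, Real.norm_eq_abs,
      pow_succ, mul_assoc]
    refine mul_le_mul_of_nonneg_left ?_ (by positivity)
    rw [mul_one, abs_mul]
    refine mul_le_mul_of_nonneg_right ?_ (norm_nonneg _)
    refine le_mul_of_one_le_left (abs_nonneg _) ?_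
    rw [abs_of_pos (by positivity)]
    nlinarith [Real.pi_gt_three]

lemma Sym.continuous_invFourier {n : ℕ} {M : ℝ} {g : R3 → ℂ} (h : Sym n M g) :
    Continuous (invFourier g) := by
  refine continuous_of_dominated (F := fun x ξ => phase x ξ * g ξ) (bound := fun ξ => ‖g ξ‖)
    (fun x => ((continuous_phase_right x).mul h.base.1).aestronglyMeasurable) (fun x => ?_) ?_ ?_
  · exact Eventually.of_forall fun ξ => by rw [norm_mul, norm_phase, one_mul]
  · simpa using (h.integrable_mul (f := fun _ => 1) continuous_const).norm
  · refine Eventually.of_forall fun ξ => ?_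
    exact (continuous_phase.comp (Continuous.prodMk continuous_id continuous_const)).mul
      continuous_const

/-- The function `2πi ξ_i`. -/
def mulCoord (i : Fin 3) (ξ : R3) : ℂ := (2 * Real.pi * co i ξ : ℝ) * Complex.I

lemma contDiff_mulCoord (i : Fin 3) : ContDiff ℝ (⊤ : ℕ∞) (mulCoord i) := by
  unfold mulCoord co
  have : ∀ c : R3 → ℝ, ContDiff ℝ (⊤ : ℕ∞) c →
      ContDiff ℝ (⊤ : ℕ∞) fun ξ => ((2 * Real.pi * c ξ : ℝ) : ℂ) * Complex.I := fun c hc =>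
    (Complex.ofRealCLM.contDiff.comp (contDiff_const.mul hc)).mul contDiff_const
  fin_cases i
  · exact this _ contDiff_fst
  · exact this _ (contDiff_fst.comp contDiff_snd)
  · exact this _ (contDiff_snd.comp contDiff_snd)

lemma Sym.hasLineDerivAt_invFourier {n : ℕ} {M : ℝ} {g : R3 → ℂ} (h : Sym n M g) (i : Fin 3)
    (x : R3) : HasLineDerivAt ℝ (invFourier g) (invFourier (fun ξ => mulCoord i ξ * g ξ) x) x
      (e i) := by
  have hm := (contDiff_mulCoord i).continuous
  have := (hasDerivAt_integral_of_dominated_loc_of_deriv_le (μ := volume)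
    (F := fun (t : ℝ) ξ => phase (x + t • e i) ξ * g ξ)
    (F' := fun (t : ℝ) ξ => mulCoord i ξ * phase (x + t • e i) ξ * g ξ) (x₀ := 0)
    (bound := fun ξ => ‖mulCoord i ξ * g ξ‖) (s := univ) univ_mem
    (Eventually.of_forall fun t =>
      ((continuous_phase_right _).mul h.base.1).aestronglyMeasurable)
    (h.integrable_mul (continuous_phase_right _))
    (((hm.mul (continuous_phase_right _)).mul h.base.1).aestronglyMeasurable)
    (Eventually.of_forall fun ξ t _ => by
      rw [norm_mul, norm_mul, norm_phase, mul_one, norm_mul])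
    (h.integrable_mul hm).norm
    (Eventually.of_forall fun ξ t _ => (hasDerivAt_phase_left x ξ i t).mul_const (g ξ))).2
  refine HasDerivAt.congr_deriv (f := fun t : ℝ => invFourier g (x + t • e i)) this ?_
  rw [invFourier_eq]
  refine integral_congr_ae (Eventually.of_forall fun ξ => ?_)
  simp only [zero_smul, add_zero]
  ring

/-! ### Bump functions with cancellation -/

/-- The decaying weight `(1 + |t|)⁻¹`. -/
def w (t : ℝ) : ℝ := (1 + |t|)⁻¹

lemma w_pos (t : ℝ) : 0 < w t := by unfold w; positivity

lemma w_le_one (t : ℝ) : w t ≤ 1 := inv_le_one_of_one_le₀ (by linarith [abs_nonneg t])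

/-- `ψ'` is the partial derivative of `ψ` in the direction `e i`. -/
def Par (i : Fin 3) (ψ ψ' : R3 → ℂ) : Prop := ∀ x, HasLineDerivAt ℝ ψ (ψ' x) x (e i)

/-- Continuity and decay of order four in each variable. -/
def BumpBase (c : ℝ) (ψ : R3 → ℂ) : Prop :=
  Continuous ψ ∧ ∀ x, ‖ψ x‖ ≤ c * (w x.1 ^ 4 * w x.2.1 ^ 4 * w x.2.2 ^ 4)

/-- A decaying function `ψ` with decaying partial derivatives and the cancellation of a tensor
product of wavelets: `ψ = ∂₁ Θ` and `ψ = ∂₂ Θ₂ + ∂₃ Θ₃` with decaying `Θ`, `Θ₂`, `Θ₃`. All the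
functions that occur have the same properties, to depth `d`. -/
def IsBump : ℕ → ℝ → (R3 → ℂ) → Prop
  | 0, c, ψ => BumpBase c ψ
  | d + 1, c, ψ => BumpBase c ψ ∧
      (∀ i, ∃ ψ', Par i ψ ψ' ∧ IsBump d c ψ') ∧
      (∃ Θ, Par 0 Θ ψ ∧ IsBump d c Θ) ∧
      (∃ Θ₂ Θ₃ ψ₂ ψ₃, Par 1 Θ₂ ψ₂ ∧ Par 2 Θ₃ ψ₃ ∧ (∀ x, ψ x = ψ₂ x + ψ₃ x) ∧
        IsBump d c Θ₂ ∧ IsBump d c Θ₃ ∧ IsBump d c ψ₂ ∧ IsBump d c ψ₃)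

lemma IsBump.base {d : ℕ} {c : ℝ} {ψ : R3 → ℂ} (h : IsBump d c ψ) : BumpBase c ψ := by
  cases d with
  | zero => exact h
  | succ n => exact h.1

lemma BumpBase.mono {c c' : ℝ} {ψ : R3 → ℂ} (h : BumpBase c ψ) (hc : c ≤ c') : BumpBase c' ψ :=
  ⟨h.1, fun x => (h.2 x).trans (mul_le_mul_of_nonneg_right hc (by
    have := w_pos x.1; have := w_pos x.2.1; have := w_pos x.2.2; positivity))⟩

lemma IsBump.mono {d : ℕ} {c c' : ℝ} {ψ : R3 → ℂ} (h : IsBump d c ψ) (hc : c ≤ c') :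
    IsBump d c' ψ := by
  induction d generalizing ψ with
  | zero => exact BumpBase.mono h hc
  | succ d ih =>
    obtain ⟨h1, h2, ⟨Θ, h3, h4⟩, Θ₂, Θ₃, ψ₂, ψ₃, h5, h6, h7, h8, h9, h10, h11⟩ := h
    refine ⟨h1.mono hc, fun i => ?_, ⟨Θ, h3, ih h4⟩,
      Θ₂, Θ₃, ψ₂, ψ₃, h5, h6, h7, ih h8, ih h9, ih h10, ih h11⟩
    obtain ⟨ψ', h12, h13⟩ := h2 i
    exact ⟨ψ', h12, ih h13⟩

lemma Adm.smooth_mul {Φ q : R3 → ℂ} (h : Adm Φ) (hq : ∀ x ∈ K0, ContDiffAt ℝ (⊤ : ℕ∞) q x) :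
    Adm fun x => q x * Φ x := by
  refine ⟨contDiff_iff_contDiffAt.2 fun x => ?_, fun x hx => by simp [h.2 x hx]⟩
  by_cases hx : x ∈ K0
  · exact (hq x hx).mul h.1.contDiffAt
  · have : (fun x => q x * Φ x) =ᶠ[𝓝 x] fun _ => 0 := by
      filter_upwards [isClosed_K0.isOpen_compl.mem_nhds hx] with y hy
      simp [h.2 y hy]
    exact contDiffAt_const.congr_of_eventuallyEq this

/-- `-(4π²) |(ξ₂, ξ₃)|²`, the symbol of the Laplacian in the last two variables. -/
def lapSymbol (ξ : R3) : ℂ := mulCoord 1 ξ ^ 2 + mulCoord 2 ξ ^ 2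

lemma mulCoord_zero_ne {ξ : R3} (h : ξ ∈ K0) : mulCoord 0 ξ ≠ 0 := by
  have h1 : ξ.1 ≠ 0 := by
    intro h0; have := h.1; rw [h0, abs_zero] at this; linarith
  unfold mulCoord co
  simp [Complex.I_ne_zero, Real.pi_ne_zero, h1]

lemma lapSymbol_ne {ξ : R3} (h : ξ ∈ K0) : lapSymbol ξ ≠ 0 := by
  have h1 := h.2.2.1
  have h2 : lapSymbol ξ = ((-(4 * Real.pi ^ 2 * (ξ.2.1 ^ 2 + ξ.2.2 ^ 2)) : ℝ) : ℂ) := by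
    unfold lapSymbol mulCoord co
    push_cast
    simp only [mul_pow, Complex.I_sq]
    ring
  rw [h2, Complex.ofReal_ne_zero, neg_ne_zero]
  have h3 : 0 < ξ.2.1 ^ 2 + ξ.2.2 ^ 2 := by
    refine Real.sqrt_pos.1 (lt_of_lt_of_le (by norm_num) h1)
  have := Real.pi_pos
  positivity

lemma contDiffAt_inv_mulCoord {ξ : R3} (h : ξ ∈ K0) :
    ContDiffAt ℝ (⊤ : ℕ∞) (fun ξ => (mulCoord 0 ξ)⁻¹) ξ :=
  (contDiff_mulCoord 0).contDiffAt.inv (mulCoord_zero_ne h)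

lemma contDiffAt_mulCoord_div {ξ : R3} (i : Fin 3) (h : ξ ∈ K0) :
    ContDiffAt ℝ (⊤ : ℕ∞) (fun ξ => mulCoord i ξ * (lapSymbol ξ)⁻¹) ξ :=
  (contDiff_mulCoord i).contDiffAt.mul
    ((((contDiff_mulCoord 1).pow 2).add ((contDiff_mulCoord 2).pow 2)).contDiffAt.inv
      (lapSymbol_ne h))

lemma one_add_pow_le (t : ℝ) (ht : 0 ≤ t) (n : ℕ) : (1 + t) ^ n ≤ 2 ^ n * (1 + t ^ n) := by
  rcases le_total t 1 with h | h
  · calc (1 + t) ^ n ≤ 2 ^ n := pow_le_pow_left₀ (by linarith) (by linarith) n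
      _ ≤ 2 ^ n * (1 + t ^ n) := le_mul_of_one_le_right (by positivity) (by
        linarith [pow_nonneg ht n])
  · calc (1 + t) ^ n ≤ (2 * t) ^ n := pow_le_pow_left₀ (by linarith) (by linarith) n
      _ = 2 ^ n * t ^ n := mul_pow _ _ _
      _ ≤ 2 ^ n * (1 + t ^ n) := mul_le_mul_of_nonneg_left (by linarith) (by positivity)

/-- Isotropic decay of order twelve gives decay of order four in each variable. -/
lemma Sym.bumpBase {M : ℝ} {g : R3 → ℂ} (h : Sym 12 M g) :
    BumpBase (2 ^ 14 * V0 * M) (invFourier g) := by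
  refine ⟨h.continuous_invFourier, fun x => ?_⟩
  have h0 := h.norm_invFourier_le x
  set a := 1 + |x.1| with ha
  set b := 1 + |x.2.1| with hb
  set c := 1 + |x.2.2| with hc
  set Y := ‖invFourier g x‖ with hY
  have hi : ∀ i, (1 + |co i x|) ^ 12 * Y ≤ 2 ^ 13 * V0 * M := fun i => by
    have h1 := h.pow_mul_norm_invFourier_le x i
    have h2 := mul_le_mul_of_nonneg_right (one_add_pow_le |co i x| (abs_nonneg _) 12)
      (norm_nonneg (invFourier g x))
    rw [← hY] at h1 h2
    linarith
  have ha1 : 1 ≤ a := by linarith [abs_nonneg x.1]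
  have hb1 : 1 ≤ b := by linarith [abs_nonneg x.2.1]
  have hc1 : 1 ≤ c := by linarith [abs_nonneg x.2.2]
  have hY0 : 0 ≤ Y := norm_nonneg _
  have hVM : 0 ≤ V0 * M := hY0.trans h0
  have hmain : a ^ 4 * b ^ 4 * c ^ 4 * Y ≤ 2 ^ 14 * V0 * M := by
    have key : ∀ d : ℝ, 1 ≤ d → a ≤ d → b ≤ d → c ≤ d → d ^ 12 * Y ≤ 2 ^ 13 * V0 * M →
        a ^ 4 * b ^ 4 * c ^ 4 * Y ≤ 2 ^ 14 * V0 * M := by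
      intro d hd h1 h2 h3 h4
      have : a ^ 4 * b ^ 4 * c ^ 4 ≤ d ^ 4 * d ^ 4 * d ^ 4 := by gcongr
      calc a ^ 4 * b ^ 4 * c ^ 4 * Y ≤ d ^ 4 * d ^ 4 * d ^ 4 * Y :=
            mul_le_mul_of_nonneg_right this hY0
        _ = d ^ 12 * Y := by ring
        _ ≤ 2 ^ 14 * V0 * M := by linarith
    have e0 : a ^ 12 * Y ≤ 2 ^ 13 * V0 * M := hi 0
    have e1 : b ^ 12 * Y ≤ 2 ^ 13 * V0 * M := hi 1
    have e2 : c ^ 12 * Y ≤ 2 ^ 13 * V0 * M := hi 2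
    rcases le_total a b with h1 | h1
    · rcases le_total b c with h2 | h2
      · exact key c hc1 (h1.trans h2) h2 le_rfl e2
      · exact key b hb1 h1 le_rfl h2 e1
    · rcases le_total a c with h2 | h2
      · exact key c hc1 h2 (h1.trans h2) le_rfl e2
      · exact key a ha1 le_rfl h1 h2 e0
  have e : w x.1 ^ 4 * w x.2.1 ^ 4 * w x.2.2 ^ 4 = (a ^ 4 * b ^ 4 * c ^ 4)⁻¹ := by
    simp only [w, ← ha, ← hb, ← hc, inv_pow, mul_inv]
  rw [e, ← div_eq_mul_inv, le_div_iff₀ (by positivity), mul_comm]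
  exact hmain

lemma invFourier_add {n n' : ℕ} {M M' : ℝ} {f g : R3 → ℂ} (hf : Sym n M f) (hg : Sym n' M' g)
    (x : R3) : invFourier (fun ξ => f ξ + g ξ) x = invFourier f x + invFourier g x := by
  simp only [invFourier_eq, mul_add]
  exact integral_add (hf.integrable_mul (continuous_phase_right x))
    (hg.integrable_mul (continuous_phase_right x))

/-- The inverse Fourier transform of a cut-off symbol is a bump function: derivatives and
primitives correspond to other cut-off functions, because `K0` avoids `ξ₁ = 0` and
`(ξ₂, ξ₃) = 0`. -/
lemma Adm.isBump (d : ℕ) {Φ : R3 → ℂ} (hΦ : Adm Φ) : ∃ C, 0 ≤ C ∧ ∀ (f : R3 → ℂ) (M : ℝ),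
    0 ≤ M → BddDer W 12 M f → IsBump d (C * M) (invFourier fun ξ => Φ ξ * f ξ) := by
  have base : ∀ {Φ : R3 → ℂ}, Adm Φ → ∃ C, 0 ≤ C ∧ ∀ (f : R3 → ℂ) (M : ℝ), 0 ≤ M →
      BddDer W 12 M f → BumpBase (C * M) (invFourier fun ξ => Φ ξ * f ξ) := by
    intro Φ hΦ
    obtain ⟨C, hC, h⟩ := hΦ.mul_bddDer 12
    refine ⟨2 ^ 14 * V0 * C, by have := V0_nonneg; positivity, fun f M hM hf => ?_⟩
    rw [mul_assoc]
    exact (h f M hM hf).bumpBase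
  induction d generalizing Φ with
  | zero => exact base hΦ
  | succ d ih =>
    have aD : ∀ i, Adm fun ξ => mulCoord i ξ * Φ ξ := fun i =>
      hΦ.smooth_mul fun ξ _ => (contDiff_mulCoord i).contDiffAt
    have aI : Adm fun ξ => (mulCoord 0 ξ)⁻¹ * Φ ξ :=
      hΦ.smooth_mul fun ξ h => contDiffAt_inv_mulCoord h
    have aT : ∀ i, Adm fun ξ => mulCoord i ξ * (lapSymbol ξ)⁻¹ * Φ ξ := fun i =>
      hΦ.smooth_mul fun ξ h => contDiffAt_mulCoord_div i h
    have aP : ∀ i, Adm fun ξ => mulCoord i ξ * (mulCoord i ξ * (lapSymbol ξ)⁻¹ * Φ ξ) := fun i =>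
      (aT i).smooth_mul fun ξ _ => (contDiff_mulCoord i).contDiffAt
    obtain ⟨C0, hC0, h0⟩ := base hΦ
    choose CD hCD hD using fun i => ih (aD i)
    obtain ⟨CI, hCI, hI⟩ := ih aI
    choose CT hCT hT using fun i => ih (aT i)
    choose CP hCP hP using fun i => ih (aP i)
    have hs : ∀ i, CD i + CT i + CP i ≤ ∑ i, (CD i + CT i + CP i) := fun i =>
      Finset.single_le_sum (f := fun i => CD i + CT i + CP i)
        (fun i _ => add_nonneg (add_nonneg (hCD i) (hCT i)) (hCP i)) (Finset.mem_univ i)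
    have hs0 : 0 ≤ ∑ i, (CD i + CT i + CP i) :=
      (add_nonneg (add_nonneg (hCD 0) (hCT 0)) (hCP 0)).trans (hs 0)
    set S := ∑ i, (CD i + CT i + CP i) with hS
    have line : ∀ (i : Fin 3) {Ψ : R3 → ℂ}, Adm Ψ → ∀ (f : R3 → ℂ) (M : ℝ), 0 ≤ M →
        BddDer W 12 M f → Par i (invFourier fun ξ => Ψ ξ * f ξ)
          (invFourier fun ξ => mulCoord i ξ * Ψ ξ * f ξ) := by
      intro i Ψ hΨ f M hM hf x
      obtain ⟨C, -, h⟩ := hΨ.mul_bddDer 12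
      simp only [mul_assoc]
      exact (h f M hM hf).hasLineDerivAt_invFourier i x
    refine ⟨C0 + CI + S, by positivity, fun f M hM hf => ?_⟩
    have mono : ∀ {C' : ℝ} {ψ : R3 → ℂ}, C' ≤ C0 + CI + S → IsBump d (C' * M) ψ →
        IsBump d ((C0 + CI + S) * M) ψ := fun hC h =>
      h.mono (mul_le_mul_of_nonneg_right hC hM)
    refine ⟨(h0 f M hM hf).mono (mul_le_mul_of_nonneg_right (by linarith) hM), fun i => ?_, ?_, ?_⟩
    · exact ⟨_, line i hΦ f M hM hf, mono (by linarith [hs i, hCT i, hCP i]) (hD i f M hM hf)⟩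
    · refine ⟨_, ?_, mono (by linarith) (hI f M hM hf)⟩
      convert line 0 aI f M hM hf using 3 with ξ
      by_cases h : ξ ∈ K0
      · rw [mul_inv_cancel_left₀ (mulCoord_zero_ne h)]
      · simp [hΦ.2 ξ h]
    · refine ⟨_, _, _, _, line 1 (aT 1) f M hM hf, line 2 (aT 2) f M hM hf, fun x => ?_,
        mono (by linarith [hs 1, hCD 1, hCP 1]) (hT 1 f M hM hf),
        mono (by linarith [hs 2, hCD 2, hCP 2]) (hT 2 f M hM hf),
        mono (by linarith [hs 1, hCD 1, hCT 1]) (hP 1 f M hM hf),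
        mono (by linarith [hs 2, hCD 2, hCT 2]) (hP 2 f M hM hf)⟩
      obtain ⟨C1, -, h1⟩ := (aP 1).mul_bddDer 12
      obtain ⟨C2, -, h2⟩ := (aP 2).mul_bddDer 12
      rw [← invFourier_add (h1 f M hM hf) (h2 f M hM hf)]
      congr 1
      funext ξ
      by_cases h : ξ ∈ K0
      · have := lapSymbol_ne h
        have e : mulCoord 1 ξ * (mulCoord 1 ξ * (lapSymbol ξ)⁻¹ * Φ ξ) * f ξ +
            mulCoord 2 ξ * (mulCoord 2 ξ * (lapSymbol ξ)⁻¹ * Φ ξ) * f ξ =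
            (lapSymbol ξ * (lapSymbol ξ)⁻¹) * (Φ ξ * f ξ) := by
          rw [show lapSymbol ξ * (lapSymbol ξ)⁻¹ =
            (mulCoord 1 ξ ^ 2 + mulCoord 2 ξ ^ 2) * (lapSymbol ξ)⁻¹ from rfl]
          ring
        rw [e, mul_inv_cancel₀ this, one_mul]
      · simp [hΦ.2 ξ h]

/-! ### Rescaled multipliers -/

lemma pd₁_scale (κ : ℂ) (g : R3 → ℂ) (s t : ℝ) :
    pd₁ (fun x => κ * g (rho s t x)) = fun x => (κ * s) * pd₁ g (rho s t x) := by
  funext x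
  simp only [pd₁, rho]
  rw [deriv_const_mul_field, deriv_comp_mul_left s (fun u => g (u, t * x.2.1, s * t * x.2.2))]
  simp [mul_assoc]

lemma pd₂_scale (κ : ℂ) (g : R3 → ℂ) (s t : ℝ) :
    pd₂ (fun x => κ * g (rho s t x)) = fun x => (κ * t) * pd₂ g (rho s t x) := by
  funext x
  simp only [pd₂, rho]
  rw [deriv_const_mul_field, deriv_comp_mul_left t (fun u => g (s * x.1, u, s * t * x.2.2))]
  simp [mul_assoc]

lemma pd₃_scale (κ : ℂ) (g : R3 → ℂ) (s t : ℝ) :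
    pd₃ (fun x => κ * g (rho s t x)) = fun x => (κ * (s * t : ℝ)) * pd₃ g (rho s t x) := by
  funext x
  simp only [pd₃, rho]
  rw [deriv_const_mul_field, deriv_comp_mul_left (s * t) (fun u => g (s * x.1, t * x.2.1, u))]
  simp [mul_assoc]

lemma iterate_scale {P : (R3 → ℂ) → R3 → ℂ} {σ : ℂ} {s t : ℝ}
    (hP : ∀ (κ : ℂ) (g : R3 → ℂ), P (fun x => κ * g (rho s t x)) =
      fun x => (κ * σ) * P g (rho s t x)) (n : ℕ) (κ : ℂ) (g : R3 → ℂ) :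
    P^[n] (fun x => κ * g (rho s t x)) = fun x => (κ * σ ^ n) * P^[n] g (rho s t x) := by
  induction n generalizing κ g with
  | zero => simp
  | succ n ih => simp only [Function.iterate_succ, Function.comp, hP, ih, pow_succ']; simp [mul_assoc]

lemma pd_scale (a b c : ℕ) (m : R3 → ℂ) (s t : ℝ) (x : R3) :
    pd a b c (m ∘ rho s t) x =
      ((s : ℂ) ^ a * (t : ℂ) ^ b * ((s * t : ℝ) : ℂ) ^ c) * pd a b c m (rho s t x) := by
  have h0 : m ∘ rho s t = fun x => 1 * m (rho s t x) := by funext x; simp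
  unfold pd
  rw [h0, iterate_scale (fun κ g => pd₃_scale κ g s t), iterate_scale (fun κ g => pd₂_scale κ g s t),
    iterate_scale (fun κ g => pd₁_scale κ g s t)]
  ring

lemma norm2_smul (t : ℝ) (ht : 0 ≤ t) (a b : ℝ) : norm2 (t * a, t * b) = t * norm2 (a, b) := by
  unfold norm2
  rw [show (t * a) ^ 2 + (t * b) ^ 2 = t ^ 2 * (a ^ 2 + b ^ 2) by ring,
    Real.sqrt_mul (sq_nonneg t), Real.sqrt_sq ht]

lemma norm2_pos {u : ℝ × ℝ} (h : u ≠ 0) : 0 < norm2 u := by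
  refine Real.sqrt_pos.2 ?_
  by_contra! h'
  refine h (Prod.ext ?_ ?_) <;> simp <;> nlinarith [sq_nonneg u.1, sq_nonneg u.2]

lemma IsM1.norm_pd_rho_le {N : ℕ} {m : R3 → ℂ} (hm : IsM1 N m) {a b c : ℕ} (ha : a ≤ N)
    (hb : b ≤ N) (hc : c ≤ N) {s t : ℝ} (hs : 0 < s) (ht : 0 < t) {ξ : R3} (hξ : ξ ∈ A1) :
    ‖pd a b c (m ∘ rho s t) ξ‖ ≤ (M1norm N m).toReal := by
  have h : ‖pd a b c (m ∘ rho s t) ξ‖ₑ ≤ M1norm N m := by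
    unfold M1norm
    refine le_iSup_of_le a <| le_iSup_of_le b <| le_iSup_of_le c <| le_iSup_of_le ⟨ha, hb, hc⟩ <|
      le_iSup_of_le s <| le_iSup_of_le t <| le_iSup_of_le ⟨hs, ht⟩ <| le_iSup_of_le ξ <|
      le_iSup_of_le hξ le_rfl
  have := ENNReal.toReal_mono hm.2.ne h
  simpa using this

/-- The invariant form of the multiplier condition: the dilation with parameters `|x₁|` and
`|(x₂, x₃ / x₁)|` takes a point of `A¹` to `x`. -/
lemma IsM1.norm_pd_le {N : ℕ} {m : R3 → ℂ} (hm : IsM1 N m) {a b c : ℕ} (ha : a ≤ N)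
    (hb : b ≤ N) (hc : c ≤ N) {s t : ℝ} (hs : 0 < s) (ht : 0 < t) {x : R3} (hx : x ∈ dom) :
    ‖pd a b c (m ∘ rho s t) x‖ * (|x.1| ^ a * norm2 (x.2.1, x.2.2 / |x.1|) ^ b *
      (|x.1| * norm2 (x.2.1, x.2.2 / |x.1|)) ^ c) ≤ (M1norm N m).toReal := by
  have h1 : 0 < |x.1| := abs_pos.2 hx.1
  set σ := |x.1| with hσ
  have h2 : 0 < norm2 (x.2.1, x.2.2 / σ) := by
    refine norm2_pos fun h => hx.2 ?_
    have e1 := congrArg Prod.fst h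
    have e2 := congrArg Prod.snd h
    simp only [Prod.fst_zero, Prod.snd_zero, div_eq_zero_iff, h1.ne', or_false] at e1 e2
    exact Prod.ext e1 e2
  set τ := norm2 (x.2.1, x.2.2 / σ) with hτ
  have hA : (x.1 / σ, x.2.1 / τ, x.2.2 / (σ * τ)) ∈ A1 := by
    have e1 : |x.1 / σ| = 1 := by rw [abs_div, abs_of_pos h1, ← hσ, div_self h1.ne']
    have e2 : norm2 (x.2.1 / τ, x.2.2 / (σ * τ)) = 1 := by
      have := norm2_smul τ⁻¹ (by positivity) x.2.1 (x.2.2 / σ)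
      rw [← hτ, inv_mul_cancel₀ h2.ne'] at this
      rw [← this]
      congr 2 <;> field_simp
    refine ⟨?_, ?_, ?_, ?_⟩ <;> simp only [e1, e2] <;> norm_num
  have key := hm.norm_pd_rho_le ha hb hc (mul_pos hs h1) (mul_pos ht h2) hA
  refine le_trans (le_of_eq ?_) key
  have hr : rho (s * σ) (t * τ) (x.1 / σ, x.2.1 / τ, x.2.2 / (σ * τ)) = rho s t x := by
    simp only [rho]
    refine Prod.ext ?_ (Prod.ext ?_ ?_) <;> simp only <;> field_simp
  rw [pd_scale, pd_scale, hr]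
  simp only [norm_mul, norm_pow, Complex.norm_real, Real.norm_eq_abs, abs_of_pos hs,
    abs_of_pos ht, abs_of_pos h1, abs_of_pos h2]
  ring

lemma W_subset_dom : W ⊆ dom := by
  rintro ξ ⟨h1, -, h3, -⟩
  refine ⟨fun h => ?_, fun h => ?_⟩
  · rw [h, abs_zero] at h1; linarith
  · rw [h] at h3; norm_num [norm2] at h3

lemma rho_mem_dom {s t : ℝ} (hs : 0 < s) (ht : 0 < t) {x : R3} (hx : x ∈ dom) :
    rho s t x ∈ dom := by
  refine ⟨mul_ne_zero hs.ne' hx.1, fun h => hx.2 ?_⟩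
  have e1 := congrArg Prod.fst h
  have e2 := congrArg Prod.snd h
  simp only [rho, Prod.fst_zero, Prod.snd_zero, mul_eq_zero, hs.ne', ht.ne', false_or] at e1 e2
  exact Prod.ext e1 e2

lemma continuous_rho (s t : ℝ) : Continuous (rho s t) := by unfold rho; fun_prop

lemma hasDerivAt_comp_const_add_zero_iff {f : ℝ → ℂ} {f' : ℂ} (a : ℝ) :
    HasDerivAt (fun t => f (a + t)) f' 0 ↔ HasDerivAt f f' a := by
  constructor
  · intro h
    have h1 : HasDerivAt (fun t => f (a + t)) f' (-a + a) := by simpa using h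
    simpa using h1.comp_const_add (-a) a
  · intro h
    exact HasDerivAt.comp_const_add a 0 (by simpa using h)

lemma hasLineDerivAt_iff_slice₁ {f : R3 → ℂ} {f' : ℂ} {x : R3} :
    HasLineDerivAt ℝ f f' x (e 0) ↔ HasDerivAt (fun t => f (t, x.2.1, x.2.2)) f' x.1 := by
  rw [← hasDerivAt_comp_const_add_zero_iff]
  simp [HasLineDerivAt, e, Prod.smul_def, Prod.add_def]

lemma hasLineDerivAt_iff_slice₂ {f : R3 → ℂ} {f' : ℂ} {x : R3} :
    HasLineDerivAt ℝ f f' x (e 1) ↔ HasDerivAt (fun t => f (x.1, t, x.2.2)) f' x.2.1 := by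
  rw [← hasDerivAt_comp_const_add_zero_iff]
  simp [HasLineDerivAt, e, Prod.smul_def, Prod.add_def]

lemma hasLineDerivAt_iff_slice₃ {f : R3 → ℂ} {f' : ℂ} {x : R3} :
    HasLineDerivAt ℝ f f' x (e 2) ↔ HasDerivAt (fun t => f (x.1, x.2.1, t)) f' x.2.2 := by
  rw [← hasDerivAt_comp_const_add_zero_iff]
  simp [HasLineDerivAt, e, Prod.smul_def, Prod.add_def]

lemma IsM1.norm_pd_le_on_W {N : ℕ} {m : R3 → ℂ} (hm : IsM1 N m) {a b c : ℕ} (ha : a ≤ N)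
    (hb : b ≤ N) (hc : c ≤ N) (habc : a + b + c ≤ 12) {s t : ℝ} (hs : 0 < s) (ht : 0 < t) {x : R3}
    (hx : x ∈ W) : ‖pd a b c (m ∘ rho s t) x‖ ≤ 64 ^ 12 * (M1norm N m).toReal := by
  have h := hm.norm_pd_le ha hb hc hs ht (W_subset_dom hx)
  obtain ⟨h1, h2, h3, -⟩ := hx
  set σ := |x.1| with hσ
  have hτ : 1 / 16 ≤ norm2 (x.2.1, x.2.2 / σ) := by
    have e1 : norm2 (1 / 4 * x.2.1, 1 / 4 * x.2.2) = 1 / 4 * norm2 x.2 := norm2_smul _ (by norm_num) _ _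
    have e2 : norm2 (1 / 4 * x.2.1, 1 / 4 * x.2.2) ≤ norm2 (x.2.1, x.2.2 / σ) := by
      refine Real.sqrt_le_sqrt ?_
      have e3 : (1 / 4 * x.2.2) ^ 2 ≤ (x.2.2 / σ) ^ 2 := by
        have : (1 / 4) ^ 2 ≤ (1 / σ) ^ 2 :=
          pow_le_pow_left₀ (by norm_num) (one_div_le_one_div_of_le (by linarith) h2.le) 2
        rw [mul_pow, div_eq_mul_one_div x.2.2, mul_pow, mul_comm]
        exact mul_le_mul_of_nonneg_left this (sq_nonneg _)
      simp only
      nlinarith [sq_nonneg x.2.1]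
    linarith
  set τ := norm2 (x.2.1, x.2.2 / σ) with hτ'
  have h4 : (1 / 64 : ℝ) ^ 12 ≤ σ ^ a * τ ^ b * (σ * τ) ^ c := by
    calc (1 / 64 : ℝ) ^ 12 ≤ (1 / 64) ^ (a + b + c) :=
          pow_le_pow_of_le_one (by norm_num) (by norm_num) habc
      _ = (1 / 64) ^ a * (1 / 64) ^ b * (1 / 64) ^ c := by rw [pow_add, pow_add]
      _ ≤ σ ^ a * τ ^ b * (σ * τ) ^ c := by
          have : (1 / 64 : ℝ) ≤ σ * τ := by nlinarith
          gcongr <;> linarith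
  have h5 := (mul_le_mul_of_nonneg_left h4 (norm_nonneg (pd a b c (m ∘ rho s t) x))).trans h
  rw [one_div, inv_pow, ← div_eq_mul_inv, div_le_iff₀ (by positivity)] at h5
  linarith

/-- The multiplier condition controls the derivatives of total order at most twelve of all the
rescaled multipliers on the fixed annulus `W`. -/
lemma IsM1.bddDer {N : ℕ} (hN : 12 ≤ N) {m : R3 → ℂ} (hm : IsM1 N m) {s t : ℝ} (hs : 0 < s)
    (ht : 0 < t) : BddDer W 12 (64 ^ 12 * (M1norm N m).toReal) (m ∘ rho s t) := by
  have base : ∀ a b c, a + b + c ≤ 12 → ContinuousOn (pd a b c (m ∘ rho s t)) W ∧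
      ∀ x ∈ W, ‖pd a b c (m ∘ rho s t) x‖ ≤ 64 ^ 12 * (M1norm N m).toReal := by
    intro a b c h
    refine ⟨?_, fun x hx => hm.norm_pd_le_on_W (by omega) (by omega) (by omega) h hs ht hx⟩
    have h1 : pd a b c (m ∘ rho s t) = fun x =>
      ((s : ℂ) ^ a * (t : ℂ) ^ b * ((s * t : ℝ) : ℂ) ^ c) * pd a b c m (rho s t x) :=
      funext fun x => pd_scale a b c m s t x
    rw [h1]
    exact continuousOn_const.mul ((hm.1.cont a b c (by omega) (by omega) (by omega)).comp
      (continuous_rho s t).continuousOn fun x hx => rho_mem_dom hs ht (W_subset_dom hx))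
  -- the order of differentiation in `pd` is fixed; `IsCN` provides the derivatives in all directions
  have main : ∀ n a b c, a + b + c + n ≤ 12 →
      BddDer W n (64 ^ 12 * (M1norm N m).toReal) (pd a b c (m ∘ rho s t)) := by
    intro n
    induction n with
    | zero => exact fun a b c h => base a b c h
    | succ n ih =>
      intro a b c h
      refine ⟨base a b c (by omega), fun i => ?_⟩
      fin_cases i
      · refine ⟨pd (a + 1) b c (m ∘ rho s t), fun x hx => ?_, ih _ _ _ (by omega)⟩
        simp only [Fin.zero_eta, hasLineDerivAt_iff_slice₁, pd_scale]
        have h1 := hm.1.diff₁ a b c (by omega) (by omega) (by omega) _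
          (rho_mem_dom hs ht (W_subset_dom hx))
        have h2 := (h1.scomp x.1 ((hasDerivAt_id x.1).const_mul s)).const_mul
          ((s : ℂ) ^ a * (t : ℂ) ^ b * ((s * t : ℝ) : ℂ) ^ c)
        refine h2.congr_deriv ?_
        simp only [mul_one, Complex.real_smul]
        ring
      · refine ⟨pd a (b + 1) c (m ∘ rho s t), fun x hx => ?_, ih _ _ _ (by omega)⟩
        simp only [Fin.mk_one, hasLineDerivAt_iff_slice₂, pd_scale]
        have h1 := hm.1.diff₂ a b c (by omega) (by omega) (by omega) _
          (rho_mem_dom hs ht (W_subset_dom hx))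
        have h2 := (h1.scomp x.2.1 ((hasDerivAt_id x.2.1).const_mul t)).const_mul
          ((s : ℂ) ^ a * (t : ℂ) ^ b * ((s * t : ℝ) : ℂ) ^ c)
        refine h2.congr_deriv ?_
        simp only [mul_one, Complex.real_smul]
        ring
      · refine ⟨pd a b (c + 1) (m ∘ rho s t), fun x hx => ?_, ih _ _ _ (by omega)⟩
        simp only [Fin.reduceFinMk, hasLineDerivAt_iff_slice₃, pd_scale]
        have h1 := hm.1.diff₃ a b c (by omega) (by omega) (by omega) _
          (rho_mem_dom hs ht (W_subset_dom hx))
        have h2 := (h1.scomp x.2.2 ((hasDerivAt_id x.2.2).const_mul (s * t))).const_mul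
          ((s : ℂ) ^ a * (t : ℂ) ^ b * ((s * t : ℝ) : ℂ) ^ c)
        refine h2.congr_deriv ?_
        simp only [mul_one, Complex.real_smul]
        ring
  exact main 12 0 0 0 (by norm_num)

/-! ### Dyadic sums -/

lemma summable_pow_natAbs {r : ℝ} (h0 : 0 ≤ r) (h1 : r < 1) :
    Summable fun l : ℤ => r ^ l.natAbs := by
  refine Summable.of_nat_of_neg ?_ ?_ <;> simpa using summable_geometric_of_lt_one h0 h1

/-- Two-sided geometric sums, uniformly in the position of the peak. -/
lemma exists_sum_min_inv_le {β : ℝ} (hβ : 1 < β) : ∃ C, 0 ≤ C ∧ ∀ (S : Finset ℤ) (x : ℝ), 0 < x →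
    ∑ j ∈ S, min (β ^ j * x) (β ^ j * x)⁻¹ ≤ C := by
  have hβ0 : 0 < β := by linarith
  have hr0 : 0 ≤ β⁻¹ := by positivity
  have hsum := summable_pow_natAbs hr0 (inv_lt_one_of_one_lt₀ hβ)
  refine ⟨β * ∑' l : ℤ, β⁻¹ ^ l.natAbs, mul_nonneg hβ0.le (tsum_nonneg fun _ => by positivity),
    fun S x hx => ?_⟩
  obtain ⟨n, hn1, hn2⟩ := exists_mem_Ico_zpow hx hβ
  have hterm : ∀ j : ℤ, min (β ^ j * x) (β ^ j * x)⁻¹ ≤ β * β⁻¹ ^ (j + n).natAbs := by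
    intro j
    have hp : 0 < β ^ j := zpow_pos hβ0 j
    rcases le_total 0 (j + n) with h | h
    · refine (min_le_right _ _).trans ?_
      have e : β⁻¹ ^ (j + n).natAbs = (β ^ (j + n))⁻¹ := by
        rw [inv_pow, ← zpow_natCast, Int.natAbs_of_nonneg h]
      rw [e]
      have h1 : β ^ (j + n) ≤ β ^ j * x := by
        rw [zpow_add₀ hβ0.ne']; exact mul_le_mul_of_nonneg_left hn1 hp.le
      calc (β ^ j * x)⁻¹ ≤ (β ^ (j + n))⁻¹ := inv_anti₀ (zpow_pos hβ0 _) h1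
        _ ≤ β * (β ^ (j + n))⁻¹ := le_mul_of_one_le_left (inv_nonneg.2 (zpow_pos hβ0 _).le) hβ.le
    · refine (min_le_left _ _).trans ?_
      have e : β⁻¹ ^ (j + n).natAbs = β ^ (j + n) := by
        rw [inv_pow, ← zpow_natCast, Int.ofNat_natAbs_of_nonpos h, zpow_neg, inv_inv]
      rw [e]
      calc β ^ j * x ≤ β ^ j * β ^ (n + 1) := mul_le_mul_of_nonneg_left hn2.le hp.le
        _ = β * β ^ (j + n) := by
          rw [← zpow_add₀ hβ0.ne', ← zpow_one_add₀ hβ0.ne']; congr 1; ring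
  calc ∑ j ∈ S, min (β ^ j * x) (β ^ j * x)⁻¹ ≤ ∑ j ∈ S, β * β⁻¹ ^ (j + n).natAbs :=
        Finset.sum_le_sum fun j _ => hterm j
    _ = β * ∑ j ∈ S, β⁻¹ ^ (j + n).natAbs := by rw [Finset.mul_sum]
    _ ≤ β * ∑' l : ℤ, β⁻¹ ^ l.natAbs := by
      refine mul_le_mul_of_nonneg_left ?_ hβ0.le
      have hs : Summable fun j : ℤ => β⁻¹ ^ (j + n).natAbs :=
        ((Equiv.addRight n).summable_iff (f := fun l : ℤ => β⁻¹ ^ l.natAbs)).2 hsum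
      have ht : ∑' j : ℤ, β⁻¹ ^ (j + n).natAbs = ∑' l : ℤ, β⁻¹ ^ l.natAbs :=
        (Equiv.addRight n).tsum_eq fun l : ℤ => β⁻¹ ^ l.natAbs
      rw [← ht]
      exact hs.sum_le_tsum S fun j _ => pow_nonneg hr0 _

lemma card_le_of_forall_mem (S : Finset ℤ) {p q : ℝ} (hpq : p ≤ q)
    (h : ∀ j ∈ S, p ≤ j ∧ (j : ℝ) ≤ q) : (S.card : ℝ) ≤ q - p + 1 := by
  have hsub : S ⊆ Finset.Icc ⌈p⌉ ⌊q⌋ := fun j hj =>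
    Finset.mem_Icc.2 ⟨Int.ceil_le.2 (h j hj).1, Int.le_floor.2 (h j hj).2⟩
  have h1 := Finset.card_le_card hsub
  rw [Int.card_Icc] at h1
  have h2 : (S.card : ℝ) ≤ ((⌊q⌋ + 1 - ⌈p⌉).toNat : ℝ) := by exact_mod_cast h1
  refine h2.trans ?_
  rcases le_total 0 (⌊q⌋ + 1 - ⌈p⌉) with h3 | h3
  · have e : ((⌊q⌋ + 1 - ⌈p⌉).toNat : ℝ) = ((⌊q⌋ + 1 - ⌈p⌉ : ℤ) : ℝ) := by
      exact_mod_cast congrArg (Int.cast (R := ℝ)) (Int.toNat_of_nonneg h3)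
    rw [e]
    push_cast
    linarith [Int.floor_le q, Int.le_ceil p]
  · rw [Int.toNat_of_nonpos h3]; simp; linarith

/-- A trapezoidal dyadic sum: the number of scales between `1 / a` and `1 / b` is logarithmic. -/
lemma exists_sum_trapezoid_le : ∃ C, 0 ≤ C ∧ ∀ (S : Finset ℤ) (a b : ℝ), 0 < a → 0 < b →
    ∑ j ∈ S, min 1 ((2 : ℝ) ^ j * a) * min 1 ((2 : ℝ) ^ j * b)⁻¹ ≤
      C * (1 + max 0 (Real.log (a / b))) := by
  obtain ⟨C, hC, hgeo⟩ := exists_sum_min_inv_le (β := 2) (by norm_num)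
  refine ⟨2 * C + 2, by positivity, fun S a b ha hb => ?_⟩
  have hp : ∀ j : ℤ, (0 : ℝ) < 2 ^ j := fun j => zpow_pos (by norm_num) j
  set S' := S.filter fun j => 1 < (2 : ℝ) ^ j * a ∧ (2 : ℝ) ^ j * b < 1 with hS'
  have hterm : ∀ j ∈ S, min 1 ((2 : ℝ) ^ j * a) * min 1 ((2 : ℝ) ^ j * b)⁻¹ ≤
      min ((2 : ℝ) ^ j * a) ((2 : ℝ) ^ j * a)⁻¹ + min ((2 : ℝ) ^ j * b) ((2 : ℝ) ^ j * b)⁻¹ +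
        if 1 < (2 : ℝ) ^ j * a ∧ (2 : ℝ) ^ j * b < 1 then 1 else 0 := by
    intro j _
    have pa : 0 < (2 : ℝ) ^ j * a := mul_pos (hp j) ha
    have pb : 0 < (2 : ℝ) ^ j * b := mul_pos (hp j) hb
    set A := (2 : ℝ) ^ j * a
    set B := (2 : ℝ) ^ j * b
    have n1 : 0 ≤ min A A⁻¹ := by positivity
    have n2 : 0 ≤ min B B⁻¹ := by positivity
    have u1 : 0 ≤ min 1 A := by positivity
    have u2 : 0 ≤ min 1 B⁻¹ := by positivity
    split_ifs with h
    · have := mul_le_mul (min_le_left 1 A) (min_le_left 1 B⁻¹) u2 zero_le_one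
      linarith
    · rw [not_and_or, not_lt, not_lt] at h
      rcases h with h | h
      · have e : min A A⁻¹ = A := min_eq_left (h.trans (one_le_inv_iff₀.2 ⟨pa, h⟩))
        have := mul_le_mul (min_le_right 1 A) (min_le_left 1 B⁻¹) u2 pa.le
        linarith
      · have e : min B B⁻¹ = B⁻¹ := min_eq_right ((inv_le_one_of_one_le₀ h).trans h)
        have := mul_le_mul (min_le_left 1 A) (min_le_right 1 B⁻¹) u2 zero_le_one
        linarith
  have hcard : (S'.card : ℝ) ≤ 2 * (1 + max 0 (Real.log (a / b))) := by
    have hl := Real.log_two_gt_d9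
    have hmax : 0 ≤ max 0 (Real.log (a / b)) := le_max_left _ _
    rcases S'.eq_empty_or_nonempty with h | ⟨j, hj⟩
    · rw [h]; simp only [Finset.card_empty, Nat.cast_zero]; positivity
    · have hmem : ∀ j ∈ S', -Real.log a / Real.log 2 ≤ j ∧ (j : ℝ) ≤ -Real.log b / Real.log 2 := by
        intro j hj
        obtain ⟨-, h1, h2⟩ := Finset.mem_filter.1 hj
        have l1 := Real.log_pos h1
        have l2 := Real.log_neg (mul_pos (hp j) hb) h2
        rw [Real.log_mul (hp j).ne' ha.ne', Real.log_zpow] at l1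
        rw [Real.log_mul (hp j).ne' hb.ne', Real.log_zpow] at l2
        rw [div_le_iff₀ (by linarith), le_div_iff₀ (by linarith)]
        constructor <;> linarith
      have h1 := card_le_of_forall_mem S' ((hmem j hj).1.trans (hmem j hj).2) hmem
      refine h1.trans ?_
      have h2 : -Real.log b / Real.log 2 - -Real.log a / Real.log 2 =
          Real.log (a / b) / Real.log 2 := by rw [Real.log_div ha.ne' hb.ne']; ring
      rw [h2]
      have h3 : Real.log (a / b) / Real.log 2 ≤ 2 * max 0 (Real.log (a / b)) := by
        rw [div_le_iff₀ (by linarith)]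
        nlinarith [le_max_right 0 (Real.log (a / b))]
      linarith
  calc _ ≤ _ := Finset.sum_le_sum hterm
    _ = (∑ j ∈ S, min ((2 : ℝ) ^ j * a) ((2 : ℝ) ^ j * a)⁻¹) +
        (∑ j ∈ S, min ((2 : ℝ) ^ j * b) ((2 : ℝ) ^ j * b)⁻¹) + S'.card := by
      rw [Finset.sum_add_distrib, Finset.sum_add_distrib, hS', Finset.sum_boole]
    _ ≤ C + C + 2 * (1 + max 0 (Real.log (a / b))) :=
      add_le_add (add_le_add (hgeo S a ha) (hgeo S b hb)) hcard
    _ ≤ (2 * C + 2) * (1 + max 0 (Real.log (a / b))) := by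
      nlinarith [le_max_left 0 (Real.log (a / b)), mul_nonneg hC (le_max_left 0 (Real.log (a / b)))]

lemma w_eq {v : ℝ} (hv : 0 < v) : w v = (1 + v)⁻¹ := by rw [w, abs_of_pos hv]

lemma w_le_inv {v : ℝ} (hv : 0 < v) : w v ≤ v⁻¹ := by
  rw [w_eq hv]; exact inv_anti₀ hv (by linarith)

lemma pow_mul_w_pow_le {v : ℝ} (hv : 0 < v) {n : ℕ} (hn : n ≤ 3) : v ^ n * w v ^ 3 ≤ 1 := by
  have h1 : v * w v ≤ 1 := by
    have := mul_le_mul_of_nonneg_left (w_le_inv hv) hv.le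
    rwa [mul_inv_cancel₀ hv.ne'] at this
  have h0 := (w_pos v).le
  calc v ^ n * w v ^ 3 = (v * w v) ^ n * w v ^ (3 - n) := by
        rw [mul_pow, mul_assoc, ← pow_add, Nat.add_sub_cancel' hn]
    _ ≤ 1 * 1 := mul_le_mul (pow_le_one₀ (mul_nonneg hv.le h0) h1)
        (pow_le_one₀ h0 (w_le_one v)) (pow_nonneg h0 _) zero_le_one
    _ = 1 := one_mul 1

lemma mul_w_pow_le_min {v : ℝ} (hv : 0 < v) : v * w v ^ 3 ≤ min v v⁻¹ := by
  refine le_min ?_ ?_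
  · simpa using mul_le_mul_of_nonneg_left (pow_mul_w_pow_le hv (n := 0) (by norm_num)) hv.le
  · rw [← one_div, le_div_iff₀ hv]
    have := pow_mul_w_pow_le hv (n := 2) (by norm_num)
    linarith

lemma sq_mul_w_pow_le_min {v : ℝ} (hv : 0 < v) : v ^ 2 * w v ^ 3 ≤ min v v⁻¹ := by
  refine le_min ?_ ?_
  · have := mul_le_mul_of_nonneg_left (pow_mul_w_pow_le hv (n := 1) (by norm_num)) hv.le
    linarith
  · rw [← one_div, le_div_iff₀ hv]
    have := pow_mul_w_pow_le hv (n := 3) (by norm_num)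
    linarith

/-- A dyadic sum with a logarithmic factor. -/
lemma exists_sum_log_le : ∃ C, 0 ≤ C ∧ ∀ (S : Finset ℤ) (v ρ : ℝ), 0 < v → 1 ≤ ρ →
    ∑ k ∈ S, ((2 : ℝ) ^ k * v) ^ 2 * w ((2 : ℝ) ^ k * v) ^ 3 *
      (1 + max 0 (Real.log (ρ / ((2 : ℝ) ^ k * v)))) ≤ C * (2 + Real.log ρ) := by
  obtain ⟨C, hC, hgeo⟩ := exists_sum_min_inv_le (β := 2) (by norm_num)
  refine ⟨C, hC, fun S v ρ hv hρ => ?_⟩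
  have hL : 0 ≤ Real.log ρ := Real.log_nonneg hρ
  calc _ ≤ ∑ k ∈ S, min ((2 : ℝ) ^ k * v) ((2 : ℝ) ^ k * v)⁻¹ * (2 + Real.log ρ) := by
        refine Finset.sum_le_sum fun k _ => ?_
        have hy : 0 < (2 : ℝ) ^ k * v := mul_pos (zpow_pos (by norm_num) k) hv
        set y := (2 : ℝ) ^ k * v
        have h1 : max 0 (Real.log (ρ / y)) ≤ Real.log ρ + 1 / y := by
          refine max_le (by positivity) ?_
          rw [Real.log_div (by linarith) hy.ne', sub_eq_add_neg, ← Real.log_inv, ← one_div]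
          linarith [Real.log_le_sub_one_of_pos (show 0 < 1 / y by positivity)]
        have hw := w_pos y
        calc y ^ 2 * w y ^ 3 * (1 + max 0 (Real.log (ρ / y)))
            ≤ y ^ 2 * w y ^ 3 * (1 + (Real.log ρ + 1 / y)) := by gcongr
          _ = y ^ 2 * w y ^ 3 * (1 + Real.log ρ) + y * w y ^ 3 := by field_simp; ring
          _ ≤ min y y⁻¹ * (1 + Real.log ρ) + min y y⁻¹ :=
              add_le_add (mul_le_mul_of_nonneg_right (sq_mul_w_pow_le_min hy) (by linarith))
                (mul_w_pow_le_min hy)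
          _ = min y y⁻¹ * (2 + Real.log ρ) := by ring
    _ = (∑ k ∈ S, min ((2 : ℝ) ^ k * v) ((2 : ℝ) ^ k * v)⁻¹) * (2 + Real.log ρ) := by
        rw [Finset.sum_mul]
    _ ≤ C * (2 + Real.log ρ) := mul_le_mul_of_nonneg_right (hgeo S v hv) (by linarith)

/-- The decay factor `D_log` as a function of the ratio `R = |x₃| / |x₁ x₂|`. -/
def dlogRatio (R : ℝ) : ℝ := (R + R⁻¹)⁻¹ * Real.log (R + R⁻¹)

lemma dlogRatio_inv (R : ℝ) : dlogRatio R⁻¹ = dlogRatio R := by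
  unfold dlogRatio; rw [inv_inv, add_comm]

lemma le_dlogRatio {R : ℝ} (hR : 1 ≤ R) : (2 + Real.log R) / R ≤ 8 * dlogRatio R := by
  have hR0 : 0 < R := by linarith
  have hi : R⁻¹ ≤ 1 := inv_le_one_of_one_le₀ hR
  have hi0 : 0 < R⁻¹ := by positivity
  have h2 : 2 ≤ R + R⁻¹ := by
    have : R * R⁻¹ = 1 := mul_inv_cancel₀ hR0.ne'
    nlinarith [sq_nonneg (R - R⁻¹)]
  have l1 : Real.log 2 ≤ Real.log (R + R⁻¹) := Real.log_le_log (by norm_num) h2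
  have l2 : Real.log R ≤ Real.log (R + R⁻¹) := Real.log_le_log hR0 (by linarith)
  have l3 := Real.log_two_gt_d9
  have h3 : (2 * R)⁻¹ ≤ (R + R⁻¹)⁻¹ := inv_anti₀ (by linarith) (by linarith)
  have h4 : 2 + Real.log R ≤ 4 * Real.log (R + R⁻¹) := by linarith
  unfold dlogRatio
  calc (2 + Real.log R) / R = (2 * R)⁻¹ * (2 * (2 + Real.log R)) := by field_simp
    _ ≤ (R + R⁻¹)⁻¹ * (2 * (4 * Real.log (R + R⁻¹))) :=
        mul_le_mul h3 (by linarith) (by linarith [Real.log_nonneg hR]) (by positivity)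
    _ = _ := by ring

lemma min_one_sq_le {a : ℝ} (ha : 0 < a) : min 1 (a ^ 2) ≤ min 1 a := by
  rcases le_total a 1 with h | h
  · rw [min_eq_right h]
    exact (min_le_right _ _).trans (by nlinarith)
  · rw [min_eq_left h]
    exact min_le_left _ _

lemma w_pow_le_min {x : ℝ} (hx : 0 < x) : w x ^ 3 ≤ min 1 x⁻¹ := by
  have h1 : w x ^ 3 ≤ w x := by
    simpa using pow_le_pow_of_le_one (w_pos x).le (w_le_one x) (show 1 ≤ 3 by norm_num)
  exact le_min (h1.trans (w_le_one x)) (h1.trans (w_le_inv hx))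

/-- The change of variables `l = j + k` in a double sum of nonnegative terms. -/
lemma sum_shear_le (S T : Finset ℤ) (F : ℤ → ℤ → ℝ) (hF : ∀ l k, 0 ≤ F l k) :
    ∑ j ∈ S, ∑ k ∈ T, F (j + k) k ≤
      ∑ l ∈ Finset.image₂ (· + ·) S T, ∑ k ∈ T, F l k := by
  rw [Finset.sum_comm, Finset.sum_comm (s := Finset.image₂ (· + ·) S T)]
  refine Finset.sum_le_sum fun k hk => ?_
  have e : ∑ j ∈ S, F (j + k) k = ∑ l ∈ S.map (addRightEmbedding k), F l k := by
    simp [Finset.sum_map]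
  rw [e]
  refine Finset.sum_le_sum_of_subset_of_nonneg (fun l hl => ?_) fun l _ _ => hF l k
  obtain ⟨j, hj, rfl⟩ := Finset.mem_map.1 hl
  exact Finset.mem_image₂_of_mem hj hk

/-- The two-parameter sum behind the logarithmic kernel bounds. -/
lemma exists_sum_zygmund_le : ∃ C, 0 ≤ C ∧ ∀ (S T : Finset ℤ) (a v R : ℝ), 0 < a → 0 < v → 0 < R →
    ∑ j ∈ S, ∑ k ∈ T, min 1 (((2 : ℝ) ^ j * a) ^ 2) * (((2 : ℝ) ^ k * v) ^ 2 * R *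
      (w ((2 : ℝ) ^ k * v) ^ 3 * w ((2 : ℝ) ^ j * a * ((2 : ℝ) ^ k * v) * R) ^ 3)) ≤
      C * dlogRatio R := by
  obtain ⟨C₁, hC₁, htrap⟩ := exists_sum_trapezoid_le
  obtain ⟨C₂, hC₂, hlog⟩ := exists_sum_log_le
  refine ⟨C₁ * C₂ * 8, by positivity, fun S T a v R ha hv hR => ?_⟩
  have hp : ∀ j : ℤ, (0 : ℝ) < 2 ^ j := fun j => zpow_pos (by norm_num) j
  rcases le_total R 1 with h | h
  · -- for `R ≤ 1` and fixed `k` the sum over `j` is trapezoidal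
    have hRi : 1 ≤ R⁻¹ := one_le_inv_iff₀.2 ⟨hR, h⟩
    calc _ ≤ ∑ j ∈ S, ∑ k ∈ T, R * (((2 : ℝ) ^ k * v) ^ 2 * w ((2 : ℝ) ^ k * v) ^ 3 *
          (min 1 ((2 : ℝ) ^ j * a) * min 1 ((2 : ℝ) ^ j * (a * ((2 : ℝ) ^ k * v) * R))⁻¹)) := by
          refine Finset.sum_le_sum fun j _ => Finset.sum_le_sum fun k _ => ?_
          have pa := mul_pos (hp j) ha
          have pv := mul_pos (hp k) hv
          have e : (2 : ℝ) ^ j * (a * ((2 : ℝ) ^ k * v) * R) =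
            (2 : ℝ) ^ j * a * ((2 : ℝ) ^ k * v) * R := by ring
          rw [e]
          set A := (2 : ℝ) ^ j * a
          set V := (2 : ℝ) ^ k * v
          have h1 := min_one_sq_le pa
          have h2 := w_pow_le_min (show 0 < A * V * R by positivity)
          have hw := w_pos V
          have hw' := w_pos (A * V * R)
          calc min 1 (A ^ 2) * (V ^ 2 * R * (w V ^ 3 * w (A * V * R) ^ 3))
              ≤ min 1 A * (V ^ 2 * R * (w V ^ 3 * min 1 (A * V * R)⁻¹)) := by gcongr
            _ = _ := by ring
      _ = ∑ k ∈ T, R * (((2 : ℝ) ^ k * v) ^ 2 * w ((2 : ℝ) ^ k * v) ^ 3 *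
          ∑ j ∈ S, (min 1 ((2 : ℝ) ^ j * a) *
            min 1 ((2 : ℝ) ^ j * (a * ((2 : ℝ) ^ k * v) * R))⁻¹)) := by
          rw [Finset.sum_comm]; simp only [Finset.mul_sum]
      _ ≤ ∑ k ∈ T, R * (((2 : ℝ) ^ k * v) ^ 2 * w ((2 : ℝ) ^ k * v) ^ 3 *
          (C₁ * (1 + max 0 (Real.log (R⁻¹ / ((2 : ℝ) ^ k * v)))))) := by
          refine Finset.sum_le_sum fun k _ => ?_
          have pv := mul_pos (hp k) hv
          have h1 := htrap S a (a * ((2 : ℝ) ^ k * v) * R) ha (by positivity)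
          have e : a / (a * ((2 : ℝ) ^ k * v) * R) = R⁻¹ / ((2 : ℝ) ^ k * v) := by field_simp
          rw [e] at h1
          have hw := w_pos ((2 : ℝ) ^ k * v)
          gcongr
      _ = R * C₁ * ∑ k ∈ T, (((2 : ℝ) ^ k * v) ^ 2 * w ((2 : ℝ) ^ k * v) ^ 3 *
          (1 + max 0 (Real.log (R⁻¹ / ((2 : ℝ) ^ k * v))))) := by
          rw [Finset.mul_sum]; exact Finset.sum_congr rfl fun k _ => by ring
      _ ≤ R * C₁ * (C₂ * (2 + Real.log R⁻¹)) :=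
          mul_le_mul_of_nonneg_left (hlog T v R⁻¹ hv hRi) (by positivity)
      _ = C₁ * C₂ * ((2 + Real.log R⁻¹) / R⁻¹) := by field_simp
      _ ≤ C₁ * C₂ * (8 * dlogRatio R⁻¹) :=
          mul_le_mul_of_nonneg_left (le_dlogRatio hRi) (by positivity)
      _ = C₁ * C₂ * 8 * dlogRatio R := by rw [dlogRatio_inv]; ring
  · -- for `R ≥ 1` the sum over `k` is trapezoidal if `j + k` is fixed
    calc _ ≤ ∑ j ∈ S, ∑ k ∈ T, R⁻¹ * (((2 : ℝ) ^ (j + k) * (a * v * R)) ^ 2 *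
          w ((2 : ℝ) ^ (j + k) * (a * v * R)) ^ 3 *
          (min 1 ((2 : ℝ) ^ k * (v * R / ((2 : ℝ) ^ (j + k) * (a * v * R)))) *
            min 1 ((2 : ℝ) ^ k * v)⁻¹)) := by
          refine Finset.sum_le_sum fun j _ => Finset.sum_le_sum fun k _ => ?_
          have pa := mul_pos (hp j) ha
          have pv := mul_pos (hp k) hv
          have e1 : (2 : ℝ) ^ (j + k) * (a * v * R) =
              (2 : ℝ) ^ j * a * ((2 : ℝ) ^ k * v) * R := by
            rw [zpow_add₀ (by norm_num)]; ring
          rw [e1]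
          have e2 : (2 : ℝ) ^ k * (v * R / ((2 : ℝ) ^ j * a * ((2 : ℝ) ^ k * v) * R)) =
              ((2 : ℝ) ^ j * a)⁻¹ := by have := hp k; field_simp
          rw [e2]
          set A := (2 : ℝ) ^ j * a
          set V := (2 : ℝ) ^ k * v
          have h1 := min_one_sq_le (inv_pos.2 pa)
          have h2 := w_pow_le_min pv
          have hw := w_pos V
          have hw' := w_pos (A * V * R)
          have e3 : min 1 (A ^ 2) = A ^ 2 * min 1 (A⁻¹ ^ 2) := by
            rw [mul_min_of_nonneg _ _ (sq_nonneg A), inv_pow, mul_inv_cancel₀ (by positivity),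
              mul_one, min_comm]
          calc min 1 (A ^ 2) * (V ^ 2 * R * (w V ^ 3 * w (A * V * R) ^ 3))
              = A ^ 2 * min 1 (A⁻¹ ^ 2) * (V ^ 2 * R * (w V ^ 3 * w (A * V * R) ^ 3)) := by rw [e3]
            _ ≤ A ^ 2 * min 1 A⁻¹ * (V ^ 2 * R * (min 1 V⁻¹ * w (A * V * R) ^ 3)) := by gcongr
            _ = _ := by field_simp
      _ ≤ ∑ l ∈ Finset.image₂ (· + ·) S T, ∑ k ∈ T, R⁻¹ * (((2 : ℝ) ^ l * (a * v * R)) ^ 2 *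
          w ((2 : ℝ) ^ l * (a * v * R)) ^ 3 *
          (min 1 ((2 : ℝ) ^ k * (v * R / ((2 : ℝ) ^ l * (a * v * R)))) *
            min 1 ((2 : ℝ) ^ k * v)⁻¹)) := by
          refine sum_shear_le S T (fun l k => R⁻¹ * (((2 : ℝ) ^ l * (a * v * R)) ^ 2 *
            w ((2 : ℝ) ^ l * (a * v * R)) ^ 3 *
            (min 1 ((2 : ℝ) ^ k * (v * R / ((2 : ℝ) ^ l * (a * v * R)))) *
            min 1 ((2 : ℝ) ^ k * v)⁻¹))) fun l k => ?_
          have := hp k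
          have := hp l
          have := w_pos ((2 : ℝ) ^ l * (a * v * R))
          positivity
      _ = ∑ l ∈ Finset.image₂ (· + ·) S T, R⁻¹ * (((2 : ℝ) ^ l * (a * v * R)) ^ 2 *
          w ((2 : ℝ) ^ l * (a * v * R)) ^ 3 * ∑ k ∈ T,
          (min 1 ((2 : ℝ) ^ k * (v * R / ((2 : ℝ) ^ l * (a * v * R)))) *
            min 1 ((2 : ℝ) ^ k * v)⁻¹)) := by simp only [Finset.mul_sum]
      _ ≤ ∑ l ∈ Finset.image₂ (· + ·) S T, R⁻¹ * (((2 : ℝ) ^ l * (a * v * R)) ^ 2 *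
          w ((2 : ℝ) ^ l * (a * v * R)) ^ 3 *
          (C₁ * (1 + max 0 (Real.log (R / ((2 : ℝ) ^ l * (a * v * R))))))) := by
          refine Finset.sum_le_sum fun l _ => ?_
          have hl := hp l
          have h1 := htrap T (v * R / ((2 : ℝ) ^ l * (a * v * R))) v (by positivity) hv
          have e : v * R / ((2 : ℝ) ^ l * (a * v * R)) / v = R / ((2 : ℝ) ^ l * (a * v * R)) := by
            field_simp
          rw [e] at h1
          have hw := w_pos ((2 : ℝ) ^ l * (a * v * R))
          gcongr
      _ = R⁻¹ * C₁ * ∑ l ∈ Finset.image₂ (· + ·) S T, (((2 : ℝ) ^ l * (a * v * R)) ^ 2 *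
          w ((2 : ℝ) ^ l * (a * v * R)) ^ 3 *
          (1 + max 0 (Real.log (R / ((2 : ℝ) ^ l * (a * v * R)))))) := by
          rw [Finset.mul_sum]; exact Finset.sum_congr rfl fun k _ => by ring
      _ ≤ R⁻¹ * C₁ * (C₂ * (2 + Real.log R)) :=
          mul_le_mul_of_nonneg_left (hlog _ (a * v * R) R (by positivity) h) (by positivity)
      _ = C₁ * C₂ * ((2 + Real.log R) / R) := by field_simp
      _ ≤ C₁ * C₂ * (8 * dlogRatio R) :=
          mul_le_mul_of_nonneg_left (le_dlogRatio h) (by positivity)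
      _ = C₁ * C₂ * 8 * dlogRatio R := by ring

lemma Dlog_eq (x₁ x₂ x₃ : ℝ) : Dlog x₁ x₂ x₃ = dlogRatio (|x₃| / (|x₁| * |x₂|)) := by
  unfold Dlog Dtheta dlogRatio
  rw [Real.rpow_neg_one, inv_div, abs_mul, add_comm]

lemma w_two_zpow (j : ℤ) (t : ℝ) : w ((2 : ℝ) ^ j * t) = w ((2 : ℝ) ^ j * |t|) := by
  simp [w, abs_mul]

/-- Summation for the full kernel. -/
lemma exists_sum_full_le : ∃ C, 0 ≤ C ∧ ∀ (S T : Finset ℤ) (z₁ z₂ z₃ : ℝ), z₁ ≠ 0 → z₂ ≠ 0 →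
    z₃ ≠ 0 → ∑ j ∈ S, ∑ k ∈ T, ((2 : ℝ) ^ j) ^ 2 * ((2 : ℝ) ^ k) ^ 2 * (w ((2 : ℝ) ^ j * z₁) ^ 3 *
      w ((2 : ℝ) ^ k * z₂) ^ 3 * w ((2 : ℝ) ^ j * (2 : ℝ) ^ k * z₃) ^ 3) ≤
      C * (Dlog z₁ z₂ z₃ / (|z₁| * |z₂| * |z₃|)) := by
  obtain ⟨C, hC, h⟩ := exists_sum_zygmund_le
  refine ⟨C, hC, fun S T z₁ z₂ z₃ h₁ h₂ h₃ => ?_⟩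
  have p₁ := abs_pos.2 h₁
  have p₂ := abs_pos.2 h₂
  have p₃ := abs_pos.2 h₃
  have key := h S T |z₁| |z₂| (|z₃| / (|z₁| * |z₂|)) p₁ p₂ (by positivity)
  rw [Dlog_eq, mul_div_assoc', le_div_iff₀ (by positivity)]
  refine le_trans ?_ key
  rw [Finset.sum_mul]
  refine Finset.sum_le_sum fun j _ => ?_
  rw [Finset.sum_mul]
  refine Finset.sum_le_sum fun k _ => ?_
  have pj : (0 : ℝ) < 2 ^ j := zpow_pos (by norm_num) j
  have pk : (0 : ℝ) < 2 ^ k := zpow_pos (by norm_num) k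
  have e : (2 : ℝ) ^ j * |z₁| * ((2 : ℝ) ^ k * |z₂|) * (|z₃| / (|z₁| * |z₂|)) =
      (2 : ℝ) ^ j * (2 : ℝ) ^ k * |z₃| := by field_simp
  have e' : w ((2 : ℝ) ^ j * (2 : ℝ) ^ k * z₃) = w ((2 : ℝ) ^ j * (2 : ℝ) ^ k * |z₃|) := by
    simp [w, abs_mul]
  rw [e, e', w_two_zpow j, w_two_zpow k]
  set u := (2 : ℝ) ^ j * |z₁| with hu
  have pu : 0 < u := by positivity
  have h1 : u ^ 2 * w u ^ 3 ≤ min 1 (u ^ 2) := by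
    refine le_min (pow_mul_w_pow_le pu (by norm_num)) ?_
    have := mul_le_mul_of_nonneg_left (pow_mul_w_pow_le pu (n := 0) (by norm_num)) (sq_nonneg u)
    simpa using this
  have hw := w_pos ((2 : ℝ) ^ k * |z₂|)
  have hw' := w_pos ((2 : ℝ) ^ j * (2 : ℝ) ^ k * |z₃|)
  refine le_trans (le_of_eq ?_) (mul_le_mul_of_nonneg_right h1
    (show 0 ≤ ((2 : ℝ) ^ k * |z₂|) ^ 2 * (|z₃| / (|z₁| * |z₂|)) *
      (w ((2 : ℝ) ^ k * |z₂|) ^ 3 * w ((2 : ℝ) ^ j * (2 : ℝ) ^ k * |z₃|) ^ 3) by positivity))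
  rw [hu]
  field_simp

/-- Summation for the partial kernels in the last two variables. -/
lemma exists_sum_partial_le : ∃ C, 0 ≤ C ∧ ∀ (S T : Finset ℤ) (ℓ z₂ z₃ : ℝ), 0 < ℓ → z₂ ≠ 0 →
    z₃ ≠ 0 → ∑ j ∈ S, ∑ k ∈ T, ((2 : ℝ) ^ k) ^ 2 * (min 1 (((2 : ℝ) ^ j * ℓ) ^ 2) *
      (w ((2 : ℝ) ^ k * z₂) ^ 3 * w ((2 : ℝ) ^ j * (2 : ℝ) ^ k * z₃) ^ 3)) ≤
      C * (ℓ / (|z₂| * |z₃|) * Dlog ℓ z₂ z₃) := by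
  obtain ⟨C, hC, h⟩ := exists_sum_zygmund_le
  refine ⟨C, hC, fun S T ℓ z₂ z₃ pℓ h₂ h₃ => ?_⟩
  have p₂ := abs_pos.2 h₂
  have p₃ := abs_pos.2 h₃
  have key := h S T ℓ |z₂| (|z₃| / (ℓ * |z₂|)) pℓ p₂ (by positivity)
  rw [Dlog_eq, abs_of_pos pℓ, mul_left_comm, ← div_le_iff₀' (by positivity)]
  refine le_trans ?_ key
  rw [Finset.sum_div]
  refine Finset.sum_le_sum fun j _ => ?_
  rw [Finset.sum_div]
  refine Finset.sum_le_sum fun k _ => le_of_eq ?_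
  have pj : (0 : ℝ) < 2 ^ j := zpow_pos (by norm_num) j
  have pk : (0 : ℝ) < 2 ^ k := zpow_pos (by norm_num) k
  have e : (2 : ℝ) ^ j * ℓ * ((2 : ℝ) ^ k * |z₂|) * (|z₃| / (ℓ * |z₂|)) =
      (2 : ℝ) ^ j * (2 : ℝ) ^ k * |z₃| := by field_simp
  have e' : w ((2 : ℝ) ^ j * (2 : ℝ) ^ k * z₃) = w ((2 : ℝ) ^ j * (2 : ℝ) ^ k * |z₃|) := by
    simp [w, abs_mul]
  rw [e, e', w_two_zpow k]
  field_simp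

/-- The relative size of the smaller side of the rectangle with sides `ℓ₂`, `ℓ₃` at the scale
`(j, k)`. -/
def relSide (j k : ℤ) (ℓ₂ ℓ₃ : ℝ) : ℝ := (2 : ℝ) ^ k * min ℓ₂ ((2 : ℝ) ^ j * ℓ₃)

lemma relSide_pos (j k : ℤ) {ℓ₂ ℓ₃ : ℝ} (h₂ : 0 < ℓ₂) (h₃ : 0 < ℓ₃) : 0 < relSide j k ℓ₂ ℓ₃ := by
  have pj : (0 : ℝ) < 2 ^ j := zpow_pos (by norm_num) j
  have pk : (0 : ℝ) < 2 ^ k := zpow_pos (by norm_num) k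
  unfold relSide; positivity

/-- Summation for the partial kernels in the first variable. -/
lemma exists_sum_CZ_le : ∃ C, 0 ≤ C ∧ ∀ (S T : Finset ℤ) (z ℓ₂ ℓ₃ : ℝ), z ≠ 0 → 0 < ℓ₂ → 0 < ℓ₃ →
    ∑ j ∈ S, ∑ k ∈ T, (2 : ℝ) ^ j * w ((2 : ℝ) ^ j * z) ^ 3 *
      min (relSide j k ℓ₂ ℓ₃) (relSide j k ℓ₂ ℓ₃)⁻¹ ≤ C / |z| := by
  obtain ⟨C, hC, hgeo⟩ := exists_sum_min_inv_le (β := 2) (by norm_num)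
  refine ⟨C * C, by positivity, fun S T z ℓ₂ ℓ₃ hz h₂ h₃ => ?_⟩
  have pz := abs_pos.2 hz
  rw [le_div_iff₀ pz, Finset.sum_mul]
  calc _ = ∑ j ∈ S, ((2 : ℝ) ^ j * |z| * w ((2 : ℝ) ^ j * |z|) ^ 3) *
        ∑ k ∈ T, min (relSide j k ℓ₂ ℓ₃) (relSide j k ℓ₂ ℓ₃)⁻¹ := by
        refine Finset.sum_congr rfl fun j _ => ?_
        rw [Finset.mul_sum, Finset.sum_mul]
        refine Finset.sum_congr rfl fun k _ => ?_
        rw [w_two_zpow j z]; ring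
    _ ≤ ∑ j ∈ S, min ((2 : ℝ) ^ j * |z|) ((2 : ℝ) ^ j * |z|)⁻¹ * C := by
        refine Finset.sum_le_sum fun j _ => ?_
        have pj : (0 : ℝ) < 2 ^ j := zpow_pos (by norm_num) j
        refine mul_le_mul (mul_w_pow_le_min (by positivity)) (hgeo T _ (by positivity))
          (Finset.sum_nonneg fun k _ => ?_) (by positivity)
        have := relSide_pos j k h₂ h₃
        positivity
    _ ≤ C * C := by
        rw [← Finset.sum_mul]
        exact mul_le_mul_of_nonneg_right (hgeo S _ pz) hC

lemma sqrt_min_inv {x : ℝ} : Real.sqrt (min x x⁻¹) = min (Real.sqrt x) (Real.sqrt x)⁻¹ := by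
  rw [← Real.sqrt_inv]
  exact Monotone.map_min (f := Real.sqrt) fun _ _ h => Real.sqrt_le_sqrt h

lemma sqrt_two_zpow (j : ℤ) (x : ℝ) :
    Real.sqrt ((2 : ℝ) ^ j * x) = Real.sqrt 2 ^ j * Real.sqrt x := by
  rw [Real.sqrt_mul (by positivity)]
  congr 1
  rw [Real.sqrt_eq_iff_mul_self_eq (by positivity) (by positivity), ← mul_zpow,
    Real.mul_self_sqrt (by norm_num)]

/-- Summation for the weak boundedness property. -/
lemma exists_sum_wbp_le : ∃ C, 0 ≤ C ∧ ∀ (S T : Finset ℤ) (ℓ₁ ℓ₂ ℓ₃ : ℝ), 0 < ℓ₁ → 0 < ℓ₂ →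
    0 < ℓ₃ → ∑ j ∈ S, ∑ k ∈ T,
      Real.sqrt (min ((2 : ℝ) ^ j * ℓ₁) ((2 : ℝ) ^ j * ℓ₁)⁻¹) *
      Real.sqrt (min (relSide j k ℓ₂ ℓ₃) (relSide j k ℓ₂ ℓ₃)⁻¹) ≤ C := by
  have h2 : 1 < Real.sqrt 2 := by
    rw [Real.lt_sqrt (by norm_num)]; norm_num
  obtain ⟨C, hC, hgeo⟩ := exists_sum_min_inv_le h2
  refine ⟨C * C, by positivity, fun S T ℓ₁ ℓ₂ ℓ₃ h₁ h₂ h₃ => ?_⟩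
  simp only [relSide, sqrt_min_inv, sqrt_two_zpow]
  calc _ ≤ ∑ j ∈ S, min (Real.sqrt 2 ^ j * Real.sqrt ℓ₁) (Real.sqrt 2 ^ j * Real.sqrt ℓ₁)⁻¹ * C := by
        refine Finset.sum_le_sum fun j _ => ?_
        rw [← Finset.mul_sum]
        have pj : (0 : ℝ) < 2 ^ j := zpow_pos (by norm_num) j
        refine mul_le_mul_of_nonneg_left (hgeo T _ (by positivity)) (by positivity)
    _ ≤ C * C := by
        rw [← Finset.sum_mul]
        exact mul_le_mul_of_nonneg_right (hgeo S _ (by positivity)) hC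

/-! ### Differences of bump functions -/

lemma w_le_two_mul {x t : ℝ} (h : |x| / 2 ≤ |t|) : w t ≤ 2 * w x := by
  unfold w
  rw [← div_eq_mul_inv, ← one_div, div_le_div_iff₀ (by positivity) (by positivity)]
  linarith [abs_nonneg x, abs_nonneg t]

lemma abs_mul_w_le (x : ℝ) : |x| * w x ≤ 1 := by
  unfold w
  rw [← div_eq_mul_inv, div_le_one (by positivity)]
  linarith

/-- The mean value estimate in scale invariant form. -/
lemma norm_sub_le_of_deriv {f f' : ℝ → ℂ} {c x h : ℝ} (hf : ∀ t, HasDerivAt f (f' t) t)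
    (hb : ∀ t, ‖f' t‖ ≤ c * w t ^ 4) (hx : x ≠ 0) (hh : |h| ≤ |x| / 2) :
    ‖f (x + h) - f x‖ ≤ 16 * c * (|h| / |x|) * w x ^ 3 := by
  have hc : 0 ≤ c := by
    have := (norm_nonneg _).trans (hb 0)
    simpa [w] using this
  have hw := w_pos x
  have hbd : ∀ t ∈ uIcc x (x + h), ‖f' t‖ ≤ c * (2 * w x) ^ 4 := by
    intro t ht
    refine (hb t).trans (mul_le_mul_of_nonneg_left ?_ hc)
    refine pow_le_pow_left₀ (w_pos t).le (w_le_two_mul ?_) 4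
    have h1 := abs_sub_left_of_mem_uIcc ht
    rw [add_sub_cancel_left] at h1
    have h2 := abs_sub_abs_le_abs_sub x t
    rw [abs_sub_comm] at h2
    linarith
  have h1 := Convex.norm_image_sub_le_of_norm_hasDerivWithin_le
    (fun t _ => (hf t).hasDerivWithinAt) hbd (convex_uIcc x (x + h)) left_mem_uIcc right_mem_uIcc
  rw [add_sub_cancel_left, Real.norm_eq_abs] at h1
  refine h1.trans ?_
  have hx' : 0 < |x| := abs_pos.2 hx
  calc c * (2 * w x) ^ 4 * |h| = 16 * c * (|h| / |x|) * w x ^ 3 * (|x| * w x) := by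
        field_simp; ring
    _ ≤ 16 * c * (|h| / |x|) * w x ^ 3 * 1 :=
        mul_le_mul_of_nonneg_left (abs_mul_w_le x) (by positivity)
    _ = _ := mul_one _

lemma Par.slice₁ {ψ ψ' : R3 → ℂ} (h : Par 0 ψ ψ') (a b t : ℝ) :
    HasDerivAt (fun t => ψ (t, a, b)) (ψ' (t, a, b)) t :=
  hasLineDerivAt_iff_slice₁.1 (h (t, a, b))

lemma Par.slice₂ {ψ ψ' : R3 → ℂ} (h : Par 1 ψ ψ') (a b t : ℝ) :
    HasDerivAt (fun t => ψ (a, t, b)) (ψ' (a, t, b)) t :=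
  hasLineDerivAt_iff_slice₂.1 (h (a, t, b))

lemma Par.slice₃ {ψ ψ' : R3 → ℂ} (h : Par 2 ψ ψ') (a b t : ℝ) :
    HasDerivAt (fun t => ψ (a, b, t)) (ψ' (a, b, t)) t :=
  hasLineDerivAt_iff_slice₃.1 (h (a, b, t))

lemma BumpBase.nonneg {c : ℝ} {ψ : R3 → ℂ} (h : BumpBase c ψ) : 0 ≤ c := by
  have := (norm_nonneg _).trans (h.2 0)
  simpa [w] using this

lemma IsBump.nonneg {d : ℕ} {c : ℝ} {ψ : R3 → ℂ} (h : IsBump d c ψ) : 0 ≤ c := h.base.nonneg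

/-- The relative increment in the last two variables. -/
def incr (x₂ x₃ h₂ h₃ : ℝ) : ℝ := |h₂| / |x₂| + |h₃| / |x₃|

lemma incr_nonneg (x₂ x₃ h₂ h₃ : ℝ) : 0 ≤ incr x₂ x₃ h₂ h₃ := by unfold incr; positivity

lemma IsBump.norm_diff₁_le {d : ℕ} {c : ℝ} {ψ : R3 → ℂ} (h : IsBump (d + 1) c ψ)
    {x₁ h₁ : ℝ} (x₂ x₃ : ℝ) (hx : x₁ ≠ 0) (hh : |h₁| ≤ |x₁| / 2) :
    ‖ψ (x₁ + h₁, x₂, x₃) - ψ (x₁, x₂, x₃)‖ ≤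
      16 * c * (|h₁| / |x₁|) * (w x₁ ^ 3 * w x₂ ^ 4 * w x₃ ^ 4) := by
  obtain ⟨ψ', h1, h2⟩ := h.2.1 0
  refine (norm_sub_le_of_deriv (c := c * (w x₂ ^ 4 * w x₃ ^ 4)) (fun t => h1.slice₁ x₂ x₃ t)
    (fun t => (h2.base.2 _).trans (le_of_eq (by ring))) hx hh).trans (le_of_eq (by ring))

lemma IsBump.norm_diff₂₃_le {d : ℕ} {c : ℝ} {ψ : R3 → ℂ} (h : IsBump (d + 1) c ψ)
    {x₂ x₃ h₂ h₃ : ℝ} (x₁ : ℝ) (hx₂ : x₂ ≠ 0) (hx₃ : x₃ ≠ 0) (hh₂ : |h₂| ≤ |x₂| / 2)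
    (hh₃ : |h₃| ≤ |x₃| / 2) :
    ‖ψ (x₁, x₂ + h₂, x₃ + h₃) - ψ (x₁, x₂, x₃)‖ ≤
      256 * c * incr x₂ x₃ h₂ h₃ * (w x₁ ^ 4 * w x₂ ^ 3 * w x₃ ^ 3) := by
  obtain ⟨ψ₂, h1, h2⟩ := h.2.1 1
  obtain ⟨ψ₃, h3, h4⟩ := h.2.1 2
  have hc := h.nonneg
  have p₁ := w_pos x₁
  have p₂ := w_pos x₂
  have p₃ := w_pos x₃
  have hw : w (x₃ + h₃) ≤ 2 * w x₃ := w_le_two_mul (by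
    have := abs_sub_abs_le_abs_sub x₃ (-h₃)
    rw [abs_neg, sub_neg_eq_add] at this
    linarith)
  have b2 := norm_sub_le_of_deriv (c := c * (w x₁ ^ 4 * w (x₃ + h₃) ^ 4))
    (fun t => h1.slice₂ x₁ (x₃ + h₃) t)
    (fun t => (h2.base.2 _).trans (le_of_eq (by ring))) hx₂ hh₂
  have b3 := norm_sub_le_of_deriv (c := c * (w x₁ ^ 4 * w x₂ ^ 4)) (fun t => h3.slice₃ x₁ x₂ t)
    (fun t => (h4.base.2 _).trans (le_of_eq (by ring))) hx₃ hh₃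
  have e4 : w (x₃ + h₃) ^ 4 ≤ 16 * w x₃ ^ 3 := by
    calc w (x₃ + h₃) ^ 4 ≤ (2 * w x₃) ^ 4 := pow_le_pow_left₀ (w_pos _).le hw 4
      _ = 16 * w x₃ ^ 3 * w x₃ := by ring
      _ ≤ 16 * w x₃ ^ 3 * 1 := mul_le_mul_of_nonneg_left (w_le_one _) (by positivity)
      _ = _ := mul_one _
  have e5 : w x₂ ^ 4 ≤ w x₂ ^ 3 := pow_le_pow_of_le_one p₂.le (w_le_one _) (by norm_num)
  calc ‖ψ (x₁, x₂ + h₂, x₃ + h₃) - ψ (x₁, x₂, x₃)‖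
      = ‖(ψ (x₁, x₂ + h₂, x₃ + h₃) - ψ (x₁, x₂, x₃ + h₃)) +
          (ψ (x₁, x₂, x₃ + h₃) - ψ (x₁, x₂, x₃))‖ := by congr 1; ring
    _ ≤ 16 * (c * (w x₁ ^ 4 * w (x₃ + h₃) ^ 4)) * (|h₂| / |x₂|) * w x₂ ^ 3 +
          16 * (c * (w x₁ ^ 4 * w x₂ ^ 4)) * (|h₃| / |x₃|) * w x₃ ^ 3 :=
        (norm_add_le _ _).trans (add_le_add b2 b3)
    _ ≤ 16 * (c * (w x₁ ^ 4 * (16 * w x₃ ^ 3))) * (|h₂| / |x₂|) * w x₂ ^ 3 +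
          16 * (c * (w x₁ ^ 4 * (16 * w x₂ ^ 3))) * (|h₃| / |x₃|) * w x₃ ^ 3 := by
        gcongr
        linarith [pow_pos p₂ 3]
    _ = _ := by unfold incr; ring

/-- The mixed difference: the first difference of a bump function in `x₁` is estimated by means of
its derivative, which is a bump function to which the bound in `(x₂, x₃)` applies. -/
lemma IsBump.norm_diff₁₂₃_le {d : ℕ} {c : ℝ} {ψ : R3 → ℂ} (h : IsBump (d + 2) c ψ)
    {x₁ x₂ x₃ h₁ h₂ h₃ : ℝ} (hx₁ : x₁ ≠ 0) (hx₂ : x₂ ≠ 0) (hx₃ : x₃ ≠ 0) (hh₁ : |h₁| ≤ |x₁| / 2)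
    (hh₂ : |h₂| ≤ |x₂| / 2) (hh₃ : |h₃| ≤ |x₃| / 2) :
    ‖ψ (x₁ + h₁, x₂ + h₂, x₃ + h₃) - ψ (x₁ + h₁, x₂, x₃) - ψ (x₁, x₂ + h₂, x₃ + h₃) +
      ψ (x₁, x₂, x₃)‖ ≤
      4096 * c * (|h₁| / |x₁| * incr x₂ x₃ h₂ h₃) * (w x₁ ^ 3 * w x₂ ^ 3 * w x₃ ^ 3) := by
  obtain ⟨ψ', h1, h2⟩ := h.2.1 0
  have := norm_sub_le_of_deriv (x := x₁) (h := h₁)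
    (c := 256 * c * incr x₂ x₃ h₂ h₃ * (w x₂ ^ 3 * w x₃ ^ 3))
    (f := fun t => ψ (t, x₂ + h₂, x₃ + h₃) - ψ (t, x₂, x₃))
    (fun t => (h1.slice₁ (x₂ + h₂) (x₃ + h₃) t).sub (h1.slice₁ x₂ x₃ t))
    (fun t => (h2.norm_diff₂₃_le t hx₂ hx₃ hh₂ hh₃).trans (le_of_eq (by ring))) hx₁ hh₁
  refine le_trans (le_of_eq ?_) (this.trans (le_of_eq (by ring)))
  congr 1
  ring

/-! ### Averages of kernels over squares of intervals and rectangles -/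

/-- `∫_I ∫_I k(s - t, z) ds dt`, the partial kernel of a convolution kernel `k`. -/
def kA (k : R3 → ℂ) (I : Intv) (z : ℝ × ℝ) : ℂ := ∫ p in I.set ×ˢ I.set, k (p.1 - p.2, z)

/-- `∫_R ∫_R k(t, u - v) du dv`, the other partial kernel of a convolution kernel `k`. -/
def kB (k : R3 → ℂ) (R : Rect) (t : ℝ) : ℂ := ∫ q in R.set ×ˢ R.set, k (t, q.1 - q.2)

lemma integrableOn_of_isBounded {X : Type*} [MetricSpace X] [ProperSpace X]
    [MeasurableSpace X] [OpensMeasurableSpace X] {μ : Measure X} [IsFiniteMeasureOnCompacts μ]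
    {E : Type*} [NormedAddCommGroup E] {g : X → E} (hg : Continuous g) {S : Set X}
    (hS : Bornology.IsBounded S) : IntegrableOn g S μ :=
  (hg.continuousOn.integrableOn_compact hS.isCompact_closure).mono_set subset_closure

lemma Intv.isBounded (I : Intv) : Bornology.IsBounded I.set := Metric.isBounded_Ico _ _

lemma Rect.isBounded (R : Rect) : Bornology.IsBounded R.set := R.1.isBounded.prod R.2.isBounded

lemma Intv.measurableSet (I : Intv) : MeasurableSet I.set := measurableSet_Ico

lemma Rect.measurableSet (R : Rect) : MeasurableSet R.set :=
  R.1.measurableSet.prod R.2.measurableSet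

lemma Intv.len_pos (I : Intv) : 0 < I.len := sub_pos.2 I.lt

lemma Intv.volume_real (I : Intv) : volume.real I.set = I.len := by
  simp [Intv.set, Intv.len, Real.volume_real_Ico_of_le I.lt.le]

lemma Intv.volume_lt_top (I : Intv) : volume I.set < ⊤ := I.isBounded.measure_lt_top

lemma w_sq_le (t : ℝ) : w t ^ 2 ≤ (1 + t ^ 2)⁻¹ := by
  unfold w
  rw [inv_pow]
  refine inv_anti₀ (by positivity) ?_
  nlinarith [abs_nonneg t, sq_abs t]

lemma continuous_w : Continuous w := by
  unfold w
  exact (continuous_const.add continuous_abs).inv₀ fun t => (show 0 < 1 + |t| by positivity).ne'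

lemma integrable_w_sq {lam : ℝ} (hl : 0 < lam) (x : ℝ) :
    Integrable (fun t => w (lam * (x - t)) ^ 2) ∧
      ∫ t, w (lam * (x - t)) ^ 2 ≤ Real.pi / lam := by
  have h1 : Integrable fun t : ℝ => (1 + (lam * t) ^ 2)⁻¹ :=
    integrable_inv_one_add_sq.comp_mul_left' hl.ne'
  have h2 : Integrable fun t : ℝ => (1 + (lam * (x - t)) ^ 2)⁻¹ := h1.comp_sub_left x
  have h3 : Integrable fun t => w (lam * (x - t)) ^ 2 := by
    refine h2.mono' ?_ (Eventually.of_forall fun t => ?_)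
    · exact ((continuous_w.comp (by fun_prop)).pow 2).aestronglyMeasurable
    · rw [Real.norm_of_nonneg (sq_nonneg _)]
      exact w_sq_le _
  refine ⟨h3, (integral_mono h3 h2 fun t => w_sq_le _).trans (le_of_eq ?_)⟩
  rw [integral_sub_left_eq_self (fun t : ℝ => (1 + (lam * t) ^ 2)⁻¹) volume x,
    Measure.integral_comp_mul_left (fun t : ℝ => (1 + t ^ 2)⁻¹) lam, integral_univ_inv_one_add_sq,
    abs_of_pos (by positivity), smul_eq_mul]
  ring

lemma setIntegral_w_sq_le {lam : ℝ} (hl : 0 < lam) (x : ℝ) (S : Set ℝ) :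
    ∫ t in S, w (lam * (x - t)) ^ 2 ≤ Real.pi / lam :=
  (setIntegral_le_integral (integrable_w_sq hl x).1
    (Eventually.of_forall fun _ => sq_nonneg _)).trans (integrable_w_sq hl x).2

lemma w_neg (t : ℝ) : w (-t) = w t := by simp [w]

lemma w_mul_sub_comm (lam s t : ℝ) : w (lam * (s - t)) = w (lam * (t - s)) := by
  rw [← w_neg, ← mul_neg, neg_sub]

lemma setIntegral_w_sq_le' {lam : ℝ} (hl : 0 < lam) (a : ℝ) (S : Set ℝ) :
    ∫ x in S, w (lam * (x - a)) ^ 2 ≤ Real.pi / lam := by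
  simp only [w_mul_sub_comm lam _ a]
  exact setIntegral_w_sq_le hl a S

lemma setIntegral_w_sq_le_len (lam : ℝ) (x : ℝ) (I : Intv) :
    ∫ t in I.set, w (lam * (x - t)) ^ 2 ≤ I.len := by
  have h := norm_setIntegral_le_of_norm_le_const (μ := volume) (C := 1)
    (f := fun t => w (lam * (x - t)) ^ 2) I.volume_lt_top fun t _ => by
      rw [Real.norm_of_nonneg (sq_nonneg _)]
      exact pow_le_one₀ (w_pos _).le (w_le_one _)
  rw [I.volume_real, one_mul] at h
  exact (le_abs_self _).trans h

/-- The integral of a derivative over an interval is controlled by the primitive at the ends. -/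
lemma norm_setIntegral_deriv_le {θ Θ : ℝ → ℂ} {B lam : ℝ} (hθ : Continuous θ)
    (hd : ∀ t, HasDerivAt Θ (θ t) t) (hB : ∀ t, ‖Θ t‖ ≤ B * w (lam * t) ^ 2) (I : Intv) (x : ℝ) :
    ‖∫ y in I.set, θ (x - y)‖ ≤ B * (w (lam * (x - I.a)) ^ 2 + w (lam * (x - I.b)) ^ 2) := by
  have h1 : ∫ y in I.set, θ (x - y) = Θ (x - I.a) - Θ (x - I.b) := by
    rw [Intv.set, integral_Ico_eq_integral_Ioc, ← intervalIntegral.integral_of_le I.lt.le,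
      intervalIntegral.integral_comp_sub_left (fun y => θ y) x]
    exact intervalIntegral.integral_eq_sub_of_hasDerivAt (fun t _ => hd t)
      (hθ.intervalIntegrable _ _)
  rw [h1, mul_add]
  exact (norm_sub_le _ _).trans (add_le_add (hB _) (hB _))

/-- Averages of a function with a decaying primitive over the square of an interval. -/
lemma norm_avg₁_le {θ Θ : ℝ → ℂ} {c lam : ℝ} (hl : 0 < lam) (hθ : Continuous θ)
    (hd : ∀ t, HasDerivAt Θ (θ t) t) (hb : ∀ t, ‖θ t‖ ≤ c * w (lam * t) ^ 2)
    (hB : ∀ t, ‖Θ t‖ ≤ c / lam * w (lam * t) ^ 2) (I : Intv) :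
    ‖∫ p in I.set ×ˢ I.set, θ (p.1 - p.2)‖ ≤
      8 * (c / lam ^ 2) * min 1 ((lam * I.len) ^ 2) := by
  have hc : 0 ≤ c := by
    have := (norm_nonneg _).trans (hb 0)
    simpa [w] using this
  rw [mul_min_of_nonneg _ _ (by positivity), mul_one]
  refine le_min ?_ ?_
  · have hint : IntegrableOn (fun p : ℝ × ℝ => θ (p.1 - p.2)) (I.set ×ˢ I.set)
        (volume.prod volume) :=
      integrableOn_of_isBounded (by fun_prop) (I.isBounded.prod I.isBounded)
    rw [show (volume : Measure (ℝ × ℝ)) = volume.prod volume from rfl, setIntegral_prod _ hint]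
    have hbi : Integrable (fun x => c / lam * (w (lam * (x - I.a)) ^ 2 + w (lam * (x - I.b)) ^ 2))
        (volume.restrict I.set) := by
      refine integrableOn_of_isBounded ?_ I.isBounded
      have := continuous_w
      fun_prop
    refine (norm_integral_le_of_norm_le hbi (Eventually.of_forall fun x =>
      norm_setIntegral_deriv_le hθ hd hB I x)).trans ?_
    have hi : ∀ a, Integrable (fun x => w (lam * (x - a)) ^ 2) (volume.restrict I.set) := fun a => by
      refine integrableOn_of_isBounded ?_ I.isBounded
      have := continuous_w
      fun_prop
    rw [integral_const_mul, integral_add (hi _) (hi _)]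
    calc c / lam * _ ≤ c / lam * (Real.pi / lam + Real.pi / lam) :=
          mul_le_mul_of_nonneg_left (add_le_add (setIntegral_w_sq_le' hl _ _)
            (setIntegral_w_sq_le' hl _ _)) (by positivity)
      _ = (2 * Real.pi) * (c / lam ^ 2) := by ring
      _ ≤ 8 * (c / lam ^ 2) :=
          mul_le_mul_of_nonneg_right (by linarith [Real.pi_lt_four]) (by positivity)
  · have h := norm_setIntegral_le_of_norm_le_const (μ := (volume : Measure (ℝ × ℝ))) (C := c)
      (f := fun p : ℝ × ℝ => θ (p.1 - p.2)) (s := I.set ×ˢ I.set)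
      (I.isBounded.prod I.isBounded).measure_lt_top fun p _ =>
        (hb _).trans (mul_le_of_le_one_right hc (pow_le_one₀ (w_pos _).le (w_le_one _)))
    have hv : volume.real (I.set ×ˢ I.set) = I.len ^ 2 := by
      rw [show (volume : Measure (ℝ × ℝ)) = volume.prod volume from rfl, measureReal_prod_prod,
        I.volume_real, sq]
    rw [hv] at h
    refine h.trans ?_
    have : 0 < I.len := I.len_pos
    have e : 8 * (c / lam ^ 2) * (lam * I.len) ^ 2 = 8 * (c * I.len ^ 2) := by field_simp
    rw [e]
    have : 0 ≤ c * I.len ^ 2 := by positivity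
    linarith

/-- The decaying weight of the plane at the scales `(l₂⁻¹, l₃⁻¹)`. -/
def w2 (l₂ l₃ : ℝ) (u : ℝ × ℝ) : ℝ := w (l₂ * u.1) ^ 2 * w (l₃ * u.2) ^ 2

lemma w2_nonneg (l₂ l₃ : ℝ) (u : ℝ × ℝ) : 0 ≤ w2 l₂ l₃ u := by unfold w2; positivity

lemma continuous_w2 (l₂ l₃ : ℝ) : Continuous (w2 l₂ l₃) := by
  have := continuous_w
  unfold w2
  fun_prop

lemma integral_w_sq_nonneg (lam x : ℝ) (S : Set ℝ) : 0 ≤ ∫ t in S, w (lam * (x - t)) ^ 2 :=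
  integral_nonneg fun _ => sq_nonneg _

lemma setIntegral_w2 (l₂ l₃ : ℝ) (R : Rect) (x : ℝ × ℝ) :
    ∫ y in R.set, w2 l₂ l₃ (x - y) = (∫ t in R.1.set, w (l₂ * (x.1 - t)) ^ 2) *
      ∫ t in R.2.set, w (l₃ * (x.2 - t)) ^ 2 := by
  rw [show (volume : Measure (ℝ × ℝ)) = volume.prod volume from rfl, Rect.set,
    ← setIntegral_prod_mul]
  rfl

/-- The trivial bound for averages over the square of a rectangle. -/
lemma norm_avg₂_le_of_bound {f : ℝ × ℝ → ℂ} {c l₂ l₃ G : ℝ} (hf : Continuous f)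
    (hc : 0 ≤ c) (hb : ∀ u, ‖f u‖ ≤ c * w2 l₂ l₃ u) (R : Rect)
    (hG : ∀ x, ∫ y in R.set, w2 l₂ l₃ (x - y) ≤ G) :
    ‖∫ q in R.set ×ˢ R.set, f (q.1 - q.2)‖ ≤ c * (R.1.len * R.2.len) * G := by
  have hint : IntegrableOn (fun p : (ℝ × ℝ) × (ℝ × ℝ) => f (p.1 - p.2)) (R.set ×ˢ R.set)
      (volume.prod volume) :=
    integrableOn_of_isBounded (by fun_prop) (R.isBounded.prod R.isBounded)
  rw [show (volume : Measure ((ℝ × ℝ) × (ℝ × ℝ))) = volume.prod volume from rfl,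
    setIntegral_prod _ hint]
  have hx : ∀ x ∈ R.set, ‖∫ y in R.set, f (x - y)‖ ≤ c * G := by
    intro x _
    have hi : Integrable (fun y => c * w2 l₂ l₃ (x - y)) (volume.restrict R.set) := by
      refine integrableOn_of_isBounded ?_ R.isBounded
      have := continuous_w2 l₂ l₃
      fun_prop
    refine (norm_integral_le_of_norm_le hi (Eventually.of_forall fun y => hb _)).trans ?_
    rw [integral_const_mul]
    exact mul_le_mul_of_nonneg_left (hG x) hc
  have h := norm_setIntegral_le_of_norm_le_const (μ := (volume : Measure (ℝ × ℝ)))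
    R.isBounded.measure_lt_top hx
  have hv : volume.real R.set = R.1.len * R.2.len := by
    rw [show (volume : Measure (ℝ × ℝ)) = volume.prod volume from rfl, Rect.set,
      measureReal_prod_prod, R.1.volume_real, R.2.volume_real]
  rw [hv] at h
  refine h.trans (le_of_eq (by ring))

lemma norm_avg₂_le_of_outer {f : ℝ × ℝ → ℂ} {g : ℝ × ℝ → ℝ} {G : ℝ} (hf : Continuous f)
    (hg : Continuous g) (R : Rect)
    (hb : ∀ x, ‖∫ y in R.set, f (x - y)‖ ≤ g x) (hG : ∫ x in R.set, g x ≤ G) :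
    ‖∫ q in R.set ×ˢ R.set, f (q.1 - q.2)‖ ≤ G := by
  have hint : IntegrableOn (fun p : (ℝ × ℝ) × (ℝ × ℝ) => f (p.1 - p.2)) (R.set ×ˢ R.set)
      (volume.prod volume) :=
    integrableOn_of_isBounded (by fun_prop) (R.isBounded.prod R.isBounded)
  rw [show (volume : Measure ((ℝ × ℝ) × (ℝ × ℝ))) = volume.prod volume from rfl,
    setIntegral_prod _ hint]
  exact (norm_integral_le_of_norm_le (integrableOn_of_isBounded hg R.isBounded)
    (Eventually.of_forall hb)).trans hG

/-- Averages of an `x₂`-derivative over the square of a rectangle. -/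
lemma norm_avg₂_deriv₂_le {f F : ℝ × ℝ → ℂ} {B l₂ l₃ : ℝ} (h₂ : 0 < l₂) (h₃ : 0 < l₃)
    (hf : Continuous f) (hd : ∀ s t, HasDerivAt (fun s => F (s, t)) (f (s, t)) s)
    (hB : ∀ u, ‖F u‖ ≤ B * w2 l₂ l₃ u) (R : Rect) :
    ‖∫ q in R.set ×ˢ R.set, f (q.1 - q.2)‖ ≤
      2 * Real.pi ^ 2 * (B / (l₂ * l₃)) * R.2.len := by
  have hB0 : 0 ≤ B := by
    have := (norm_nonneg _).trans (hB 0)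
    simpa [w2, w] using this
  have hw := continuous_w
  set G : ℝ → ℝ := fun s => w (l₂ * (s - R.1.a)) ^ 2 + w (l₂ * (s - R.1.b)) ^ 2 with hGdef
  have hGc : Continuous G := by rw [hGdef]; fun_prop
  have hG0 : ∀ s, 0 ≤ G s := fun s => by rw [hGdef]; positivity
  refine norm_avg₂_le_of_outer (g := fun x => B * (Real.pi / l₃) * (G x.1 * 1)) hf
    (by fun_prop) R (fun x => ?_) ?_
  · have hint : IntegrableOn (fun y : ℝ × ℝ => f (x - y)) (R.1.set ×ˢ R.2.set)
        (volume.prod volume) :=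
      integrableOn_of_isBounded (by fun_prop) (R.1.isBounded.prod R.2.isBounded)
    have e : ∫ y in R.set, f (x - y) = ∫ t in R.2.set, ∫ s in R.1.set, f (x.1 - s, x.2 - t) := by
      rw [show (volume : Measure (ℝ × ℝ)) = volume.prod volume from rfl, Rect.set,
        ← Measure.prod_restrict, integral_prod_symm]
      · rfl
      · rw [Measure.prod_restrict]; exact hint
    rw [e]
    have hi : Integrable (fun t => B * w (l₃ * (x.2 - t)) ^ 2 * G x.1)
        (volume.restrict R.2.set) :=
      integrableOn_of_isBounded (by fun_prop) R.2.isBounded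
    refine (norm_integral_le_of_norm_le hi (Eventually.of_forall fun t => ?_)).trans ?_
    · exact norm_setIntegral_deriv_le (θ := fun s => f (s, x.2 - t))
        (Θ := fun s => F (s, x.2 - t)) (by fun_prop) (fun s => hd s _)
        (fun s => (hB _).trans (le_of_eq (by unfold w2; ring))) R.1 x.1
    · rw [integral_mul_const, integral_const_mul, mul_one]
      exact mul_le_mul_of_nonneg_right
        (mul_le_mul_of_nonneg_left (setIntegral_w_sq_le h₃ _ _) hB0) (hG0 _)
  · rw [integral_const_mul, show (volume : Measure (ℝ × ℝ)) = volume.prod volume from rfl, Rect.set,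
      setIntegral_prod_mul (fun s => G s) (fun _ => (1 : ℝ))]
    have hi : ∀ a, Integrable (fun x => w (l₂ * (x - a)) ^ 2) (volume.restrict R.1.set) :=
      fun a => integrableOn_of_isBounded (by fun_prop) R.1.isBounded
    have hGi : ∫ s in R.1.set, G s ≤ Real.pi / l₂ + Real.pi / l₂ := by
      rw [hGdef, integral_add (hi _) (hi _)]
      exact add_le_add (setIntegral_w_sq_le' h₂ _ _) (setIntegral_w_sq_le' h₂ _ _)
    have h1 : ∫ _ in R.2.set, (1 : ℝ) = R.2.len := by simp [R.2.volume_real]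
    rw [h1]
    have hpi := Real.pi_pos
    have hlen := R.2.len_pos
    calc B * (Real.pi / l₃) * ((∫ s in R.1.set, G s) * R.2.len)
        ≤ B * (Real.pi / l₃) * ((Real.pi / l₂ + Real.pi / l₂) * R.2.len) := by gcongr
      _ = _ := by field_simp; ring

/-- Averages of an `x₃`-derivative over the square of a rectangle. -/
lemma norm_avg₂_deriv₃_le {f F : ℝ × ℝ → ℂ} {B l₂ l₃ : ℝ} (h₂ : 0 < l₂) (h₃ : 0 < l₃)
    (hf : Continuous f) (hd : ∀ s t, HasDerivAt (fun t => F (s, t)) (f (s, t)) t)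
    (hB : ∀ u, ‖F u‖ ≤ B * w2 l₂ l₃ u) (R : Rect) :
    ‖∫ q in R.set ×ˢ R.set, f (q.1 - q.2)‖ ≤
      2 * Real.pi ^ 2 * (B / (l₂ * l₃)) * R.1.len := by
  have hB0 : 0 ≤ B := by
    have := (norm_nonneg _).trans (hB 0)
    simpa [w2, w] using this
  have hw := continuous_w
  set G : ℝ → ℝ := fun s => w (l₃ * (s - R.2.a)) ^ 2 + w (l₃ * (s - R.2.b)) ^ 2 with hGdef
  have hGc : Continuous G := by rw [hGdef]; fun_prop
  have hG0 : ∀ s, 0 ≤ G s := fun s => by rw [hGdef]; positivity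
  refine norm_avg₂_le_of_outer (g := fun x => B * (Real.pi / l₂) * (1 * G x.2)) hf
    (by fun_prop) R (fun x => ?_) ?_
  · have hint : IntegrableOn (fun y : ℝ × ℝ => f (x - y)) (R.1.set ×ˢ R.2.set)
        (volume.prod volume) :=
      integrableOn_of_isBounded (by fun_prop) (R.1.isBounded.prod R.2.isBounded)
    have e : ∫ y in R.set, f (x - y) = ∫ s in R.1.set, ∫ t in R.2.set, f (x.1 - s, x.2 - t) := by
      rw [show (volume : Measure (ℝ × ℝ)) = volume.prod volume from rfl, Rect.set,
        setIntegral_prod _ hint]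
      rfl
    rw [e]
    have hi : Integrable (fun t => B * w (l₂ * (x.1 - t)) ^ 2 * G x.2)
        (volume.restrict R.1.set) :=
      integrableOn_of_isBounded (by fun_prop) R.1.isBounded
    refine (norm_integral_le_of_norm_le hi (Eventually.of_forall fun s => ?_)).trans ?_
    · exact norm_setIntegral_deriv_le (θ := fun t => f (x.1 - s, t))
        (Θ := fun t => F (x.1 - s, t)) (by fun_prop) (fun t => hd _ t)
        (fun t => (hB _).trans (le_of_eq (by unfold w2; ring))) R.2 x.2
    · rw [integral_mul_const, integral_const_mul, one_mul]
      exact mul_le_mul_of_nonneg_right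
        (mul_le_mul_of_nonneg_left (setIntegral_w_sq_le h₂ _ _) hB0) (hG0 _)
  · rw [integral_const_mul, show (volume : Measure (ℝ × ℝ)) = volume.prod volume from rfl, Rect.set,
      setIntegral_prod_mul (fun _ => (1 : ℝ)) (fun s => G s)]
    have hi : ∀ a, Integrable (fun x => w (l₃ * (x - a)) ^ 2) (volume.restrict R.2.set) :=
      fun a => integrableOn_of_isBounded (by fun_prop) R.2.isBounded
    have hGi : ∫ s in R.2.set, G s ≤ Real.pi / l₃ + Real.pi / l₃ := by
      rw [hGdef, integral_add (hi _) (hi _)]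
      exact add_le_add (setIntegral_w_sq_le' h₃ _ _) (setIntegral_w_sq_le' h₃ _ _)
    have h1 : ∫ _ in R.1.set, (1 : ℝ) = R.1.len := by simp [R.1.volume_real]
    rw [h1]
    have hpi := Real.pi_pos
    have hlen := R.1.len_pos
    calc B * (Real.pi / l₂) * (R.1.len * ∫ s in R.2.set, G s)
        ≤ B * (Real.pi / l₂) * (R.1.len * (Real.pi / l₃ + Real.pi / l₃)) := by gcongr
      _ = _ := by field_simp; ring

/-- Averages over the square of a rectangle of a function `f = ∂₂ F₂ + ∂₃ F₃`: the trivial bound is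
used if the shorter side is small compared with the scale, the primitives if it is large. -/
lemma norm_avg₂_le {f f₂ f₃ F₂ F₃ : ℝ × ℝ → ℂ} {c l₂ l₃ : ℝ} (h₂ : 0 < l₂) (h₃ : 0 < l₃)
    (hf₂ : Continuous f₂) (hf₃ : Continuous f₃) (hf : ∀ u, f u = f₂ u + f₃ u)
    (hd₂ : ∀ s t, HasDerivAt (fun s => F₂ (s, t)) (f₂ (s, t)) s)
    (hd₃ : ∀ s t, HasDerivAt (fun t => F₃ (s, t)) (f₃ (s, t)) t)
    (hb : ∀ u, ‖f u‖ ≤ c * w2 l₂ l₃ u) (hB₂ : ∀ u, ‖F₂ u‖ ≤ c / l₂ * w2 l₂ l₃ u)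
    (hB₃ : ∀ u, ‖F₃ u‖ ≤ c / l₃ * w2 l₂ l₃ u) (R : Rect) :
    ‖∫ q in R.set ×ˢ R.set, f (q.1 - q.2)‖ ≤ 64 * c * (R.area / (l₂ * l₃)) *
      min (min (l₂ * R.1.len) (l₃ * R.2.len)) (min (l₂ * R.1.len) (l₃ * R.2.len))⁻¹ := by
  have hc : 0 ≤ c := by
    have := (norm_nonneg _).trans (hb 0)
    simpa [w2, w] using this
  have hlen₂ := R.1.len_pos
  have hlen₃ := R.2.len_pos
  have hpi := Real.pi_pos
  have hpi4 := Real.pi_lt_four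
  have hfc : Continuous f := by rw [funext hf]; exact hf₂.add hf₃
  set m := min (l₂ * R.1.len) (l₃ * R.2.len) with hm
  have hm0 : 0 < m := by positivity
  unfold Rect.area
  rw [mul_min_of_nonneg _ _ (by positivity)]
  refine le_min ?_ ?_
  · have hG : ∀ x, ∫ y in R.set, w2 l₂ l₃ (x - y) ≤ 4 * m / (l₂ * l₃) := by
      intro x
      rw [setIntegral_w2]
      have a1 := setIntegral_w_sq_le h₂ x.1 R.1.set
      have a2 := setIntegral_w_sq_le h₃ x.2 R.2.set
      have b1 := setIntegral_w_sq_le_len l₂ x.1 R.1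
      have b2 := setIntegral_w_sq_le_len l₃ x.2 R.2
      have n1 := integral_w_sq_nonneg l₂ x.1 R.1.set
      have n2 := integral_w_sq_nonneg l₃ x.2 R.2.set
      rcases le_total (l₂ * R.1.len) (l₃ * R.2.len) with h | h
      · rw [hm, min_eq_left h]
        calc _ ≤ R.1.len * (Real.pi / l₃) := mul_le_mul b1 a2 n2 hlen₂.le
          _ = Real.pi * (l₂ * R.1.len) / (l₂ * l₃) := by field_simp
          _ ≤ _ := by gcongr
      · rw [hm, min_eq_right h]
        calc _ ≤ (Real.pi / l₂) * R.2.len := mul_le_mul a1 b2 n2 (by positivity)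
          _ = Real.pi * (l₃ * R.2.len) / (l₂ * l₃) := by field_simp
          _ ≤ _ := by gcongr
    refine (norm_avg₂_le_of_bound hfc hc hb R hG).trans ?_
    have : 0 ≤ c * (R.1.len * R.2.len / (l₂ * l₃)) * m := by positivity
    calc c * (R.1.len * R.2.len) * (4 * m / (l₂ * l₃))
        = 4 * (c * (R.1.len * R.2.len / (l₂ * l₃)) * m) := by ring
      _ ≤ _ := by linarith
  · have e : ∫ q in R.set ×ˢ R.set, f (q.1 - q.2) =
        (∫ q in R.set ×ˢ R.set, f₂ (q.1 - q.2)) + ∫ q in R.set ×ˢ R.set, f₃ (q.1 - q.2) := by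
      simp only [hf]
      exact integral_add
        (integrableOn_of_isBounded (by fun_prop) (R.isBounded.prod R.isBounded))
        (integrableOn_of_isBounded (by fun_prop) (R.isBounded.prod R.isBounded))
    rw [e]
    refine (norm_add_le _ _).trans ((add_le_add (norm_avg₂_deriv₂_le h₂ h₃ hf₂ hd₂ hB₂ R)
      (norm_avg₂_deriv₃_le h₂ h₃ hf₃ hd₃ hB₃ R)).trans ?_)
    have i2 : (l₂ * R.1.len)⁻¹ ≤ m⁻¹ := inv_anti₀ hm0 (min_le_left _ _)
    have i3 : (l₃ * R.2.len)⁻¹ ≤ m⁻¹ := inv_anti₀ hm0 (min_le_right _ _)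
    have hp : 2 * Real.pi ^ 2 ≤ 32 := by nlinarith
    calc 2 * Real.pi ^ 2 * (c / l₂ / (l₂ * l₃)) * R.2.len +
          2 * Real.pi ^ 2 * (c / l₃ / (l₂ * l₃)) * R.1.len
        = 2 * Real.pi ^ 2 * (c * (R.1.len * R.2.len / (l₂ * l₃))) *
          ((l₂ * R.1.len)⁻¹ + (l₃ * R.2.len)⁻¹) := by field_simp
      _ ≤ 32 * (c * (R.1.len * R.2.len / (l₂ * l₃))) * (m⁻¹ + m⁻¹) := by gcongr
      _ = _ := by ring

/-! ### Rescaled bump functions -/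

/-- The `L¹`-normalized rescaling of `ψ` by the Zygmund dilation `ρ_{a,b}`. -/
def sc (a b : ℝ) (ψ : R3 → ℂ) (x : R3) : ℂ :=
  ((a ^ 2 * b ^ 2 : ℝ) : ℂ) * ψ (a * x.1, b * x.2.1, a * b * x.2.2)

lemma continuous_sc {a b : ℝ} {ψ : R3 → ℂ} (h : Continuous ψ) : Continuous (sc a b ψ) := by
  unfold sc; fun_prop

lemma norm_ofReal_mul {r : ℝ} (hr : 0 ≤ r) (z : ℂ) : ‖(r : ℂ) * z‖ = r * ‖z‖ := by
  rw [norm_mul, Complex.norm_real, Real.norm_of_nonneg hr]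

lemma abs_mul_le_half {a x h : ℝ} (ha : 0 < a) (hh : |h| ≤ |x| / 2) : |a * h| ≤ |a * x| / 2 := by
  rw [abs_mul, abs_mul, abs_of_pos ha]; nlinarith

lemma abs_mul_div_abs_mul {a : ℝ} (ha : 0 < a) (x h : ℝ) : |a * h| / |a * x| = |h| / |x| := by
  rw [abs_mul, abs_mul, abs_of_pos ha, mul_div_mul_left _ _ ha.ne']

lemma incr_mul {a b : ℝ} (ha : 0 < a) (hb : 0 < b) (x₂ x₃ h₂ h₃ : ℝ) :
    incr (a * x₂) (b * x₃) (a * h₂) (b * h₃) = incr x₂ x₃ h₂ h₃ := by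
  unfold incr; rw [abs_mul_div_abs_mul ha, abs_mul_div_abs_mul hb]

lemma w_pow_le_pow {m n : ℕ} (h : n ≤ m) (t : ℝ) : w t ^ m ≤ w t ^ n :=
  pow_le_pow_of_le_one (w_pos t).le (w_le_one t) h

/-- The weight of order three in each variable, at scale `(a, b)`. -/
def wt (a b : ℝ) (x₁ x₂ x₃ : ℝ) : ℝ := w (a * x₁) ^ 3 * w (b * x₂) ^ 3 * w (a * b * x₃) ^ 3

section
variable {d : ℕ} {c a b : ℝ} {ψ : R3 → ℂ}

lemma IsBump.norm_sc_le_pow (h : IsBump d c ψ) (x : R3) :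
    ‖sc a b ψ x‖ ≤
      a ^ 2 * b ^ 2 * (c * (w (a * x.1) ^ 4 * w (b * x.2.1) ^ 4 * w (a * b * x.2.2) ^ 4)) := by
  unfold sc
  rw [norm_ofReal_mul (by positivity)]
  exact mul_le_mul_of_nonneg_left (h.base.2 _) (by positivity)

lemma IsBump.norm_sc_le (h : IsBump d c ψ) (x₁ x₂ x₃ : ℝ) :
    ‖sc a b ψ (x₁, x₂, x₃)‖ ≤ c * (a ^ 2 * b ^ 2 * wt a b x₁ x₂ x₃) := by
  refine (h.norm_sc_le_pow _).trans ?_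
  have hc := h.nonneg
  have p₁ := w_pos (a * x₁)
  have p₂ := w_pos (b * x₂)
  have p₃ := w_pos (a * b * x₃)
  have e : c * (a ^ 2 * b ^ 2 * wt a b x₁ x₂ x₃) = a ^ 2 * b ^ 2 * (c * wt a b x₁ x₂ x₃) := by ring
  rw [e]
  unfold wt
  have q₁ : w (a * x₁) ^ 4 ≤ w (a * x₁) ^ 3 := w_pow_le_pow (by norm_num) _
  have q₂ : w (b * x₂) ^ 4 ≤ w (b * x₂) ^ 3 := w_pow_le_pow (by norm_num) _
  have q₃ : w (a * b * x₃) ^ 4 ≤ w (a * b * x₃) ^ 3 := w_pow_le_pow (by norm_num) _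
  exact mul_le_mul_of_nonneg_left (mul_le_mul_of_nonneg_left (mul_le_mul (mul_le_mul q₁ q₂
    (by positivity) (by positivity)) q₃ (by positivity) (by positivity)) hc) (by positivity)

lemma IsBump.norm_sc_diff₁_le (h : IsBump (d + 1) c ψ) (ha : 0 < a) (hb : 0 < b) {x₁ h₁ : ℝ}
    (x₂ x₃ : ℝ) (hx : x₁ ≠ 0) (hh : |h₁| ≤ |x₁| / 2) :
    ‖sc a b ψ (x₁ + h₁, x₂, x₃) - sc a b ψ (x₁, x₂, x₃)‖ ≤
      16 * c * (|h₁| / |x₁|) * (a ^ 2 * b ^ 2 *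
        (w (a * x₁) ^ 3 * w (b * x₂) ^ 4 * w (a * b * x₃) ^ 4)) := by
  have := h.norm_diff₁_le (x₁ := a * x₁) (h₁ := a * h₁) (b * x₂) (a * b * x₃)
    (mul_ne_zero ha.ne' hx) (abs_mul_le_half ha hh)
  rw [abs_mul_div_abs_mul ha, ← mul_add] at this
  unfold sc
  rw [← mul_sub, norm_ofReal_mul (by positivity)]
  exact (mul_le_mul_of_nonneg_left this (by positivity)).trans (le_of_eq (by ring))

lemma IsBump.norm_sc_diff₂₃_le (h : IsBump (d + 1) c ψ) (ha : 0 < a) (hb : 0 < b)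
    {x₂ x₃ h₂ h₃ : ℝ} (x₁ : ℝ) (hx₂ : x₂ ≠ 0) (hx₃ : x₃ ≠ 0) (hh₂ : |h₂| ≤ |x₂| / 2)
    (hh₃ : |h₃| ≤ |x₃| / 2) :
    ‖sc a b ψ (x₁, x₂ + h₂, x₃ + h₃) - sc a b ψ (x₁, x₂, x₃)‖ ≤
      256 * c * incr x₂ x₃ h₂ h₃ * (a ^ 2 * b ^ 2 *
        (w (a * x₁) ^ 4 * w (b * x₂) ^ 3 * w (a * b * x₃) ^ 3)) := by
  have hab : 0 < a * b := by positivity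
  have := h.norm_diff₂₃_le (x₂ := b * x₂) (h₂ := b * h₂) (x₃ := a * b * x₃) (h₃ := a * b * h₃)
    (a * x₁) (mul_ne_zero hb.ne' hx₂) (mul_ne_zero hab.ne' hx₃) (abs_mul_le_half hb hh₂)
    (abs_mul_le_half hab hh₃)
  rw [incr_mul hb hab, ← mul_add, ← mul_add] at this
  unfold sc
  rw [← mul_sub, norm_ofReal_mul (by positivity)]
  exact (mul_le_mul_of_nonneg_left this (by positivity)).trans (le_of_eq (by ring))

lemma IsBump.norm_sc_diff₁₂₃_le (h : IsBump (d + 2) c ψ) (ha : 0 < a) (hb : 0 < b)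
    {x₁ x₂ x₃ h₁ h₂ h₃ : ℝ} (hx₁ : x₁ ≠ 0) (hx₂ : x₂ ≠ 0) (hx₃ : x₃ ≠ 0) (hh₁ : |h₁| ≤ |x₁| / 2)
    (hh₂ : |h₂| ≤ |x₂| / 2) (hh₃ : |h₃| ≤ |x₃| / 2) :
    ‖sc a b ψ (x₁ + h₁, x₂ + h₂, x₃ + h₃) - sc a b ψ (x₁ + h₁, x₂, x₃) -
      sc a b ψ (x₁, x₂ + h₂, x₃ + h₃) + sc a b ψ (x₁, x₂, x₃)‖ ≤
      4096 * c * (|h₁| / |x₁| * incr x₂ x₃ h₂ h₃) * (a ^ 2 * b ^ 2 * wt a b x₁ x₂ x₃) := by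
  have hab : 0 < a * b := by positivity
  have := h.norm_diff₁₂₃_le (x₁ := a * x₁) (h₁ := a * h₁) (x₂ := b * x₂) (h₂ := b * h₂)
    (x₃ := a * b * x₃) (h₃ := a * b * h₃)
    (mul_ne_zero ha.ne' hx₁) (mul_ne_zero hb.ne' hx₂) (mul_ne_zero hab.ne' hx₃)
    (abs_mul_le_half ha hh₁) (abs_mul_le_half hb hh₂) (abs_mul_le_half hab hh₃)
  rw [incr_mul hb hab, abs_mul_div_abs_mul ha, ← mul_add, ← mul_add, ← mul_add] at this
  unfold sc
  rw [← mul_sub, ← mul_sub, ← mul_add, norm_ofReal_mul (by positivity)]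
  exact (mul_le_mul_of_nonneg_left this (by positivity)).trans (le_of_eq (by unfold wt; ring))

lemma Par.sc_slice₁ {Θ : R3 → ℂ} (h : Par 0 Θ ψ) (ha : 0 < a) (z : ℝ × ℝ) (t : ℝ) :
    HasDerivAt (fun t => ((a⁻¹ : ℝ) : ℂ) * sc a b Θ (t, z)) (sc a b ψ (t, z)) t := by
  have h1 := ((h.slice₁ (b * z.1) (a * b * z.2) (a * t)).scomp t
    ((hasDerivAt_id t).const_mul a)).const_mul ((a ^ 2 * b ^ 2 : ℝ) : ℂ)
  refine (h1.const_mul ((a⁻¹ : ℝ) : ℂ)).congr_deriv ?_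
  have : (a : ℂ) ≠ 0 := Complex.ofReal_ne_zero.2 ha.ne'
  unfold sc
  simp only [mul_one, Complex.real_smul]
  push_cast
  field_simp

lemma Par.sc_slice₂ {Θ : R3 → ℂ} (h : Par 1 Θ ψ) (hb : 0 < b) (x s t : ℝ) :
    HasDerivAt (fun s => ((b⁻¹ : ℝ) : ℂ) * sc a b Θ (x, s, t)) (sc a b ψ (x, s, t)) s := by
  have h1 := ((h.slice₂ (a * x) (a * b * t) (b * s)).scomp s
    ((hasDerivAt_id s).const_mul b)).const_mul ((a ^ 2 * b ^ 2 : ℝ) : ℂ)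
  refine (h1.const_mul ((b⁻¹ : ℝ) : ℂ)).congr_deriv ?_
  have : (b : ℂ) ≠ 0 := Complex.ofReal_ne_zero.2 hb.ne'
  unfold sc
  simp only [mul_one, Complex.real_smul]
  push_cast
  field_simp

lemma Par.sc_slice₃ {Θ : R3 → ℂ} (h : Par 2 Θ ψ) (ha : 0 < a) (hb : 0 < b) (x s t : ℝ) :
    HasDerivAt (fun t => (((a * b)⁻¹ : ℝ) : ℂ) * sc a b Θ (x, s, t)) (sc a b ψ (x, s, t)) t := by
  have h1 := ((h.slice₃ (a * x) (b * s) (a * b * t)).scomp t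
    ((hasDerivAt_id t).const_mul (a * b))).const_mul ((a ^ 2 * b ^ 2 : ℝ) : ℂ)
  refine (h1.const_mul (((a * b)⁻¹ : ℝ) : ℂ)).congr_deriv ?_
  have : (a : ℂ) ≠ 0 := Complex.ofReal_ne_zero.2 ha.ne'
  have : (b : ℂ) ≠ 0 := Complex.ofReal_ne_zero.2 hb.ne'
  unfold sc
  simp only [mul_one, Complex.real_smul]
  push_cast
  field_simp

/-- The size in `x₁` of a rescaled bump function. -/
lemma IsBump.norm_sc_le₁ (h : IsBump d c ψ) (z : ℝ × ℝ) (t : ℝ) :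
    ‖sc a b ψ (t, z)‖ ≤ c * (a ^ 2 * b ^ 2 * (w (b * z.1) ^ 3 * w (a * b * z.2) ^ 3)) *
      w (a * t) ^ 2 := by
  refine (h.norm_sc_le t z.1 z.2).trans ?_
  have hc := h.nonneg
  have p₁ := w_pos (a * t)
  have p₂ := w_pos (b * z.1)
  have p₃ := w_pos (a * b * z.2)
  calc c * (a ^ 2 * b ^ 2 * wt a b t z.1 z.2)
      = c * (a ^ 2 * b ^ 2 * (w (b * z.1) ^ 3 * w (a * b * z.2) ^ 3)) * w (a * t) ^ 3 := by
        unfold wt; ring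
    _ ≤ _ := mul_le_mul_of_nonneg_left (w_pow_le_pow (by norm_num) _) (by positivity)

/-- The size in `(x₂, x₃)` of a rescaled bump function. -/
lemma IsBump.norm_sc_le₂₃ (h : IsBump d c ψ) (t : ℝ) (u : ℝ × ℝ) :
    ‖sc a b ψ (t, u)‖ ≤ c * (a ^ 2 * b ^ 2 * w (a * t) ^ 3) * w2 b (a * b) u := by
  refine (h.norm_sc_le t u.1 u.2).trans ?_
  have hc := h.nonneg
  have p₁ := w_pos (a * t)
  have p₂ := w_pos (b * u.1)
  have p₃ := w_pos (a * b * u.2)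
  calc c * (a ^ 2 * b ^ 2 * wt a b t u.1 u.2)
      = c * (a ^ 2 * b ^ 2 * w (a * t) ^ 3) * (w (b * u.1) ^ 3 * w (a * b * u.2) ^ 3) := by
        unfold wt; ring
    _ ≤ _ := mul_le_mul_of_nonneg_left (mul_le_mul (w_pow_le_pow (by norm_num) _)
        (w_pow_le_pow (by norm_num) _) (by positivity) (by positivity)) (by positivity)

lemma norm_inv_mul_le {lam r v : ℝ} {z : ℂ} (hl : 0 < lam) (h : ‖z‖ ≤ r * v) :
    ‖((lam⁻¹ : ℝ) : ℂ) * z‖ ≤ r / lam * v := by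
  rw [norm_ofReal_mul (by positivity), div_mul_eq_mul_div, inv_mul_eq_div]
  exact div_le_div_of_nonneg_right h hl.le

/-- The average over the square of a short interval gains the square of its relative length. -/
lemma IsBump.norm_kA_sc_le (h : IsBump (d + 1) c ψ) (ha : 0 < a) (I : Intv) (z : ℝ × ℝ) :
    ‖kA (sc a b ψ) I z‖ ≤ 8 * c * (b ^ 2 * (min 1 ((a * I.len) ^ 2) *
      (w (b * z.1) ^ 3 * w (a * b * z.2) ^ 3))) := by
  obtain ⟨-, -, ⟨Θ, h1, h2⟩, -⟩ := id h
  have hcont : Continuous (sc a b ψ) := continuous_sc h.base.1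
  refine (norm_avg₁_le (θ := fun t => sc a b ψ (t, z)) ha (by fun_prop)
    (fun t => h1.sc_slice₁ ha z t) (fun t => h.norm_sc_le₁ z t)
    (fun t => norm_inv_mul_le ha (h2.norm_sc_le₁ z t)) I).trans (le_of_eq ?_)
  field_simp

lemma IsBump.norm_sc_diff₂₃_le₁ (h : IsBump (d + 1) c ψ) (ha : 0 < a) (hb : 0 < b)
    {x₂ x₃ h₂ h₃ : ℝ} (hx₂ : x₂ ≠ 0) (hx₃ : x₃ ≠ 0) (hh₂ : |h₂| ≤ |x₂| / 2)
    (hh₃ : |h₃| ≤ |x₃| / 2) (t : ℝ) :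
    ‖sc a b ψ (t, x₂ + h₂, x₃ + h₃) - sc a b ψ (t, x₂, x₃)‖ ≤
      256 * c * incr x₂ x₃ h₂ h₃ * (a ^ 2 * b ^ 2 * (w (b * x₂) ^ 3 * w (a * b * x₃) ^ 3)) *
        w (a * t) ^ 2 := by
  refine (h.norm_sc_diff₂₃_le ha hb t hx₂ hx₃ hh₂ hh₃).trans ?_
  have hc := h.nonneg
  have hi := incr_nonneg x₂ x₃ h₂ h₃
  have p₂ := w_pos (b * x₂)
  have p₃ := w_pos (a * b * x₃)
  calc _ = 256 * c * incr x₂ x₃ h₂ h₃ *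
        (a ^ 2 * b ^ 2 * (w (b * x₂) ^ 3 * w (a * b * x₃) ^ 3)) * w (a * t) ^ 4 := by ring
    _ ≤ _ := mul_le_mul_of_nonneg_left (w_pow_le_pow (by norm_num) _) (by positivity)

lemma kA_sub {k : R3 → ℂ} (hk : Continuous k) (I : Intv) (z z' : ℝ × ℝ) :
    kA k I z - kA k I z' = ∫ p in I.set ×ˢ I.set, (k (p.1 - p.2, z) - k (p.1 - p.2, z')) := by
  unfold kA
  rw [integral_sub]
  · exact integrableOn_of_isBounded (by fun_prop) (I.isBounded.prod I.isBounded)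
  · exact integrableOn_of_isBounded (by fun_prop) (I.isBounded.prod I.isBounded)

lemma kB_sub {k : R3 → ℂ} (hk : Continuous k) (R : Rect) (t t' : ℝ) :
    kB k R t - kB k R t' = ∫ q in R.set ×ˢ R.set, (k (t, q.1 - q.2) - k (t', q.1 - q.2)) := by
  unfold kB
  rw [integral_sub]
  · exact integrableOn_of_isBounded (by fun_prop) (R.isBounded.prod R.isBounded)
  · exact integrableOn_of_isBounded (by fun_prop) (R.isBounded.prod R.isBounded)

lemma IsBump.norm_kA_sc_diff_le (h : IsBump (d + 2) c ψ) (ha : 0 < a) (hb : 0 < b) (I : Intv)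
    {x₂ x₃ h₂ h₃ : ℝ} (hx₂ : x₂ ≠ 0) (hx₃ : x₃ ≠ 0) (hh₂ : |h₂| ≤ |x₂| / 2)
    (hh₃ : |h₃| ≤ |x₃| / 2) :
    ‖kA (sc a b ψ) I (x₂ + h₂, x₃ + h₃) - kA (sc a b ψ) I (x₂, x₃)‖ ≤
      2048 * c * incr x₂ x₃ h₂ h₃ * (b ^ 2 * (min 1 ((a * I.len) ^ 2) *
        (w (b * x₂) ^ 3 * w (a * b * x₃) ^ 3))) := by
  -- differences in `(x₂, x₃)` inherit the primitive in `x₁`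
  obtain ⟨-, -, ⟨Θ, h1, h2⟩, -⟩ := id h
  have hcont : Continuous (sc a b ψ) := continuous_sc h.base.1
  rw [kA_sub hcont]
  refine (norm_avg₁_le
    (θ := fun t => sc a b ψ (t, x₂ + h₂, x₃ + h₃) - sc a b ψ (t, x₂, x₃)) ha (by fun_prop)
    (fun t => (h1.sc_slice₁ ha (x₂ + h₂, x₃ + h₃) t).sub (h1.sc_slice₁ ha (x₂, x₃) t))
    (fun t => h.norm_sc_diff₂₃_le₁ ha hb hx₂ hx₃ hh₂ hh₃ t) (fun t => ?_) I).trans (le_of_eq ?_)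
  · rw [Pi.sub_apply, ← mul_sub]
    exact norm_inv_mul_le ha (h2.norm_sc_diff₂₃_le₁ ha hb hx₂ hx₃ hh₂ hh₃ t)
  · field_simp; ring

lemma relSide_eq (j k : ℤ) (ℓ₂ ℓ₃ : ℝ) : relSide j k ℓ₂ ℓ₃ =
    min ((2 : ℝ) ^ k * ℓ₂) ((2 : ℝ) ^ j * (2 : ℝ) ^ k * ℓ₃) := by
  unfold relSide
  rw [mul_min_of_nonneg _ _ (zpow_pos (by norm_num) k).le]
  congr 1; ring

/-- The shorter side of a rectangle relative to the scale `(b, a b)`. -/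
def side (a b : ℝ) (R : Rect) : ℝ := min (b * R.1.len) (a * b * R.2.len)

lemma side_pos (ha : 0 < a) (hb : 0 < b) (R : Rect) : 0 < side a b R := by
  have := R.1.len_pos
  have := R.2.len_pos
  unfold side; positivity

/-- The average over the square of a rectangle decays if its shorter side is far from the scale of
the piece. -/
lemma IsBump.norm_kB_sc_le (h : IsBump (d + 1) c ψ) (ha : 0 < a) (hb : 0 < b) (R : Rect) (t : ℝ) :
    ‖kB (sc a b ψ) R t‖ ≤ 64 * c * R.area *
      (a * w (a * t) ^ 3 * min (side a b R) (side a b R)⁻¹) := by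
  obtain ⟨-, -, -, Θ₂, Θ₃, ψ₂, ψ₃, h1, h2, h3, b1, b2, b3, b4⟩ := id h
  have hab : 0 < a * b := by positivity
  have c2 : Continuous (sc a b ψ₂) := continuous_sc b3.base.1
  have c3 : Continuous (sc a b ψ₃) := continuous_sc b4.base.1
  refine (norm_avg₂_le (f := fun u => sc a b ψ (t, u)) (f₂ := fun u => sc a b ψ₂ (t, u))
    (f₃ := fun u => sc a b ψ₃ (t, u)) hb hab (by fun_prop) (by fun_prop)
    (fun u => by unfold sc; rw [h3, mul_add])
    (fun x y => h1.sc_slice₂ hb t x y) (fun x y => h2.sc_slice₃ ha hb t x y)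
    (fun u => h.norm_sc_le₂₃ t u) (fun u => norm_inv_mul_le hb (b1.norm_sc_le₂₃ t u))
    (fun u => norm_inv_mul_le hab (b2.norm_sc_le₂₃ t u)) R).trans (le_of_eq ?_)
  unfold side
  field_simp

lemma IsBump.norm_sc_diff₁_le₂₃ (h : IsBump (d + 1) c ψ) (ha : 0 < a) (hb : 0 < b) {t h₁ : ℝ}
    (hx : t ≠ 0) (hh : |h₁| ≤ |t| / 2) (u : ℝ × ℝ) :
    ‖sc a b ψ (t + h₁, u) - sc a b ψ (t, u)‖ ≤
      16 * c * (|h₁| / |t|) * (a ^ 2 * b ^ 2 * w (a * t) ^ 3) * w2 b (a * b) u := by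
  refine (h.norm_sc_diff₁_le ha hb u.1 u.2 hx hh).trans ?_
  have hc := h.nonneg
  have p₁ := w_pos (a * t)
  calc _ = 16 * c * (|h₁| / |t|) * (a ^ 2 * b ^ 2 * w (a * t) ^ 3) *
        (w (b * u.1) ^ 4 * w (a * b * u.2) ^ 4) := by ring
    _ ≤ _ := mul_le_mul_of_nonneg_left (mul_le_mul (w_pow_le_pow (by norm_num) _)
        (w_pow_le_pow (by norm_num) _) (pow_nonneg (w_pos _).le _) (sq_nonneg _)) (by positivity)

lemma IsBump.norm_kB_sc_diff_le (h : IsBump (d + 2) c ψ) (ha : 0 < a) (hb : 0 < b) (R : Rect)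
    {t h₁ : ℝ} (hx : t ≠ 0) (hh : |h₁| ≤ |t| / 2) :
    ‖kB (sc a b ψ) R (t + h₁) - kB (sc a b ψ) R t‖ ≤ 1024 * c * (|h₁| / |t|) * R.area *
      (a * w (a * t) ^ 3 * min (side a b R) (side a b R)⁻¹) := by
  obtain ⟨-, -, -, Θ₂, Θ₃, ψ₂, ψ₃, h1, h2, h3, b1, b2, b3, b4⟩ := id h
  have hab : 0 < a * b := by positivity
  have c1 : Continuous (sc a b ψ) := continuous_sc h.base.1
  have c2 : Continuous (sc a b ψ₂) := continuous_sc b3.base.1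
  have c3 : Continuous (sc a b ψ₃) := continuous_sc b4.base.1
  rw [kB_sub c1]
  refine (norm_avg₂_le (f := fun u => sc a b ψ (t + h₁, u) - sc a b ψ (t, u))
    (f₂ := fun u => sc a b ψ₂ (t + h₁, u) - sc a b ψ₂ (t, u))
    (f₃ := fun u => sc a b ψ₃ (t + h₁, u) - sc a b ψ₃ (t, u))
    (F₂ := fun u => ((b⁻¹ : ℝ) : ℂ) * sc a b Θ₂ (t + h₁, u) - ((b⁻¹ : ℝ) : ℂ) * sc a b Θ₂ (t, u))
    (F₃ := fun u => (((a * b)⁻¹ : ℝ) : ℂ) * sc a b Θ₃ (t + h₁, u) -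
      (((a * b)⁻¹ : ℝ) : ℂ) * sc a b Θ₃ (t, u))
    hb hab (by fun_prop) (by fun_prop)
    (fun u => by unfold sc; rw [h3, h3]; ring)
    (fun x y => (h1.sc_slice₂ hb _ x y).sub (h1.sc_slice₂ hb _ x y))
    (fun x y => (h2.sc_slice₃ ha hb _ x y).sub (h2.sc_slice₃ ha hb _ x y))
    (fun u => h.norm_sc_diff₁_le₂₃ ha hb hx hh u) (fun u => ?_) (fun u => ?_) R).trans
    (le_of_eq ?_)
  · rw [← mul_sub]
    exact norm_inv_mul_le hb (b1.norm_sc_diff₁_le₂₃ ha hb hx hh u)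
  · rw [← mul_sub]
    exact norm_inv_mul_le hab (b2.norm_sc_diff₁_le₂₃ ha hb hx hh u)
  · unfold side
    field_simp
    ring

/-! ### Integrability and vanishing means -/

lemma integrable_w_mul_sq {lam : ℝ} (hl : 0 < lam) : Integrable fun t => w (lam * t) ^ 2 := by
  have := (integrable_w_sq hl 0).1
  simpa [w_neg] using this

lemma integrable_w2 {l₂ l₃ : ℝ} (h₂ : 0 < l₂) (h₃ : 0 < l₃) : Integrable (w2 l₂ l₃) :=
  (integrable_w_mul_sq h₂).mul_prod (integrable_w_mul_sq h₃)

lemma IsBump.integrable_sc (h : IsBump d c ψ) (ha : 0 < a) (hb : 0 < b) :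
    Integrable (sc a b ψ) := by
  have h1 : Integrable fun x : R3 => w (a * x.1) ^ 2 * w2 b (a * b) x.2 :=
    (integrable_w_mul_sq ha).mul_prod (integrable_w2 hb (by positivity))
  refine (h1.const_mul (c * (a ^ 2 * b ^ 2))).mono'
    (continuous_sc h.base.1).aestronglyMeasurable (Eventually.of_forall fun x => ?_)
  refine (h.norm_sc_le₂₃ x.1 x.2).trans ?_
  have hc := h.nonneg
  have := w2_nonneg b (a * b) x.2
  calc c * (a ^ 2 * b ^ 2 * w (a * x.1) ^ 3) * w2 b (a * b) x.2
      = c * (a ^ 2 * b ^ 2) * (w (a * x.1) ^ 3 * w2 b (a * b) x.2) := by ring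
    _ ≤ _ := mul_le_mul_of_nonneg_left (mul_le_mul_of_nonneg_right
        (w_pow_le_pow (by norm_num) _) this) (by positivity)

lemma IsBump.integrable_sc_slice₁ (h : IsBump d c ψ) (ha : 0 < a) (z : ℝ × ℝ) :
    Integrable fun t => sc a b ψ (t, z) := by
  have := continuous_sc (a := a) (b := b) h.base.1
  exact ((integrable_w_mul_sq ha).const_mul _).mono' (by fun_prop)
    (Eventually.of_forall fun t => h.norm_sc_le₁ z t)

lemma IsBump.integrable_sc_slice₂₃ (h : IsBump d c ψ) (ha : 0 < a) (hb : 0 < b) (t : ℝ) :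
    Integrable fun u : ℝ × ℝ => sc a b ψ (t, u) := by
  have := continuous_sc (a := a) (b := b) h.base.1
  exact ((integrable_w2 hb (by positivity : 0 < a * b)).const_mul _).mono' (by fun_prop)
    (Eventually.of_forall fun u => h.norm_sc_le₂₃ t u)

lemma IsBump.integral_sc_slice₁ (h : IsBump (d + 1) c ψ) (ha : 0 < a) (z : ℝ × ℝ) :
    ∫ t, sc a b ψ (t, z) = 0 := by
  obtain ⟨-, -, ⟨Θ, h1, h2⟩, -⟩ := id h
  exact integral_eq_zero_of_hasDerivAt_of_integrable (fun t => h1.sc_slice₁ ha z t)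
    (h.integrable_sc_slice₁ ha z) ((h2.integrable_sc_slice₁ ha z).const_mul _)

lemma integrable_of_le_w2_left {f : ℝ × ℝ → ℂ} {κ l₂ l₃ : ℝ} (h₂ : 0 < l₂) (hf : Continuous f)
    (hb : ∀ u, ‖f u‖ ≤ κ * w2 l₂ l₃ u) (t : ℝ) : Integrable fun s => f (s, t) := by
  refine ((integrable_w_mul_sq h₂).const_mul (κ * w (l₃ * t) ^ 2)).mono' (by fun_prop)
    (Eventually.of_forall fun s => (hb _).trans (le_of_eq ?_))
  unfold w2; ring

lemma integrable_of_le_w2_right {f : ℝ × ℝ → ℂ} {κ l₂ l₃ : ℝ} (h₃ : 0 < l₃) (hf : Continuous f)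
    (hb : ∀ u, ‖f u‖ ≤ κ * w2 l₂ l₃ u) (s : ℝ) : Integrable fun t => f (s, t) := by
  refine ((integrable_w_mul_sq h₃).const_mul (κ * w (l₂ * s) ^ 2)).mono' (by fun_prop)
    (Eventually.of_forall fun t => (hb _).trans (le_of_eq ?_))
  unfold w2; ring

lemma IsBump.integral_sc_slice₂₃ (h : IsBump (d + 1) c ψ) (ha : 0 < a) (hb : 0 < b) (t : ℝ) :
    ∫ u : ℝ × ℝ, sc a b ψ (t, u) = 0 := by
  obtain ⟨-, -, -, Θ₂, Θ₃, ψ₂, ψ₃, h1, h2, h3, b1, b2, b3, b4⟩ := id h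
  have hab : 0 < a * b := by positivity
  have cc : ∀ {d : ℕ} {Θ : R3 → ℂ}, IsBump d c Θ → Continuous fun u : ℝ × ℝ => sc a b Θ (t, u) :=
    fun hΘ => by
      have := continuous_sc (a := a) (b := b) hΘ.base.1
      fun_prop
  have i2 := b3.integrable_sc_slice₂₃ ha hb t
  have i3 := b4.integrable_sc_slice₂₃ ha hb t
  have e : ∀ u : ℝ × ℝ, sc a b ψ (t, u) = sc a b ψ₂ (t, u) + sc a b ψ₃ (t, u) := fun u => by
    unfold sc; rw [h3, mul_add]
  have z2 : ∫ u : ℝ × ℝ, sc a b ψ₂ (t, u) = 0 := by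
    rw [show (volume : Measure (ℝ × ℝ)) = volume.prod volume from rfl, integral_prod_symm _ i2]
    refine integral_eq_zero_of_ae (Eventually.of_forall fun y => ?_)
    exact integral_eq_zero_of_hasDerivAt_of_integrable (fun s => h1.sc_slice₂ hb t s y)
      (integrable_of_le_w2_left hb (cc b3) (fun u => b3.norm_sc_le₂₃ t u) y)
      ((integrable_of_le_w2_left hb (cc b1) (fun u => b1.norm_sc_le₂₃ t u) y).const_mul _)
  have z3 : ∫ u : ℝ × ℝ, sc a b ψ₃ (t, u) = 0 := by
    rw [show (volume : Measure (ℝ × ℝ)) = volume.prod volume from rfl, integral_prod _ i3]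
    refine integral_eq_zero_of_ae (Eventually.of_forall fun x => ?_)
    exact integral_eq_zero_of_hasDerivAt_of_integrable (fun y => h2.sc_slice₃ ha hb t x y)
      (integrable_of_le_w2_right hab (cc b4) (fun u => b4.norm_sc_le₂₃ t u) x)
      ((integrable_of_le_w2_right hab (cc b2) (fun u => b2.norm_sc_le₂₃ t u) x).const_mul _)
  simp only [e]
  rw [integral_add i2 i3, z2, z3, add_zero]

end

/-! ### Weak boundedness of the rescaled bump functions -/

/-- The pairing of the indicator of `I × R` with its convolution with `k`. -/
def kAB (k : R3 → ℂ) (I : Intv) (R : Rect) : ℂ :=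
  ∫ x in (I.set ×ˢ I.set) ×ˢ (R.set ×ˢ R.set), k (x.1.1 - x.1.2, x.2.1 - x.2.2)

lemma isBounded_squares (I : Intv) (R : Rect) :
    Bornology.IsBounded ((I.set ×ˢ I.set) ×ˢ (R.set ×ˢ R.set)) :=
  (I.isBounded.prod I.isBounded).prod (R.isBounded.prod R.isBounded)

lemma integrableOn_kAB {k : R3 → ℂ} (hk : Continuous k) (I : Intv) (R : Rect) :
    IntegrableOn (fun x : (ℝ × ℝ) × ((ℝ × ℝ) × (ℝ × ℝ)) => k (x.1.1 - x.1.2, x.2.1 - x.2.2))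
      ((I.set ×ˢ I.set) ×ˢ (R.set ×ˢ R.set)) :=
  integrableOn_of_isBounded (by fun_prop) (isBounded_squares I R)

lemma kAB_eq_kB {k : R3 → ℂ} (hk : Continuous k) (I : Intv) (R : Rect) :
    kAB k I R = ∫ p in I.set ×ˢ I.set, kB k R (p.1 - p.2) := by
  have := integrableOn_kAB hk I R
  unfold kAB kB
  exact setIntegral_prod _ this

lemma kAB_eq_kA {k : R3 → ℂ} (hk : Continuous k) (I : Intv) (R : Rect) :
    kAB k I R = ∫ q in R.set ×ˢ R.set, kA k I (q.1 - q.2) := by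
  have h : Integrable (fun x : (ℝ × ℝ) × ((ℝ × ℝ) × (ℝ × ℝ)) => k (x.1.1 - x.1.2, x.2.1 - x.2.2))
      ((volume.restrict (I.set ×ˢ I.set)).prod (volume.restrict (R.set ×ˢ R.set))) := by
    rw [Measure.prod_restrict]
    exact integrableOn_kAB hk I R
  unfold kAB kA
  rw [show (volume : Measure ((ℝ × ℝ) × ((ℝ × ℝ) × (ℝ × ℝ)))) = volume.prod volume from rfl,
    ← Measure.prod_restrict]
  exact integral_prod_symm _ h

lemma setIntegral_w2_square_le {l₂ l₃ : ℝ} (h₂ : 0 < l₂) (h₃ : 0 < l₃) (R : Rect) :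
    ∫ q in R.set ×ˢ R.set, w2 l₂ l₃ (q.1 - q.2) ≤ R.area * (16 / (l₂ * l₃)) := by
  have hc := continuous_w2 l₂ l₃
  have hint : IntegrableOn (fun p : (ℝ × ℝ) × (ℝ × ℝ) => w2 l₂ l₃ (p.1 - p.2)) (R.set ×ˢ R.set)
      (volume.prod volume) :=
    integrableOn_of_isBounded (by fun_prop) (R.isBounded.prod R.isBounded)
  rw [show (volume : Measure ((ℝ × ℝ) × (ℝ × ℝ))) = volume.prod volume from rfl,
    setIntegral_prod _ hint]
  have hpi := Real.pi_pos
  have hpi4 := Real.pi_lt_four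
  have hx : ∀ x ∈ R.set, ‖∫ y in R.set, w2 l₂ l₃ (x - y)‖ ≤ 16 / (l₂ * l₃) := by
    intro x _
    rw [Real.norm_of_nonneg (integral_nonneg fun _ => w2_nonneg _ _ _), setIntegral_w2]
    calc _ ≤ (Real.pi / l₂) * (Real.pi / l₃) := mul_le_mul (setIntegral_w_sq_le h₂ _ _)
          (setIntegral_w_sq_le h₃ _ _) (integral_w_sq_nonneg _ _ _) (by positivity)
      _ = Real.pi ^ 2 / (l₂ * l₃) := by field_simp
      _ ≤ 16 / (l₂ * l₃) := div_le_div_of_nonneg_right (by nlinarith) (by positivity)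
  have h := norm_setIntegral_le_of_norm_le_const (μ := (volume : Measure (ℝ × ℝ)))
    R.isBounded.measure_lt_top hx
  have hv : volume.real R.set = R.area := by
    rw [show (volume : Measure (ℝ × ℝ)) = volume.prod volume from rfl, Rect.set,
      measureReal_prod_prod, R.1.volume_real, R.2.volume_real, Rect.area]
  rw [hv, mul_comm] at h
  exact (le_abs_self _).trans h

lemma setIntegral_w_square_le {lam : ℝ} (hl : 0 < lam) (I : Intv) :
    ∫ p in I.set ×ˢ I.set, w (lam * (p.1 - p.2)) ^ 2 ≤ I.len * (4 / lam) := by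
  have hc := continuous_w
  have hint : IntegrableOn (fun p : ℝ × ℝ => w (lam * (p.1 - p.2)) ^ 2) (I.set ×ˢ I.set)
      (volume.prod volume) :=
    integrableOn_of_isBounded (by fun_prop) (I.isBounded.prod I.isBounded)
  rw [show (volume : Measure (ℝ × ℝ)) = volume.prod volume from rfl, setIntegral_prod _ hint]
  have hx : ∀ x ∈ I.set, ‖∫ y in I.set, w (lam * (x - y)) ^ 2‖ ≤ 4 / lam := by
    intro x _
    rw [Real.norm_of_nonneg (integral_w_sq_nonneg _ _ _)]
    exact (setIntegral_w_sq_le hl _ _).trans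
      (div_le_div_of_nonneg_right Real.pi_lt_four.le hl.le)
  have h := norm_setIntegral_le_of_norm_le_const (μ := (volume : Measure ℝ)) I.volume_lt_top hx
  rw [I.volume_real, mul_comm] at h
  exact (le_abs_self _).trans h

lemma Rect.area_pos (R : Rect) : 0 < R.area := mul_pos R.1.len_pos R.2.len_pos

/-- The bound for the pairing is the geometric mean of those obtained from the averages over the
interval and over the rectangle, so that it is summable in both scales. -/
lemma IsBump.norm_kAB_sc_le {d : ℕ} {c a b : ℝ} {ψ : R3 → ℂ} (h : IsBump (d + 1) c ψ) (ha : 0 < a)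
    (hb : 0 < b) (I : Intv) (R : Rect) :
    ‖kAB (sc a b ψ) I R‖ ≤ 256 * c * (I.len * R.area) *
      (Real.sqrt (min (a * I.len) (a * I.len)⁻¹) *
        Real.sqrt (min (side a b R) (side a b R)⁻¹)) := by
  have hc := h.nonneg
  have hI := I.len_pos
  have hR := R.area_pos
  have hm := side_pos ha hb R
  have hab : 0 < a * b := by positivity
  have cs : Continuous (sc a b ψ) := continuous_sc h.base.1
  have hw := continuous_w
  set K := 256 * c * (I.len * R.area) with hK
  have hK0 : 0 ≤ K := by positivity
  set α := min (a * I.len) (a * I.len)⁻¹ with hα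
  set β := min (side a b R) (side a b R)⁻¹ with hβ
  have hα0 : 0 ≤ α := by positivity
  have hβ0 : 0 ≤ β := by positivity
  have hA : ‖kAB (sc a b ψ) I R‖ ≤ K * α := by
    rw [kAB_eq_kA cs]
    have hi : Integrable (fun q : (ℝ × ℝ) × (ℝ × ℝ) =>
        8 * c * (b ^ 2 * min 1 ((a * I.len) ^ 2)) * w2 b (a * b) (q.1 - q.2))
        (volume.restrict (R.set ×ˢ R.set)) := by
      have := continuous_w2 b (a * b)
      exact integrableOn_of_isBounded (by fun_prop) (R.isBounded.prod R.isBounded)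
    refine (norm_integral_le_of_norm_le hi (Eventually.of_forall fun q => ?_)).trans ?_
    · refine (h.norm_kA_sc_le ha I _).trans ?_
      set u := q.1 - q.2
      have p₂ := w_pos (b * u.1)
      have p₃ := w_pos (a * b * u.2)
      calc _ = 8 * c * (b ^ 2 * min 1 ((a * I.len) ^ 2)) *
            (w (b * u.1) ^ 3 * w (a * b * u.2) ^ 3) := by ring
        _ ≤ _ := mul_le_mul_of_nonneg_left (mul_le_mul (w_pow_le_pow (by norm_num) _)
            (w_pow_le_pow (by norm_num) _) (by positivity) (by positivity)) (by positivity)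
    · rw [integral_const_mul]
      have e : min 1 ((a * I.len) ^ 2) = a * I.len * α := by
        rw [hα, mul_min_of_nonneg _ _ (by positivity), mul_inv_cancel₀ (by positivity), min_comm, sq]
      rw [e]
      calc _ ≤ 8 * c * (b ^ 2 * (a * I.len * α)) * (R.area * (16 / (b * (a * b)))) :=
            mul_le_mul_of_nonneg_left (setIntegral_w2_square_le hb hab R) (by positivity)
        _ = 128 * c * (I.len * R.area) * α := by field_simp; ring
        _ ≤ K * α := by
          refine mul_le_mul_of_nonneg_right ?_ hα0
          rw [hK]
          exact mul_le_mul_of_nonneg_right (by linarith) (by positivity)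
  have hB : ‖kAB (sc a b ψ) I R‖ ≤ K * β := by
    rw [kAB_eq_kB cs]
    have hi : Integrable (fun p : ℝ × ℝ => 64 * c * R.area * (a * β) * w (a * (p.1 - p.2)) ^ 2)
        (volume.restrict (I.set ×ˢ I.set)) :=
      integrableOn_of_isBounded (by fun_prop) (I.isBounded.prod I.isBounded)
    refine (norm_integral_le_of_norm_le hi (Eventually.of_forall fun p => ?_)).trans ?_
    · refine (h.norm_kB_sc_le ha hb R _).trans ?_
      calc _ = 64 * c * R.area * (a * β) * w (a * (p.1 - p.2)) ^ 3 := by ring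
        _ ≤ _ := mul_le_mul_of_nonneg_left (w_pow_le_pow (by norm_num) _) (by positivity)
    · rw [integral_const_mul]
      calc _ ≤ 64 * c * R.area * (a * β) * (I.len * (4 / a)) :=
            mul_le_mul_of_nonneg_left (setIntegral_w_square_le ha I) (by positivity)
        _ = K * β := by rw [hK]; field_simp; ring
  -- the geometric mean of the two bounds
  have h1 : ‖kAB (sc a b ψ) I R‖ ≤ Real.sqrt ((K * α) * (K * β)) := by
    refine Real.le_sqrt_of_sq_le ?_
    rw [sq]
    exact mul_le_mul hA hB (norm_nonneg _) (by positivity)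
  refine h1.trans (le_of_eq ?_)
  rw [show K * α * (K * β) = K ^ 2 * (α * β) by ring, Real.sqrt_mul (by positivity),
    Real.sqrt_sq hK0, Real.sqrt_mul hα0]

/-! ### Convolution kernels adapted to Zygmund dilations -/

/-- The properties of a translation invariant kernel `k(x - y)` from which the conditions on a
`(log, 1, 1)`-CZZ operator are derived. -/
structure ZygKernel (C : ℝ) (k : R3 → ℂ) : Prop where
  cont : Continuous k
  int : Integrable k
  bdd : ∃ M, ∀ x, ‖k x‖ ≤ M
  mean₁ : ∀ z, ∫ t, k (t, z) = 0
  mean₂₃ : ∀ t, ∫ u : ℝ × ℝ, k (t, u) = 0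
  size : ∀ z₁ z₂ z₃, z₁ ≠ 0 → z₂ ≠ 0 → z₃ ≠ 0 →
    ‖k (z₁, z₂, z₃)‖ ≤ C * (Dlog z₁ z₂ z₃ / (|z₁| * |z₂| * |z₃|))
  diff₁ : ∀ z₁ z₂ z₃ h₁, z₁ ≠ 0 → z₂ ≠ 0 → z₃ ≠ 0 → |h₁| ≤ |z₁| / 2 →
    ‖k (z₁ + h₁, z₂, z₃) - k (z₁, z₂, z₃)‖ ≤
      C * (|h₁| / |z₁| * (Dlog z₁ z₂ z₃ / (|z₁| * |z₂| * |z₃|)))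
  diff₂₃ : ∀ z₁ z₂ z₃ h₂ h₃, z₁ ≠ 0 → z₂ ≠ 0 → z₃ ≠ 0 → |h₂| ≤ |z₂| / 2 → |h₃| ≤ |z₃| / 2 →
    ‖k (z₁, z₂ + h₂, z₃ + h₃) - k (z₁, z₂, z₃)‖ ≤
      C * (incr z₂ z₃ h₂ h₃ * (Dlog z₁ z₂ z₃ / (|z₁| * |z₂| * |z₃|)))
  diff₁₂₃ : ∀ z₁ z₂ z₃ h₁ h₂ h₃, z₁ ≠ 0 → z₂ ≠ 0 → z₃ ≠ 0 → |h₁| ≤ |z₁| / 2 →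
    |h₂| ≤ |z₂| / 2 → |h₃| ≤ |z₃| / 2 →
    ‖k (z₁ + h₁, z₂ + h₂, z₃ + h₃) - k (z₁ + h₁, z₂, z₃) - k (z₁, z₂ + h₂, z₃ + h₃) +
      k (z₁, z₂, z₃)‖ ≤
      C * (|h₁| / |z₁| * incr z₂ z₃ h₂ h₃ * (Dlog z₁ z₂ z₃ / (|z₁| * |z₂| * |z₃|)))
  sizeA : ∀ (I : Intv) z₂ z₃, z₂ ≠ 0 → z₃ ≠ 0 →
    ‖kA k I (z₂, z₃)‖ ≤ C * (I.len / (|z₂| * |z₃|) * Dlog I.len z₂ z₃)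
  diffA : ∀ (I : Intv) z₂ z₃ h₂ h₃, z₂ ≠ 0 → z₃ ≠ 0 → |h₂| ≤ |z₂| / 2 → |h₃| ≤ |z₃| / 2 →
    ‖kA k I (z₂ + h₂, z₃ + h₃) - kA k I (z₂, z₃)‖ ≤
      C * (incr z₂ z₃ h₂ h₃ * (I.len / (|z₂| * |z₃|) * Dlog I.len z₂ z₃))
  sizeB : ∀ (R : Rect) t, t ≠ 0 → ‖kB k R t‖ ≤ C * R.area / |t|
  diffB : ∀ (R : Rect) t h, t ≠ 0 → |h| ≤ |t| / 2 →
    ‖kB k R (t + h) - kB k R t‖ ≤ C * R.area * (|h| / |t| ^ 2)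
  wbp : ∀ (I : Intv) (R : Rect), ‖kAB k I R‖ ≤ C * (I.len * R.area)

/-- A finite sum of rescaled bump functions. -/
def ksum (S T : Finset ℤ) (ψ : ℤ → ℤ → R3 → ℂ) (x : R3) : ℂ :=
  ∑ j ∈ S, ∑ k ∈ T, sc ((2 : ℝ) ^ j) ((2 : ℝ) ^ k) (ψ j k) x

lemma norm_sum_sum_le {S T : Finset ℤ} {F : ℤ → ℤ → ℂ} {G : ℤ → ℤ → ℝ} {κ B : ℝ} (hκ : 0 ≤ κ)
    (h : ∀ j k, ‖F j k‖ ≤ κ * G j k) (hG : ∑ j ∈ S, ∑ k ∈ T, G j k ≤ B) :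
    ‖∑ j ∈ S, ∑ k ∈ T, F j k‖ ≤ κ * B := by
  calc ‖∑ j ∈ S, ∑ k ∈ T, F j k‖ ≤ ∑ j ∈ S, ∑ k ∈ T, κ * G j k :=
        norm_sum_le_of_le _ fun j _ => norm_sum_le_of_le _ fun k _ => h j k
    _ = κ * ∑ j ∈ S, ∑ k ∈ T, G j k := by simp only [Finset.mul_sum]
    _ ≤ κ * B := mul_le_mul_of_nonneg_left hG hκ

lemma integral_sum_sum {X : Type*} [MeasurableSpace X] {μ : Measure X} (S T : Finset ℤ)
    {F : ℤ → ℤ → X → ℂ} (h : ∀ j k, Integrable (F j k) μ) :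
    ∫ x, ∑ j ∈ S, ∑ k ∈ T, F j k x ∂μ = ∑ j ∈ S, ∑ k ∈ T, ∫ x, F j k x ∂μ := by
  rw [integral_finsetSum _ fun j _ => integrable_finsetSum _ fun k _ => h j k]
  exact Finset.sum_congr rfl fun j _ => integral_finsetSum _ fun k _ => h j k

lemma sum_sum_sub (S T : Finset ℤ) (F G : ℤ → ℤ → ℂ) :
    (∑ j ∈ S, ∑ k ∈ T, F j k) - ∑ j ∈ S, ∑ k ∈ T, G j k =
      ∑ j ∈ S, ∑ k ∈ T, (F j k - G j k) := by
  simp only [Finset.sum_sub_distrib]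

lemma sum_sum_add (S T : Finset ℤ) (F G : ℤ → ℤ → ℂ) :
    (∑ j ∈ S, ∑ k ∈ T, F j k) + ∑ j ∈ S, ∑ k ∈ T, G j k =
      ∑ j ∈ S, ∑ k ∈ T, (F j k + G j k) := by
  simp only [Finset.sum_add_distrib]

lemma two_zpow_pos (j : ℤ) : (0 : ℝ) < 2 ^ j := zpow_pos (by norm_num) j

lemma IsBump.continuous_sc {d : ℕ} {c : ℝ} {ψ : R3 → ℂ} (h : IsBump d c ψ) (a b : ℝ) :
    Continuous (sc a b ψ) := Zyg.continuous_sc h.base.1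

section
variable {c : ℝ} {ψ : ℤ → ℤ → R3 → ℂ} (S T : Finset ℤ)

lemma kA_ksum (hψ : ∀ j k, IsBump 2 c (ψ j k)) (I : Intv) (z : ℝ × ℝ) :
    kA (ksum S T ψ) I z =
      ∑ j ∈ S, ∑ k ∈ T, kA (sc ((2 : ℝ) ^ j) ((2 : ℝ) ^ k) (ψ j k)) I z :=
  integral_sum_sum (μ := volume.restrict (I.set ×ˢ I.set)) S T fun j k => by
    have := (hψ j k).continuous_sc (2 ^ j) (2 ^ k)
    exact integrableOn_of_isBounded (by fun_prop) (I.isBounded.prod I.isBounded)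

lemma kB_ksum (hψ : ∀ j k, IsBump 2 c (ψ j k)) (R : Rect) (t : ℝ) :
    kB (ksum S T ψ) R t =
      ∑ j ∈ S, ∑ k ∈ T, kB (sc ((2 : ℝ) ^ j) ((2 : ℝ) ^ k) (ψ j k)) R t :=
  integral_sum_sum (μ := volume.restrict (R.set ×ˢ R.set)) S T fun j k => by
    have := (hψ j k).continuous_sc (2 ^ j) (2 ^ k)
    exact integrableOn_of_isBounded (by fun_prop) (R.isBounded.prod R.isBounded)

lemma kAB_ksum (hψ : ∀ j k, IsBump 2 c (ψ j k)) (I : Intv) (R : Rect) :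
    kAB (ksum S T ψ) I R =
      ∑ j ∈ S, ∑ k ∈ T, kAB (sc ((2 : ℝ) ^ j) ((2 : ℝ) ^ k) (ψ j k)) I R :=
  integral_sum_sum (μ := volume.restrict ((I.set ×ˢ I.set) ×ˢ (R.set ×ˢ R.set))) S T
    fun j k => integrableOn_kAB ((hψ j k).continuous_sc _ _) I R

end

/-- Finite sums of rescaled bump functions are kernels adapted to Zygmund dilations, with uniform
constants. -/
lemma exists_zygKernel_ksum : ∃ C, 0 ≤ C ∧ ∀ (c : ℝ) (ψ : ℤ → ℤ → R3 → ℂ) (S T : Finset ℤ),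
    (∀ j k, IsBump 2 c (ψ j k)) → ZygKernel (C * c) (ksum S T ψ) := by
  obtain ⟨C₁, hC₁, hfull⟩ := exists_sum_full_le
  obtain ⟨C₂, hC₂, hpart⟩ := exists_sum_partial_le
  obtain ⟨C₃, hC₃, hCZ⟩ := exists_sum_CZ_le
  obtain ⟨C₄, hC₄, hwbp⟩ := exists_sum_wbp_le
  refine ⟨4096 * (C₁ + C₂ + C₃ + C₄), by positivity, fun c ψ S T hψ => ?_⟩
  have hc : 0 ≤ c := (hψ 0 0).nonneg
  have cs : ∀ j k, Continuous (sc ((2 : ℝ) ^ j) ((2 : ℝ) ^ k) (ψ j k)) := fun j k =>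
    (hψ j k).continuous_sc _ _
  set C := 4096 * (C₁ + C₂ + C₃ + C₄) with hC
  -- every estimate has the form `κ · c · Cᵢ · (nonnegative quantity)` with `κ ≤ 4096`
  have fin : ∀ {κ Ci X Y : ℝ}, 0 ≤ Y → κ * Ci ≤ C → X ≤ κ * c * (Ci * Y) → X ≤ C * c * Y := by
    intro κ Ci X Y hY hκ hX
    refine hX.trans ?_
    calc κ * c * (Ci * Y) = (κ * Ci) * (c * Y) := by ring
      _ ≤ C * (c * Y) := mul_le_mul_of_nonneg_right hκ (by positivity)
      _ = _ := by ring
  have hS : ∀ z₁ z₂ z₃ : ℝ, z₁ ≠ 0 → z₂ ≠ 0 → z₃ ≠ 0 →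
      0 ≤ Dlog z₁ z₂ z₃ / (|z₁| * |z₂| * |z₃|) := by
    intro z₁ z₂ z₃ h₁ h₂ h₃
    have p₁ := abs_pos.2 h₁
    have p₂ := abs_pos.2 h₂
    have p₃ := abs_pos.2 h₃
    have hR : 0 < |z₃| / (|z₁| * |z₂|) := by positivity
    refine div_nonneg ?_ (by positivity)
    rw [Dlog_eq]
    unfold dlogRatio
    set R := |z₃| / (|z₁| * |z₂|)
    refine mul_nonneg (by positivity) (Real.log_nonneg ?_)
    rcases le_total 1 R with h | h
    · linarith [inv_pos.2 hR]
    · linarith [one_le_inv_iff₀.2 ⟨hR, h⟩]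
  have hSA : ∀ ℓ z₂ z₃ : ℝ, 0 < ℓ → z₂ ≠ 0 → z₃ ≠ 0 →
      0 ≤ ℓ / (|z₂| * |z₃|) * Dlog ℓ z₂ z₃ := by
    intro ℓ z₂ z₃ hℓ h₂ h₃
    have h := hS ℓ z₂ z₃ hℓ.ne' h₂ h₃
    have p₂ := abs_pos.2 h₂
    have p₃ := abs_pos.2 h₃
    have : Dlog ℓ z₂ z₃ = Dlog ℓ z₂ z₃ / (|ℓ| * |z₂| * |z₃|) * (|ℓ| * |z₂| * |z₃|) := by
      rw [div_mul_cancel₀]; positivity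
    rw [this]
    positivity
  refine
    { cont := ?_
      int := ?_
      bdd := ?_
      mean₁ := fun z => ?_
      mean₂₃ := fun t => ?_
      size := fun z₁ z₂ z₃ h₁ h₂ h₃ => ?_
      diff₁ := fun z₁ z₂ z₃ h₁ n₁ n₂ n₃ e₁ => ?_
      diff₂₃ := fun z₁ z₂ z₃ h₂ h₃ n₁ n₂ n₃ e₂ e₃ => ?_
      diff₁₂₃ := fun z₁ z₂ z₃ h₁ h₂ h₃ n₁ n₂ n₃ e₁ e₂ e₃ => ?_
      sizeA := fun I z₂ z₃ n₂ n₃ => ?_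
      diffA := fun I z₂ z₃ h₂ h₃ n₂ n₃ e₂ e₃ => ?_
      sizeB := fun R t n => ?_
      diffB := fun R t h n e => ?_
      wbp := fun I R => ?_ }
  · exact continuous_finsetSum _ fun j _ => continuous_finsetSum _ fun k _ => cs j k
  · exact integrable_finsetSum _ fun j _ => integrable_finsetSum _ fun k _ =>
      (hψ j k).integrable_sc (two_zpow_pos j) (two_zpow_pos k)
  · refine ⟨∑ j ∈ S, ∑ k ∈ T, c * (((2 : ℝ) ^ j) ^ 2 * ((2 : ℝ) ^ k) ^ 2), fun x => ?_⟩
    refine norm_sum_le_of_le _ fun j _ => norm_sum_le_of_le _ fun k _ => ?_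
    refine ((hψ j k).norm_sc_le x.1 x.2.1 x.2.2).trans (mul_le_mul_of_nonneg_left ?_ hc)
    refine mul_le_of_le_one_right (by positivity) ?_
    have q : ∀ t, w t ^ 3 ≤ 1 := fun t => pow_le_one₀ (w_pos t).le (w_le_one t)
    have p : ∀ t, 0 ≤ w t ^ 3 := fun t => pow_nonneg (w_pos t).le 3
    exact mul_le_one₀ (mul_le_one₀ (q _) (p _) (q _)) (p _) (q _)
  · unfold ksum
    rw [integral_sum_sum S T fun j k => (hψ j k).integrable_sc_slice₁ (two_zpow_pos j) z]
    exact Finset.sum_eq_zero fun j _ => Finset.sum_eq_zero fun k _ =>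
      (hψ j k).integral_sc_slice₁ (two_zpow_pos j) z
  · unfold ksum
    rw [integral_sum_sum S T fun j k =>
      (hψ j k).integrable_sc_slice₂₃ (two_zpow_pos j) (two_zpow_pos k) t]
    exact Finset.sum_eq_zero fun j _ => Finset.sum_eq_zero fun k _ =>
      (hψ j k).integral_sc_slice₂₃ (two_zpow_pos j) (two_zpow_pos k) t
  · refine fin (κ := 1) (Ci := C₁) (hS _ _ _ h₁ h₂ h₃) (by linarith) ?_
    refine norm_sum_sum_le (by positivity) (fun j k => ?_) (hfull S T z₁ z₂ z₃ h₁ h₂ h₃)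
    rw [one_mul]
    exact (hψ j k).norm_sc_le z₁ z₂ z₃
  · have hs := hS _ _ _ n₁ n₂ n₃
    refine fin (κ := 16) (Ci := C₁) (by positivity) (by linarith) ?_
    unfold ksum
    rw [sum_sum_sub]
    refine (norm_sum_sum_le (κ := 16 * c * (|h₁| / |z₁|)) (by positivity) (fun j k => ?_)
      (hfull S T z₁ z₂ z₃ n₁ n₂ n₃)).trans (le_of_eq (by ring))
    refine ((hψ j k).norm_sc_diff₁_le (two_zpow_pos j) (two_zpow_pos k) z₂ z₃ n₁ e₁).trans ?_
    refine mul_le_mul_of_nonneg_left (mul_le_mul_of_nonneg_left ?_ (by positivity)) (by positivity)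
    have p : ∀ t n, 0 ≤ w t ^ n := fun t n => pow_nonneg (w_pos t).le n
    exact mul_le_mul (mul_le_mul_of_nonneg_left (w_pow_le_pow (by norm_num) _) (p _ _))
      (w_pow_le_pow (by norm_num) _) (p _ _) (mul_nonneg (p _ _) (p _ _))
  · have hs := hS _ _ _ n₁ n₂ n₃
    have hi := incr_nonneg z₂ z₃ h₂ h₃
    refine fin (κ := 256) (Ci := C₁) (by positivity) (by linarith) ?_
    unfold ksum
    rw [sum_sum_sub]
    refine (norm_sum_sum_le (κ := 256 * c * incr z₂ z₃ h₂ h₃) (by positivity) (fun j k => ?_)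
      (hfull S T z₁ z₂ z₃ n₁ n₂ n₃)).trans (le_of_eq (by ring))
    refine ((hψ j k).norm_sc_diff₂₃_le (two_zpow_pos j) (two_zpow_pos k) z₁ n₂ n₃ e₂ e₃).trans ?_
    refine mul_le_mul_of_nonneg_left (mul_le_mul_of_nonneg_left ?_ (by positivity)) (by positivity)
    have p : ∀ t n, 0 ≤ w t ^ n := fun t n => pow_nonneg (w_pos t).le n
    exact mul_le_mul_of_nonneg_right (mul_le_mul_of_nonneg_right (w_pow_le_pow (by norm_num) _)
      (p _ _)) (p _ _)
  · have hs := hS _ _ _ n₁ n₂ n₃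
    have hi := incr_nonneg z₂ z₃ h₂ h₃
    refine fin (κ := 4096) (Ci := C₁) (by positivity) (by linarith) ?_
    unfold ksum
    rw [sum_sum_sub, sum_sum_sub, sum_sum_add]
    refine (norm_sum_sum_le (κ := 4096 * c * (|h₁| / |z₁| * incr z₂ z₃ h₂ h₃)) (by positivity)
      (fun j k => ?_) (hfull S T z₁ z₂ z₃ n₁ n₂ n₃)).trans (le_of_eq (by ring))
    exact (hψ j k).norm_sc_diff₁₂₃_le (two_zpow_pos j) (two_zpow_pos k) n₁ n₂ n₃ e₁ e₂ e₃
  · refine fin (κ := 8) (Ci := C₂) (hSA _ _ _ I.len_pos n₂ n₃) (by linarith) ?_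
    rw [kA_ksum S T hψ]
    exact norm_sum_sum_le (by positivity)
      (fun j k => (hψ j k).norm_kA_sc_le (two_zpow_pos j) I (z₂, z₃))
      (hpart S T I.len z₂ z₃ I.len_pos n₂ n₃)
  · have hs := hSA _ _ _ I.len_pos n₂ n₃
    have hi := incr_nonneg z₂ z₃ h₂ h₃
    refine fin (κ := 2048) (Ci := C₂) (by positivity) (by linarith) ?_
    rw [kA_ksum S T hψ, kA_ksum S T hψ, sum_sum_sub]
    exact (norm_sum_sum_le (κ := 2048 * c * incr z₂ z₃ h₂ h₃) (by positivity)
      (fun j k => (hψ j k).norm_kA_sc_diff_le (two_zpow_pos j) (two_zpow_pos k) I n₂ n₃ e₂ e₃)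
      (hpart S T I.len z₂ z₃ I.len_pos n₂ n₃)).trans (le_of_eq (by ring))
  · have hR := R.area_pos
    rw [mul_div_assoc]
    refine fin (κ := 64) (Ci := C₃) (by positivity) (by linarith) ?_
    rw [kB_ksum S T hψ]
    refine (norm_sum_sum_le (κ := 64 * c * R.area) (by positivity) (fun j k => ?_)
      (hCZ S T t R.1.len R.2.len n R.1.len_pos R.2.len_pos)).trans (le_of_eq (by ring))
    rw [relSide_eq]
    exact (hψ j k).norm_kB_sc_le (two_zpow_pos j) (two_zpow_pos k) R t
  · have hR := R.area_pos
    rw [mul_assoc]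
    refine fin (κ := 1024) (Ci := C₃) (by positivity) (by linarith) ?_
    rw [kB_ksum S T hψ, kB_ksum S T hψ, sum_sum_sub]
    refine (norm_sum_sum_le (κ := 1024 * c * (|h| / |t|) * R.area) (by positivity) (fun j k => ?_)
      (hCZ S T t R.1.len R.2.len n R.1.len_pos R.2.len_pos)).trans (le_of_eq ?_)
    · rw [relSide_eq]
      exact (hψ j k).norm_kB_sc_diff_le (two_zpow_pos j) (two_zpow_pos k) R n e
    · field_simp
  · have hR := R.area_pos
    have hI := I.len_pos
    refine fin (κ := 256) (Ci := C₄) (by positivity) (by linarith) ?_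
    rw [kAB_ksum S T hψ]
    refine (norm_sum_sum_le (κ := 256 * c * (I.len * R.area)) (by positivity) (fun j k => ?_)
      (hwbp S T I.len R.1.len R.2.len hI R.1.len_pos R.2.len_pos)).trans (le_of_eq (by ring))
    rw [relSide_eq]
    exact (hψ j k).norm_kAB_sc_le (two_zpow_pos j) (two_zpow_pos k) I R

/-! ### Rearranging products of measures -/

section
variable {A B C D : Type*} [MeasureSpace A] [MeasureSpace B] [MeasureSpace C] [MeasureSpace D]

/-- The exchange `((a, b), (c, d)) ↦ ((a, c), (b, d))` of the two middle variables. -/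
def middleSwap (A B C D : Type*) [MeasurableSpace A] [MeasurableSpace B] [MeasurableSpace C]
    [MeasurableSpace D] : (A × B) × (C × D) ≃ᵐ (A × C) × (B × D) where
  toFun p := ((p.1.1, p.2.1), (p.1.2, p.2.2))
  invFun p := ((p.1.1, p.2.1), (p.1.2, p.2.2))
  left_inv _ := rfl
  right_inv _ := rfl
  measurable_toFun := by
    show Measurable fun p : (A × B) × (C × D) => ((p.1.1, p.2.1), (p.1.2, p.2.2))
    fun_prop
  measurable_invFun := by
    show Measurable fun p : (A × C) × (B × D) => ((p.1.1, p.2.1), (p.1.2, p.2.2))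
    fun_prop

lemma measurePreserving_middleSwap [SFinite (volume : Measure A)] [SFinite (volume : Measure B)]
    [SFinite (volume : Measure C)] [SFinite (volume : Measure D)] :
    MeasurePreserving (middleSwap A B C D) := by
  have a1 : MeasurePreserving (MeasurableEquiv.prodAssoc : (A × B) × (C × D) ≃ᵐ A × B × (C × D))
      volume volume := volume_preserving_prodAssoc
  have b1 : MeasurePreserving (MeasurableEquiv.prodAssoc.symm : B × C × D ≃ᵐ (B × C) × D)
      volume volume := volume_preserving_prodAssoc.symm
  have b2 : MeasurePreserving (Prod.map (Prod.swap : B × C → C × B) (id : D → D))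
      volume volume := Measure.measurePreserving_swap.prod (MeasurePreserving.id _)
  have b3 : MeasurePreserving (MeasurableEquiv.prodAssoc : (C × B) × D ≃ᵐ C × B × D)
      volume volume := volume_preserving_prodAssoc
  have a2 : MeasurePreserving (Prod.map (id : A → A)
      (MeasurableEquiv.prodAssoc ∘ Prod.map (Prod.swap : B × C → C × B) (id : D → D) ∘
        (MeasurableEquiv.prodAssoc.symm : B × C × D ≃ᵐ (B × C) × D))) volume volume :=
    (MeasurePreserving.id _).prod (b3.comp (b2.comp b1))
  have a3 : MeasurePreserving (MeasurableEquiv.prodAssoc.symm : A × C × (B × D) ≃ᵐ (A × C) × (B × D))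
      volume volume := volume_preserving_prodAssoc.symm
  exact a3.comp (a2.comp a1)

lemma integrable_middleSwap_iff [SFinite (volume : Measure A)] [SFinite (volume : Measure B)]
    [SFinite (volume : Measure C)] [SFinite (volume : Measure D)] (F : (A × C) × (B × D) → ℂ) :
    Integrable (fun p : (A × B) × (C × D) => F ((p.1.1, p.2.1), (p.1.2, p.2.2))) ↔ Integrable F :=
  measurePreserving_middleSwap.integrable_comp_emb (middleSwap A B C D).measurableEmbedding

lemma integral_middleSwap [SFinite (volume : Measure A)] [SFinite (volume : Measure B)]
    [SFinite (volume : Measure C)] [SFinite (volume : Measure D)] (F : (A × C) × (B × D) → ℂ) :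
    ∫ p : (A × B) × (C × D), F ((p.1.1, p.2.1), (p.1.2, p.2.2)) = ∫ q, F q :=
  measurePreserving_middleSwap.integral_comp (middleSwap A B C D).measurableEmbedding F

end

/-! ### The cancellation identities -/

section
variable {A B : Type*} [NormedAddCommGroup A] [MeasureSpace A] [BorelSpace A]
  [SecondCountableTopology A] [NormedAddCommGroup B] [MeasureSpace B] [BorelSpace B]
  [SecondCountableTopology B] [SFinite (volume : Measure A)] [SFinite (volume : Measure B)]
  [(volume : Measure (A × B)).IsAddLeftInvariant] [(volume : Measure (A × B)).IsNegInvariant]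
  [(volume : Measure B).IsAddLeftInvariant] [(volume : Measure B).IsNegInvariant]

/-- The integrand `e(a) e'(a') h(b) κ(a - a', σ(b) - b') χ(b')`. -/
def pairInt (κ : A × B → ℂ) (e e' : A → ℂ) (h : B → ℂ) (σ : B → B) (χ : B → ℂ)
    (p : (A × A) × (B × B)) : ℂ :=
  e p.1.1 * e' p.1.2 * (h p.2.1 * (κ (p.1.1 - p.1.2, σ p.2.1 - p.2.2) * χ p.2.2))

variable {κ : A × B → ℂ} {e e' : A → ℂ} {h : B → ℂ} {σ : B → B} {χ : B → ℂ} {M : ℝ}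

lemma integrable_pairInt (hκ : Continuous κ) (hκi : Integrable κ) (he : Integrable e)
    (hem : Measurable e) (hem' : Measurable e') (heb : ∀ a, ‖e' a‖ ≤ M) (hh : Integrable h)
    (hhm : Measurable h) (hσ : Measurable σ) (hχ : Measurable χ) (hχb : ∀ b, ‖χ b‖ ≤ M) :
    Integrable (pairInt κ e e' h σ χ) := by
  rw [← integrable_middleSwap_iff]
  have hu : Integrable fun x : A × B => e x.1 * h x.2 := he.mul_prod hh
  have hmeas : Measurable fun p : (A × B) × (A × B) =>
      (e p.1.1 * h p.1.2) * κ ((p.1.1, σ p.1.2) - p.2) := by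
    have := hκ.measurable
    fun_prop
  have hmain : Integrable (fun p : (A × B) × (A × B) =>
      (e p.1.1 * h p.1.2) * κ ((p.1.1, σ p.1.2) - p.2)) := by
    refine (integrable_prod_iff hmeas.aestronglyMeasurable).2 ⟨Eventually.of_forall fun x => ?_, ?_⟩
    · exact (hκi.comp_sub_left (x.1, σ x.2)).const_mul (e x.1 * h x.2)
    · simp only [norm_mul, integral_const_mul]
      have : ∀ x : A × B, ∫ y, ‖κ ((x.1, σ x.2) - y)‖ = ∫ y, ‖κ y‖ := fun x =>
        integral_sub_left_eq_self (fun y => ‖κ y‖) volume (x.1, σ x.2)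
      simp only [this]
      simpa using hu.norm.mul_const (∫ y, ‖κ y‖)
  have hb : Integrable (fun p : (A × B) × (A × B) => (e' p.2.1 * χ p.2.2) *
      ((e p.1.1 * h p.1.2) * κ ((p.1.1, σ p.1.2) - p.2))) := by
    refine hmain.bdd_mul (c := M * M) ?_ (Eventually.of_forall fun p => ?_)
    · exact (by fun_prop : Measurable fun p : (A × B) × (A × B) =>
        e' p.2.1 * χ p.2.2).aestronglyMeasurable
    · rw [norm_mul]
      exact mul_le_mul (heb _) (hχb _) (norm_nonneg _) ((norm_nonneg _).trans (heb 0))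
  refine hb.congr (Eventually.of_forall fun p => ?_)
  simp only [pairInt]
  rw [show (p.1.1, σ p.1.2) - p.2 = (p.1.1 - p.2.1, σ p.1.2 - p.2.2) from rfl]
  ring

/-- Integrating out the first pair of variables. -/
lemma integral_pairInt_section (b b' : B) : ∫ q : A × A, pairInt κ e e' h σ χ (q, (b, b')) =
    h b * ((∫ q : A × A, e q.1 * e' q.2 * κ (q.1 - q.2, σ b - b')) * χ b') := by
  rw [← integral_mul_const, ← integral_const_mul]
  refine integral_congr_ae (Eventually.of_forall fun q => ?_)
  simp only [pairInt]
  ring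

lemma integrable_pairInt_part (hi : Integrable (pairInt κ e e' h σ χ)) :
    Integrable fun p : B × B =>
      h p.1 * ((∫ q : A × A, e q.1 * e' q.2 * κ (q.1 - q.2, σ p.1 - p.2)) * χ p.2) := by
  have := Integrable.integral_prod_right hi
  simpa only [integral_pairInt_section] using! this

lemma integral_pairInt_part (hi : Integrable (pairInt κ e e' h σ χ)) :
    ∫ p : B × B, h p.1 * ((∫ q : A × A, e q.1 * e' q.2 * κ (q.1 - q.2, σ p.1 - p.2)) * χ p.2) =
      ∫ p, pairInt κ e e' h σ χ p := by
  have := integral_prod_symm (pairInt κ e e' h σ χ) hi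
  rw [show (volume : Measure ((A × A) × (B × B))) = volume.prod volume from rfl, this]
  refine integral_congr_ae (Eventually.of_forall fun p => ?_)
  exact (integral_pairInt_section p.1 p.2).symm

/-- The integral vanishes if `κ` has vanishing means in the second variable. -/
lemma integral_pairInt_of_mean (hi : Integrable (pairInt κ e e' h σ fun _ => 1))
    (hm : ∀ a, ∫ b, κ (a, b) = 0) : ∫ p, pairInt κ e e' h σ (fun _ => 1) p = 0 := by
  rw [show (volume : Measure ((A × A) × (B × B))) = volume.prod volume from rfl,
    integral_prod _ hi]
  refine integral_eq_zero_of_ae ?_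
  filter_upwards [Integrable.prod_right_ae hi] with q hq
  rw [show (volume : Measure (B × B)) = volume.prod volume from rfl, integral_prod _ hq]
  refine integral_eq_zero_of_ae (Eventually.of_forall fun b => ?_)
  simp only [pairInt, mul_one]
  rw [integral_const_mul, integral_const_mul,
    integral_sub_left_eq_self (fun y => κ (q.1 - q.2, y)) volume (σ b), hm]
  simp

/-- The integral vanishes if `h` is orthogonal to the kernel. -/
lemma integral_pairInt_of_orthogonal (hi : Integrable (pairInt κ e e' h σ χ))
    (hm : ∀ a b', ∫ b, h b * κ (a, σ b - b') = 0) : ∫ p, pairInt κ e e' h σ χ p = 0 := by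
  rw [show (volume : Measure ((A × A) × (B × B))) = volume.prod volume from rfl,
    integral_prod _ hi]
  refine integral_eq_zero_of_ae ?_
  filter_upwards [Integrable.prod_right_ae hi] with q hq
  rw [show (volume : Measure (B × B)) = volume.prod volume from rfl, integral_prod_symm _ hq]
  refine integral_eq_zero_of_ae (Eventually.of_forall fun b' => ?_)
  simp only [pairInt, ← mul_assoc]
  rw [integral_mul_const]
  simp only [mul_assoc]
  rw [integral_const_mul, integral_const_mul, hm]
  simp

/-- The indicator function of a set. -/
def ind {X : Type*} (E : Set X) (x : X) : ℂ := E.indicator (fun _ => 1) x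

lemma measurable_ind {X : Type*} [MeasurableSpace X] {E : Set X} (hE : MeasurableSet E) :
    Measurable (ind E) := measurable_const.indicator hE

lemma norm_ind_le {X : Type*} (E : Set X) (x : X) : ‖ind E x‖ ≤ 1 := by
  unfold ind Set.indicator; split_ifs <;> simp

lemma integrable_ind {X : Type*} [MeasurableSpace X] {μ : Measure X} {E : Set X}
    (hE : MeasurableSet E) (hf : μ E < ⊤) : Integrable (ind E) μ :=
  (integrable_indicator_iff hE).2 (integrableOn_const hf.ne)

/-- The part of `1_I ⊗ 1_J` off the square of `I ∩ J`. The identity holds also if `I ∩ J` is empty. -/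
lemma off_eq {X : Type} (I J : Set X) (x y : X) :
    off I J x y = ind J x * ind I y - ind (I ∩ J) x * ind (I ∩ J) y := by
  classical
  unfold off ind
  simp only [Set.indicator_apply, Set.mem_sdiff, Set.mem_prod, mem_inter_iff]
  by_cases h1 : x ∈ J <;> by_cases h2 : y ∈ I <;> by_cases h3 : x ∈ I <;> by_cases h4 : y ∈ J <;>
    simp [h1, h2, h3, h4]

lemma setIntegral_square_eq {E : Set A} (hE : MeasurableSet E) (F : A × A → ℂ) :
    ∫ q in E ×ˢ E, F q = ∫ q : A × A, ind E q.1 * ind E q.2 * F q := by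
  classical
  rw [← integral_indicator (hE.prod hE)]
  refine integral_congr_ae (Eventually.of_forall fun q => ?_)
  unfold ind
  simp only [Set.indicator_apply, mem_prod]
  by_cases h1 : q.1 ∈ E <;> by_cases h2 : q.2 ∈ E <;> simp [h1, h2]

/-- The integrand `h(b) (κ(α, b - b') (1 - τ(b')) - κ(α, σ(b) - b') χ(b'))` of the far part of the
pairing with the constant function. -/
def farInt (κ : B → ℂ) (h : B → ℂ) (σ : B → B) (τ χ : B → ℂ) (b b' : B) : ℂ :=
  h b * (κ (b - b') * (1 - τ b') - κ (σ b - b') * χ b')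

/-- The cancellation identity: splitting the constant function into `τ` and `1 - τ`, subtracting
the kernel at `σ(b)` where `χ = 1`, and treating the square of `S' ∩ S` separately. -/
lemma cancellation {S S' : Set A} {τ : B → ℂ} (hκ : Continuous κ) (hκi : Integrable κ)
    (hmean : ∀ a, ∫ b, κ (a, b) = 0) (hS : MeasurableSet S) (hS' : MeasurableSet S')
    (hSf : volume S < ⊤) (hh : Integrable h) (hhm : Measurable h) (hσ : Measurable σ)
    (hτ : Measurable τ) (hτb : ∀ b, ‖τ b‖ ≤ 1) (hχ : Measurable χ) (hχb : ∀ b, ‖χ b‖ ≤ 1)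
    (horth : ∀ a b', ∫ b, h b * κ (a, σ b - b') = 0) :
    Integrable (fun p : (A × A) × (B × B) =>
      (ind S p.1.1 * ind S' p.1.2 - ind (S' ∩ S) p.1.1 * ind (S' ∩ S) p.1.2) *
        farInt (fun v => κ (p.1.1 - p.1.2, v)) h σ τ χ p.2.1 p.2.2) ∧
    Integrable (fun p : B × B => farInt
      (fun v => ∫ q in (S' ∩ S) ×ˢ (S' ∩ S), κ (q.1 - q.2, v)) h σ τ χ p.1 p.2) ∧
    (∫ p, pairInt κ (ind S) (ind S') h id τ p) +
      (∫ p : (A × A) × (B × B),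
        (ind S p.1.1 * ind S' p.1.2 - ind (S' ∩ S) p.1.1 * ind (S' ∩ S) p.1.2) *
          farInt (fun v => κ (p.1.1 - p.1.2, v)) h σ τ χ p.2.1 p.2.2) +
      ∫ p : B × B, farInt
        (fun v => ∫ q in (S' ∩ S) ×ˢ (S' ∩ S), κ (q.1 - q.2, v)) h σ τ χ p.1 p.2 = 0 := by
  set E := S' ∩ S with hEdef
  have hE : MeasurableSet E := hS'.inter hS
  have hEf : volume E < ⊤ := (measure_mono inter_subset_right).trans_lt hSf
  have b2 : ∀ (F : Set A) a, ‖ind F a‖ ≤ 2 := fun F a => (norm_ind_le F a).trans (by norm_num)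
  have t2 : ∀ b, ‖1 - τ b‖ ≤ 2 := fun b => (norm_sub_le _ _).trans (by
    rw [norm_one]; linarith [hτb b])
  have iS : ∀ {σ : B → B} {χ : B → ℂ}, Measurable σ → Measurable χ → (∀ b, ‖χ b‖ ≤ 2) →
      Integrable (pairInt κ (ind S) (ind S') h σ χ) := fun h1 h2 h3 =>
    integrable_pairInt hκ hκi (integrable_ind hS hSf) (measurable_ind hS) (measurable_ind hS')
      (b2 S') hh hhm h1 h2 h3
  have iE : ∀ {σ : B → B} {χ : B → ℂ}, Measurable σ → Measurable χ → (∀ b, ‖χ b‖ ≤ 2) →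
      Integrable (pairInt κ (ind E) (ind E) h σ χ) := fun h1 h2 h3 =>
    integrable_pairInt hκ hκi (integrable_ind hE hEf) (measurable_ind hE) (measurable_ind hE)
      (b2 E) hh hhm h1 h2 h3
  have χ2 : ∀ b, ‖χ b‖ ≤ 2 := fun b => (hχb b).trans (by norm_num)
  have τ2 : ∀ b, ‖τ b‖ ≤ 2 := fun b => (hτb b).trans (by norm_num)
  have o2 : ∀ b : B, ‖(1 : ℂ)‖ ≤ 2 := fun b => by norm_num
  have mτ : Measurable fun b => 1 - τ b := measurable_const.sub hτ
  have i1 := iS measurable_id mτ t2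
  have i2 := iS hσ hχ χ2
  have i3 := iE measurable_id mτ t2
  have i4 := iE hσ hχ χ2
  have i5 := iS measurable_id hτ τ2
  have i6 := iS measurable_id (measurable_const (a := (1 : ℂ))) o2
  have efull : (fun p : (A × A) × (B × B) =>
      (ind S p.1.1 * ind S' p.1.2 - ind E p.1.1 * ind E p.1.2) *
        farInt (fun v => κ (p.1.1 - p.1.2, v)) h σ τ χ p.2.1 p.2.2) = fun p =>
      (pairInt κ (ind S) (ind S') h id (fun b => 1 - τ b) p - pairInt κ (ind S) (ind S') h σ χ p) -
      (pairInt κ (ind E) (ind E) h id (fun b => 1 - τ b) p - pairInt κ (ind E) (ind E) h σ χ p) := by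
    funext p
    simp only [farInt, pairInt, id]
    ring
  have epart : (fun p : B × B => farInt (fun v => ∫ q in E ×ˢ E, κ (q.1 - q.2, v)) h σ τ χ p.1 p.2)
      = fun p => h p.1 * ((∫ q : A × A, ind E q.1 * ind E q.2 * κ (q.1 - q.2, id p.1 - p.2)) *
          (1 - τ p.2)) -
        h p.1 * ((∫ q : A × A, ind E q.1 * ind E q.2 * κ (q.1 - q.2, σ p.1 - p.2)) * χ p.2) := by
    funext p
    simp only [farInt, setIntegral_square_eq hE, id]
    ring
  have j3 := integrable_pairInt_part i3
  have j4 := integrable_pairInt_part i4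
  rw [efull, epart]
  refine ⟨(i1.sub i2).sub (i3.sub i4), j3.sub j4, ?_⟩
  rw [integral_sub j3 j4, integral_pairInt_part i3, integral_pairInt_part i4]
  have e2 := integral_sub (i1.sub i2) (i3.sub i4)
  simp only [Pi.sub_apply] at e2
  rw [integral_sub i1 i2, integral_sub i3 i4, integral_pairInt_of_orthogonal i2 horth] at e2
  rw [e2]
  -- `τ` and `1 - τ` together give the pairing with `1`, which vanishes by the mean zero of `κ`
  have e1 : (∫ p, pairInt κ (ind S) (ind S') h id τ p) +
      ∫ p, pairInt κ (ind S) (ind S') h id (fun b => 1 - τ b) p = 0 := by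
    rw [← integral_add i5 i1, ← integral_pairInt_of_mean i6 hmean]
    refine integral_congr_ae (Eventually.of_forall fun p => ?_)
    simp only [pairInt]
    ring
  linear_combination e1

end

/-! ### Indicators and Haar functions of intervals and rectangles -/

lemma Intv.ind_eq (I : Intv) : I.ind = Zyg.ind I.set := rfl

lemma ind_prod {X Y : Type*} (E : Set X) (F : Set Y) (x : X × Y) :
    ind (E ×ˢ F) x = ind E x.1 * ind F x.2 := by
  classical
  simp only [ind, Set.indicator_apply, Set.mem_prod]
  by_cases h1 : x.1 ∈ E <;> by_cases h2 : x.2 ∈ F <;> simp [h1, h2]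

lemma Rect.ind_eq (Q : Rect) : Q.ind = Zyg.ind Q.set := by
  funext u
  exact (ind_prod Q.1.set Q.2.set u).symm

lemma Intv.coind_eq (I : Intv) (t : ℝ) : I.coind t = 1 - I.ind t := by
  classical
  simp only [Intv.coind, Intv.ind, Set.indicator_apply, Set.mem_compl_iff]
  by_cases h : t ∈ I.set <;> simp [h]

lemma Intv.measurable_ind (I : Intv) : Measurable I.ind := Zyg.measurable_ind I.measurableSet

lemma Intv.integrable_ind (I : Intv) : Integrable I.ind :=
  Zyg.integrable_ind I.measurableSet I.volume_lt_top

lemma Intv.integral_ind (I : Intv) : ∫ t, I.ind t = (I.len : ℂ) := by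
  unfold Intv.ind
  rw [integral_indicator I.measurableSet, setIntegral_const, I.volume_real]
  simp

lemma Intv.measurable_coind (I : Intv) : Measurable I.coind :=
  measurable_const.indicator I.measurableSet.compl

lemma Intv.norm_coind_le (I : Intv) (t : ℝ) : ‖I.coind t‖ ≤ 1 := norm_ind_le _ t

lemma Rect.measurable_ind (Q : Rect) : Measurable Q.ind := by
  rw [Q.ind_eq]
  exact Zyg.measurable_ind Q.measurableSet

lemma Rect.integrable_ind (Q : Rect) : Integrable Q.ind := by
  rw [Q.ind_eq]
  exact Zyg.integrable_ind Q.measurableSet Q.isBounded.measure_lt_top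

lemma Intv.measurable_haar (I : Intv) (η : Bool) : Measurable (I.haar η) := by
  have h1 := I.left.measurable_ind
  have h2 := I.right.measurable_ind
  have h3 := I.measurable_ind
  unfold Intv.haar
  cases η
  · exact h3.const_mul _
  · exact (h1.sub h2).const_mul _

lemma Intv.integrable_haar (I : Intv) (η : Bool) : Integrable (I.haar η) := by
  unfold Intv.haar
  cases η
  · exact I.integrable_ind.const_mul _
  · exact (I.left.integrable_ind.sub I.right.integrable_ind).const_mul _

lemma Intv.integral_haar (I : Intv) : ∫ t, I.haar true t = 0 := by
  simp only [Intv.haar, if_true]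
  rw [integral_const_mul, integral_sub I.left.integrable_ind I.right.integrable_ind,
    I.left.integral_ind, I.right.integral_ind]
  have : I.left.len = I.right.len := by
    simp only [Intv.len, Intv.left, Intv.right, Intv.center]; ring
  rw [this, sub_self, mul_zero]

lemma Rect.measurable_haar (Q : Rect) (η₂ η₃ : Bool) : Measurable (Q.haar η₂ η₃) :=
  ((Q.1.measurable_haar η₂).comp measurable_fst).mul ((Q.2.measurable_haar η₃).comp measurable_snd)

lemma Rect.integrable_haar (Q : Rect) (η₂ η₃ : Bool) : Integrable (Q.haar η₂ η₃) :=
  (Q.1.integrable_haar η₂).mul_prod (Q.2.integrable_haar η₃)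

lemma Intv.set_of_inter_eq_some {I J R : Intv} (h : I.inter J = some R) :
    R.set = I.set ∩ J.set := by
  unfold Intv.inter at h
  split_ifs at h with hlt
  obtain rfl := Option.some.inj h
  exact Ico_inter_Ico.symm

lemma Intv.inter_set_of_inter_eq_none {I J : Intv} (h : I.inter J = none) :
    I.set ∩ J.set = ∅ := by
  unfold Intv.inter at h
  split_ifs at h with hlt
  rw [Intv.set, Intv.set, Ico_inter_Ico]
  exact Ico_eq_empty hlt

lemma Rect.set_of_inter_eq_some {P Q R : Rect} (h : P.inter Q = some R) :
    R.set = P.set ∩ Q.set := by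
  unfold Rect.inter at h
  obtain ⟨A, hA, h⟩ := Option.bind_eq_some_iff.1 h
  obtain ⟨B, hB, rfl⟩ := Option.map_eq_some_iff.1 h
  simp only [Rect.set]
  rw [Intv.set_of_inter_eq_some hA, Intv.set_of_inter_eq_some hB, prod_inter_prod]

lemma Rect.inter_set_of_inter_eq_none {P Q : Rect} (h : P.inter Q = none) :
    P.set ∩ Q.set = ∅ := by
  simp only [Rect.set, prod_inter_prod]
  unfold Rect.inter at h
  rcases hA : P.1.inter Q.1 with _ | A
  · rw [Intv.inter_set_of_inter_eq_none hA, empty_prod]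
  · rcases hB : P.2.inter Q.2 with _ | B
    · rw [Intv.inter_set_of_inter_eq_none hB, prod_empty]
    · simp [hA, hB] at h

/-! ### The convolution operator and its kernel representations -/

section
variable {k : R3 → ℂ}

lemma convOp_apply (k f : R3 → ℂ) (x : R3) : convOp k f x = ∫ y, k (x - y) * f y :=
  convolution_eq_swap (ContinuousLinearMap.mul ℂ ℂ)

lemma integrable_conv_integrand (hk : Continuous k) {M : ℝ} (hM : ∀ x, ‖k x‖ ≤ M) {f : R3 → ℂ}
    (hf : Integrable f) (x : R3) : Integrable fun y => k (x - y) * f y :=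
  hf.bdd_mul (c := M) (by fun_prop : Continuous fun y => k (x - y)).aestronglyMeasurable
    (Eventually.of_forall fun y => hM _)

lemma integrable_tens {f : ℝ → ℂ} {g : ℝ × ℝ → ℂ} (hf : Integrable f) (hg : Integrable g) :
    Integrable (tens f g) := hf.mul_prod hg

lemma integrable_box (I : Intv) (P : Rect) : Integrable (box I P) :=
  integrable_tens I.integrable_ind P.integrable_ind

lemma integrable_of_mem_stepFun {f : R3 → ℂ} (hf : f ∈ stepFun) : Integrable f := by
  unfold stepFun at hf
  induction hf using Submodule.span_induction with
  | mem f hf => obtain ⟨I, Q, rfl⟩ := hf; exact integrable_box I Q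
  | zero => exact integrable_zero _ _ _
  | add f g _ _ hf hg => exact hf.add hg
  | smul c f _ hf => exact hf.smul c

lemma convOp_add (hk : Continuous k) {M : ℝ} (hM : ∀ x, ‖k x‖ ≤ M) {f g : R3 → ℂ}
    (hf : Integrable f) (hg : Integrable g) : convOp k (f + g) = convOp k f + convOp k g := by
  funext x
  simp only [Pi.add_apply, convOp_apply, mul_add]
  exact integral_add (integrable_conv_integrand hk hM hf x) (integrable_conv_integrand hk hM hg x)

lemma convOp_smul (c : ℂ) (f : R3 → ℂ) : convOp k (c • f) = c • convOp k f := by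
  funext x
  simp only [Pi.smul_apply, convOp_apply, smul_eq_mul]
  rw [← integral_const_mul]
  exact integral_congr_ae (Eventually.of_forall fun y => by ring)

lemma integrable_pairing (hk : Continuous k) {M : ℝ} (hM : ∀ x, ‖k x‖ ≤ M) {f g : R3 → ℂ}
    (hf : Integrable f) (hg : Integrable g) :
    Integrable fun p : R3 × R3 => k (p.1 - p.2) * (g p.1 * f p.2) :=
  (hg.mul_prod hf).bdd_mul (c := M)
    (by fun_prop : Continuous fun p : R3 × R3 => k (p.1 - p.2)).aestronglyMeasurable
    (Eventually.of_forall fun p => hM _)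

lemma pairing_convOp (hk : Continuous k) {M : ℝ} (hM : ∀ x, ‖k x‖ ≤ M) {f g : R3 → ℂ}
    (hf : Integrable f) (hg : Integrable g) :
    pairing (convOp k) f g = ∫ p : R3 × R3, k (p.1 - p.2) * (g p.1 * f p.2) := by
  rw [show (volume : Measure (R3 × R3)) = volume.prod volume from rfl,
    integral_prod _ (integrable_pairing hk hM hf hg)]
  unfold pairing
  refine integral_congr_ae (Eventually.of_forall fun x => ?_)
  simp only [convOp_apply]
  rw [← integral_mul_const]
  exact integral_congr_ae (Eventually.of_forall fun y => by ring)

/-- The transposed operator is the convolution with the reflected kernel. -/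
lemma pairing_convOp_transpose (hk : Continuous k) {M : ℝ} (hM : ∀ x, ‖k x‖ ≤ M) {f g : R3 → ℂ}
    (hf : Integrable f) (hg : Integrable g) :
    pairing (convOp k) g f = ∫ p : R3 × R3, k (-(p.1 - p.2)) * (g p.1 * f p.2) := by
  rw [pairing_convOp hk hM hg hf, show (volume : Measure (R3 × R3)) = volume.prod volume from rfl,
    ← integral_prod_swap]
  refine integral_congr_ae (Eventually.of_forall fun p => ?_)
  simp only [Prod.fst_swap, Prod.snd_swap, neg_sub]
  ring

lemma integrable_convOp (hki : Integrable k) {f : R3 → ℂ} (hf : Integrable f) : Integrable (convOp k f) :=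
  hki.integrable_convolution (ContinuousLinearMap.mul ℂ ℂ) hf

lemma pairing_box (hk : Continuous k) {M : ℝ} (hM : ∀ x, ‖k x‖ ≤ M) (I J : Intv) (P Q : Rect) :
    pairing (convOp k) (box I P) (box J Q) =
      ∫ p in (J.set ×ˢ Q.set) ×ˢ (I.set ×ˢ P.set), k (p.1 - p.2) := by
  rw [pairing_convOp hk hM (integrable_box I P) (integrable_box J Q),
    ← integral_indicator ((J.measurableSet.prod Q.measurableSet).prod
      (I.measurableSet.prod P.measurableSet))]
  refine integral_congr_ae (Eventually.of_forall fun p => ?_)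
  have h : ∀ (I : Intv) (P : Rect) (x : R3), box I P x = ind (I.set ×ˢ P.set) x := by
    intro I P x
    rw [ind_prod]
    simp only [box, tens, Rect.ind_eq, Intv.ind_eq]
  simp only [h]
  rw [← ind_prod]
  unfold ind
  by_cases hp : p ∈ (J.set ×ˢ Q.set) ×ˢ (I.set ×ˢ P.set)
  · rw [indicator_of_mem hp, indicator_of_mem hp, mul_one]
  · rw [indicator_of_notMem hp, indicator_of_notMem hp, mul_zero]

/-- The pairing of the indicators of two rectangles, with the variables grouped by factors. -/
lemma pairing_box' (hk : Continuous k) {M : ℝ} (hM : ∀ x, ‖k x‖ ≤ M) (I J : Intv) (P Q : Rect) :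
    pairing (convOp k) (box I P) (box J Q) =
      ∫ q in (J.set ×ˢ I.set) ×ˢ (Q.set ×ˢ P.set), k (q.1.1 - q.1.2, q.2.1 - q.2.2) := by
  rw [pairing_box hk hM]
  exact (measurePreserving_middleSwap (A := ℝ) (B := ℝ) (C := ℝ × ℝ) (D := ℝ × ℝ)).symm
    |>.setIntegral_preimage_emb (middleSwap _ _ _ _).symm.measurableEmbedding
      (fun q => k (q.1.1 - q.1.2, q.2.1 - q.2.2)) ((J.set ×ˢ I.set) ×ˢ (Q.set ×ˢ P.set)) ▸ by
    congr 2
    ext p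
    simp only [middleSwap, mem_prod, mem_preimage]
    tauto

lemma integrable_rect (hk : Continuous k) (I J : Intv) (P Q : Rect) :
    Integrable (fun q : (ℝ × ℝ) × ((ℝ × ℝ) × (ℝ × ℝ)) => k (q.1.1 - q.1.2, q.2.1 - q.2.2))
      ((volume.restrict (J.set ×ˢ I.set)).prod (volume.restrict (Q.set ×ˢ P.set))) := by
  rw [Measure.prod_restrict]
  exact integrableOn_of_isBounded (by fun_prop)
    ((J.isBounded.prod I.isBounded).prod (Q.isBounded.prod P.isBounded))

lemma convOp_full_rep (hk : Continuous k) {M : ℝ} (hM : ∀ x, ‖k x‖ ≤ M) (I J : Intv) (P Q : Rect) :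
    IntegrableOn (fun p : R3 × R3 => k (p.1 - p.2)) ((J.set ×ˢ Q.set) ×ˢ (I.set ×ˢ P.set)) ∧
    pairing (convOp k) (box I P) (box J Q) =
      ∫ x in J.set ×ˢ Q.set, ∫ y in I.set ×ˢ P.set, k (x - y) := by
  have hi : IntegrableOn (fun p : R3 × R3 => k (p.1 - p.2))
      ((J.set ×ˢ Q.set) ×ˢ (I.set ×ˢ P.set)) (volume.prod volume) :=
    integrableOn_of_isBounded (by fun_prop)
      ((J.isBounded.prod Q.isBounded).prod (I.isBounded.prod P.isBounded))
  exact ⟨hi, (pairing_box hk hM I J P Q).trans (setIntegral_prod _ hi)⟩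

lemma convOp_part₁_rep (hk : Continuous k) {M : ℝ} (hM : ∀ x, ‖k x‖ ≤ M) (I : Intv) (P Q : Rect) :
    IntegrableOn (fun p : (ℝ × ℝ) × (ℝ × ℝ) => kA k I (p.1 - p.2)) (Q.set ×ˢ P.set) ∧
    pairing (convOp k) (box I P) (box I Q) = ∫ x in Q.set, ∫ y in P.set, kA k I (x - y) := by
  have h := integrable_rect hk I I P Q
  have hi : IntegrableOn (fun p : (ℝ × ℝ) × (ℝ × ℝ) => kA k I (p.1 - p.2)) (Q.set ×ˢ P.set)
    (volume.prod volume) := h.integral_prod_right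
  refine ⟨hi, ?_⟩
  rw [pairing_box' hk hM, ← setIntegral_prod _ hi,
    show (volume : Measure ((ℝ × ℝ) × ((ℝ × ℝ) × (ℝ × ℝ)))) = volume.prod volume from rfl,
    ← Measure.prod_restrict]
  exact integral_prod_symm _ h

lemma convOp_part₂₃_rep (hk : Continuous k) {M : ℝ} (hM : ∀ x, ‖k x‖ ≤ M) (I J : Intv) (P : Rect) :
    IntegrableOn (fun p : ℝ × ℝ => kB k P (p.1 - p.2)) (J.set ×ˢ I.set) ∧
    pairing (convOp k) (box I P) (box J P) = ∫ x in J.set, ∫ y in I.set, kB k P (x - y) := by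
  have h := integrable_rect hk I J P P
  have hi : IntegrableOn (fun p : ℝ × ℝ => kB k P (p.1 - p.2)) (J.set ×ˢ I.set)
    (volume.prod volume) := h.integral_prod_left
  refine ⟨hi, ?_⟩
  rw [pairing_box' hk hM, ← setIntegral_prod _ hi,
    show (volume : Measure ((ℝ × ℝ) × ((ℝ × ℝ) × (ℝ × ℝ)))) = volume.prod volume from rfl,
    ← Measure.prod_restrict]
  exact integral_prod _ h

end

/-! ### The kernel estimates -/

lemma Dlog_mul {s₁ s : ℝ} (h₁ : |s₁| = 1) (h : |s| = 1) (a b c : ℝ) :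
    Dlog (s₁ * a) (s * b) (s * c) = Dlog a b c := by
  simp only [Dlog_eq, abs_mul, h₁, h, one_mul]

section
variable {k : R3 → ℂ} {C : ℝ}

/-- The signs `s₁`, `s` cover the kernel and its three (partial) adjoints. -/
lemma ZygKernel.fullEstimates (hk : ZygKernel C k) {s₁ s : ℝ} (h₁ : |s₁| = 1) (h : |s| = 1) :
    FullEstimates C Dlog 1 1
      fun x y => k (s₁ * (x.1 - y.1), s * (x.2.1 - y.2.1), s * (x.2.2 - y.2.2)) := by
  intro x₁ x₂ x₃ y₁ y₂ y₃ n₁ n₂ n₃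
  have hs₁ : s₁ ≠ 0 := by rintro rfl; simp at h₁
  have hs : s ≠ 0 := by rintro rfl; simp at h
  have m₁ := mul_ne_zero hs₁ (sub_ne_zero.2 n₁)
  have m₂ := mul_ne_zero hs (sub_ne_zero.2 n₂)
  have m₃ := mul_ne_zero hs (sub_ne_zero.2 n₃)
  have e : ∀ s x x' y : ℝ, s * (x' - y) = s * (x - y) + s * (x' - x) := fun s x x' y => by ring
  refine ⟨by simpa only [Dlog_mul h₁ h, abs_mul, h₁, h, one_mul] using hk.size _ _ _ m₁ m₂ m₃,
    fun x₁' x₂' x₃' i₁ i₂ i₃ => ⟨?_, ?_, ?_⟩⟩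
  · have := hk.diff₁ _ _ _ (s₁ * (x₁' - x₁)) m₁ m₂ m₃ (by simpa only [abs_mul, h₁, one_mul] using i₁)
    simp only [Real.rpow_one]
    rw [e s₁ x₁ x₁' y₁]
    simpa only [Dlog_mul h₁ h, abs_mul, h₁, h, one_mul] using this
  · have := hk.diff₂₃ _ _ _ (s * (x₂' - x₂)) (s * (x₃' - x₃)) m₁ m₂ m₃
      (by simpa only [abs_mul, h, one_mul] using i₂) (by simpa only [abs_mul, h, one_mul] using i₃)
    simp only [Real.rpow_one]
    rw [e s x₂ x₂' y₂, e s x₃ x₃' y₃]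
    simpa only [incr, Dlog_mul h₁ h, abs_mul, h₁, h, one_mul] using this
  · have := hk.diff₁₂₃ _ _ _ (s₁ * (x₁' - x₁)) (s * (x₂' - x₂)) (s * (x₃' - x₃)) m₁ m₂ m₃
      (by simpa only [abs_mul, h₁, one_mul] using i₁)
      (by simpa only [abs_mul, h, one_mul] using i₂) (by simpa only [abs_mul, h, one_mul] using i₃)
    simp only [Real.rpow_one]
    rw [e s₁ x₁ x₁' y₁, e s x₂ x₂' y₂, e s x₃ x₃' y₃]
    simpa only [incr, Dlog_mul h₁ h, abs_mul, h₁, h, one_mul] using this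

/-- The sign `s` covers the partial kernel and its adjoint. -/
lemma ZygKernel.partialEstimates (hk : ZygKernel C k) (I : Intv) {s : ℝ} (h : |s| = 1) :
    PartialEstimates C Dlog 1 I.len
      fun x y => kA k I (s * (x.1 - y.1), s * (x.2 - y.2)) := by
  intro x₂ x₃ y₂ y₃ n₂ n₃
  have hs : s ≠ 0 := by rintro rfl; simp at h
  have m₂ := mul_ne_zero hs (sub_ne_zero.2 n₂)
  have m₃ := mul_ne_zero hs (sub_ne_zero.2 n₃)
  have e : ∀ x x' y : ℝ, s * (x' - y) = s * (x - y) + s * (x' - x) := fun x x' y => by ring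
  have eD : ∀ a b : ℝ, Dlog I.len (s * a) (s * b) = Dlog I.len a b := fun a b => by
    simpa using Dlog_mul (s₁ := 1) (by simp) h I.len a b
  refine ⟨by simpa only [eD, abs_mul, h, one_mul] using hk.sizeA I _ _ m₂ m₃,
    fun x₂' x₃' i₂ i₃ => ?_⟩
  have := hk.diffA I _ _ (s * (x₂' - x₂)) (s * (x₃' - x₃)) m₂ m₃
    (by simpa only [abs_mul, h, one_mul] using i₂) (by simpa only [abs_mul, h, one_mul] using i₃)
  simp only [Real.rpow_one]
  rw [e x₂ x₂' y₂, e x₃ x₃' y₃]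
  simpa only [incr, eD, abs_mul, h, one_mul] using this

lemma ZygKernel.czEstimates (hk : ZygKernel C k) (R : Rect) :
    CZEstimates (C * R.area) 1 fun s t => kB k R (s - t) := by
  intro x y n
  refine ⟨hk.sizeB R _ (sub_ne_zero.2 n), fun x' i => ?_⟩
  have e2 : |x - y| ^ (1 + 1 : ℝ) = |x - y| ^ 2 := by
    rw [show (1 + 1 : ℝ) = ((2 : ℕ) : ℝ) by norm_num, Real.rpow_natCast]
  rw [Real.rpow_one, e2]
  constructor
  · have := hk.diffB R (x - y) (x' - x) (sub_ne_zero.2 n) i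
    rwa [show x - y + (x' - x) = x' - y by ring] at this
  · have := hk.diffB R (y - x) (x - x') (sub_ne_zero.2 n.symm)
      (by rwa [abs_sub_comm x x', abs_sub_comm y x])
    rwa [show y - x + (x - x') = y - x' by ring, abs_sub_comm x x', abs_sub_comm y x] at this

end

/-! ### The cancellation conditions -/

lemma farInt_zero {B : Type*} [NormedAddCommGroup B] (h : B → ℂ) (σ : B → B) (τ χ : B → ℂ)
    (b b' : B) : farInt (fun _ => 0) h σ τ χ b b' = 0 := by simp [farInt]

instance : (volume : Measure ((ℝ × ℝ) × ℝ)).IsAddHaarMeasure :=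
  inferInstanceAs ((volume : Measure (ℝ × ℝ)).prod (volume : Measure ℝ)).IsAddHaarMeasure

section
variable {k : R3 → ℂ} {B : (R3 → ℂ) → (R3 → ℂ) → ℂ}

/-- The cancellation identity with the roles `A = ℝ`, `B = ℝ²`. Here `B f g` stands for `⟨T f, g⟩`. -/
lemma cancel_of_orthogonal₂₃ (hc : Continuous k) (hi : Integrable k)
    (hm : ∀ t, ∫ u : ℝ × ℝ, k (t, u) = 0)
    (hB : ∀ f g, Integrable f → Integrable g →
      B f g = ∫ p : R3 × R3, k (p.1 - p.2) * (g p.1 * f p.2)) (I J : Intv) (Q : Rect)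
    {h χ : ℝ × ℝ → ℂ} {σ : ℝ × ℝ → ℝ × ℝ} (hh : Integrable h) (hhm : Measurable h)
    (hσ : Measurable σ) (hχ : Measurable χ) (hχb : ∀ b, ‖χ b‖ ≤ 1)
    (horth : ∀ a b', ∫ b, h b * k (a, σ b - b') = 0) :
    Integrable (fun p : R3 × R3 => off I.set J.set p.1.1 p.2.1 *
      farInt (fun v => k (p.1.1 - p.2.1, v)) h σ Q.ind χ p.1.2 p.2.2) ∧
    (∀ R ∈ I.inter J, Integrable fun p : (ℝ × ℝ) × (ℝ × ℝ) =>
      farInt (kA k R) h σ Q.ind χ p.1 p.2) ∧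
    B (tens I.ind Q.ind) (tens J.ind h) +
      (∫ p : R3 × R3, off I.set J.set p.1.1 p.2.1 *
        farInt (fun v => k (p.1.1 - p.2.1, v)) h σ Q.ind χ p.1.2 p.2.2) +
      (I.inter J).elim 0 (fun R => ∫ p : (ℝ × ℝ) × (ℝ × ℝ),
        farInt (kA k R) h σ Q.ind χ p.1 p.2) = 0 := by
  have hτb : ∀ b, ‖Q.ind b‖ ≤ 1 := fun b => by rw [Q.ind_eq]; exact norm_ind_le _ _
  obtain ⟨c1, c2, c3⟩ := cancellation (S := J.set) (S' := I.set) hc hi hm J.measurableSet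
    I.measurableSet J.volume_lt_top hh hhm hσ Q.measurable_ind hτb hχ hχb horth
  have eB : B (tens I.ind Q.ind) (tens J.ind h) =
      ∫ p, pairInt k (ind J.set) (ind I.set) h id Q.ind p := by
    rw [hB _ _ (integrable_tens I.integrable_ind Q.integrable_ind)
      (integrable_tens J.integrable_ind hh)]
    refine Eq.trans ?_ (integral_middleSwap _)
    refine integral_congr_ae (Eventually.of_forall fun p => ?_)
    simp only [tens, pairInt, id, Intv.ind_eq]
    rw [show p.1 - p.2 = (p.1.1 - p.2.1, p.1.2 - p.2.2) from rfl]
    ring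
  simp only [off_eq]
  have e2 := integral_middleSwap fun p : (ℝ × ℝ) × ((ℝ × ℝ) × (ℝ × ℝ)) =>
    (ind J.set p.1.1 * ind I.set p.1.2 - ind (I.set ∩ J.set) p.1.1 * ind (I.set ∩ J.set) p.1.2) *
      farInt (fun v => k (p.1.1 - p.1.2, v)) h σ Q.ind χ p.2.1 p.2.2
  have epart : ∀ R ∈ I.inter J, kA k R =
      fun v => ∫ q in (I.set ∩ J.set) ×ˢ (I.set ∩ J.set), k (q.1 - q.2, v) := by
    intro R hR
    funext v
    rw [kA, Intv.set_of_inter_eq_some hR]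
  refine ⟨(integrable_middleSwap_iff _).2 c1, fun R hR => by rw [epart R hR]; exact c2, ?_⟩
  rw [eB, e2]
  refine Eq.trans ?_ c3
  congr 1
  rcases hR : I.inter J with _ | R
  · simp [Intv.inter_set_of_inter_eq_none hR, farInt_zero]
  · simp only [Option.elim_some, epart R hR]

/-- The cancellation identity with the roles `A = ℝ²`, `B = ℝ`. -/
lemma cancel_of_orthogonal₁ (hc : Continuous k) (hi : Integrable k)
    (hm : ∀ z : ℝ × ℝ, ∫ t, k (t, z) = 0)
    (hB : ∀ f g, Integrable f → Integrable g →
      B f g = ∫ p : R3 × R3, k (p.1 - p.2) * (g p.1 * f p.2)) (I : Intv) (P Q : Rect)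
    {h χ : ℝ → ℂ} {σ : ℝ → ℝ} (hh : Integrable h) (hhm : Measurable h)
    (hσ : Measurable σ) (hχ : Measurable χ) (hχb : ∀ b, ‖χ b‖ ≤ 1)
    (horth : ∀ (a : ℝ × ℝ) (b' : ℝ), ∫ b, h b * k (σ b - b', a) = 0) :
    Integrable (fun p : R3 × R3 => off P.set Q.set p.1.2 p.2.2 *
      farInt (fun t => k (t, p.1.2 - p.2.2)) h σ I.ind χ p.1.1 p.2.1) ∧
    (∀ R ∈ P.inter Q, Integrable fun p : ℝ × ℝ =>
      farInt (kB k R) h σ I.ind χ p.1 p.2) ∧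
    B (tens I.ind P.ind) (tens h Q.ind) +
      (∫ p : R3 × R3, off P.set Q.set p.1.2 p.2.2 *
        farInt (fun t => k (t, p.1.2 - p.2.2)) h σ I.ind χ p.1.1 p.2.1) +
      (P.inter Q).elim 0 (fun R => ∫ p : ℝ × ℝ,
        farInt (kB k R) h σ I.ind χ p.1 p.2) = 0 := by
  have hτb : ∀ b, ‖I.ind b‖ ≤ 1 := fun b => norm_ind_le _ _
  have hc' : Continuous fun z : (ℝ × ℝ) × ℝ => k (z.2, z.1) := by fun_prop
  have hi' : Integrable fun z : (ℝ × ℝ) × ℝ => k (z.2, z.1) := hi.swap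
  obtain ⟨c1, c2, c3⟩ := cancellation (S := Q.set) (S' := P.set) hc' hi' hm Q.measurableSet
    P.measurableSet Q.isBounded.measure_lt_top hh hhm hσ I.measurable_ind hτb hχ hχb horth
  have swap : ∀ F : ((ℝ × ℝ) × (ℝ × ℝ)) × (ℝ × ℝ) → ℂ,
      ∫ p : (ℝ × ℝ) × ((ℝ × ℝ) × (ℝ × ℝ)), F p.swap = ∫ p, F p := fun F => by
    rw [show (volume : Measure ((ℝ × ℝ) × ((ℝ × ℝ) × (ℝ × ℝ)))) = volume.prod volume from rfl,
      show (volume : Measure (((ℝ × ℝ) × (ℝ × ℝ)) × (ℝ × ℝ))) = volume.prod volume from rfl]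
    exact integral_prod_swap F
  have eB : B (tens I.ind P.ind) (tens h Q.ind) =
      ∫ p, pairInt (fun z : (ℝ × ℝ) × ℝ => k (z.2, z.1)) (ind Q.set) (ind P.set) h id I.ind p := by
    rw [hB _ _ (integrable_tens I.integrable_ind P.integrable_ind)
      (integrable_tens hh Q.integrable_ind)]
    refine Eq.trans ?_ (swap fun q => pairInt (fun z : (ℝ × ℝ) × ℝ => k (z.2, z.1))
      (ind Q.set) (ind P.set) h id I.ind q)
    refine Eq.trans ?_ (integral_middleSwap _)
    refine integral_congr_ae (Eventually.of_forall fun p => ?_)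
    simp only [tens, pairInt, id, Rect.ind_eq, Prod.swap]
    rw [show p.1 - p.2 = (p.1.1 - p.2.1, p.1.2 - p.2.2) from rfl]
    ring
  simp only [off_eq]
  set F : ((ℝ × ℝ) × (ℝ × ℝ)) × (ℝ × ℝ) → ℂ := fun p =>
    (ind Q.set p.1.1 * ind P.set p.1.2 - ind (P.set ∩ Q.set) p.1.1 * ind (P.set ∩ Q.set) p.1.2) *
      farInt (fun v => k (v, p.1.1 - p.1.2)) h σ I.ind χ p.2.1 p.2.2 with hF
  have e2 := (integral_middleSwap fun p : (ℝ × ℝ) × ((ℝ × ℝ) × (ℝ × ℝ)) => F p.swap).trans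
    (swap F)
  have epart : ∀ R ∈ P.inter Q, kB k R =
      fun v => ∫ q in (P.set ∩ Q.set) ×ˢ (P.set ∩ Q.set), k (v, q.1 - q.2) := by
    intro R hR
    funext v
    rw [kB, Rect.set_of_inter_eq_some hR]
  refine ⟨(integrable_middleSwap_iff fun p => F p.swap).2 c1.swap,
    fun R hR => by rw [epart R hR]; exact c2, ?_⟩
  rw [eB]
  refine Eq.trans ?_ c3
  congr 1
  · congr 1
  rcases hR : P.inter Q with _ | R
  · simp [Rect.inter_set_of_inter_eq_none hR, farInt_zero]
  · simp only [Option.elim_some, epart R hR]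

lemma far₁_eq (κ : ℝ → ℂ) (I : Intv) (x y : ℝ) : far₁ (fun s t => κ (s - t)) I x y =
    farInt κ (I.haar true) (fun _ => I.center) I.triple.ind I.triple.coind x y := by
  simp only [far₁, farInt, Intv.coind_eq]
  ring

/-- The two complementary terms of `far₂` add up to `κ(x - y) 1_{(3Q)^c}(y)`, apart from the
subtracted term. -/
lemma far₂_eq (κ : ℝ × ℝ → ℂ) (Q : Rect) (η : Bool) (x y : ℝ × ℝ) :
    far₂ (fun s t => κ (s - t)) Q η x y = farInt κ (Q.haar true η) (fun x => (Q.1.center, x.2))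
      Q.triple.ind (fun y => Q.1.triple.coind y.1) x y := by
  simp only [far₂, farInt, Intv.coind_eq, Rect.ind, Rect.triple]
  ring

lemma far₃_eq (κ : ℝ × ℝ → ℂ) (Q : Rect) (η : Bool) (x y : ℝ × ℝ) :
    far₃ (fun s t => κ (s - t)) Q η x y = farInt κ (Q.haar η true) (fun x => (x.1, Q.2.center))
      Q.triple.ind (fun y => Q.2.triple.coind y.2) x y := by
  simp only [far₃, farInt, Intv.coind_eq, Rect.ind, Rect.triple]
  ring

lemma cancel₁_of_mean (hc : Continuous k) (hi : Integrable k)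
    (hm : ∀ z : ℝ × ℝ, ∫ t, k (t, z) = 0)
    (hB : ∀ f g, Integrable f → Integrable g →
      B f g = ∫ p : R3 × R3, k (p.1 - p.2) * (g p.1 * f p.2)) :
    Cancel₁ B (fun x y => k (x - y)) fun R s t => kB k R (s - t) := by
  intro I P Q
  have horth : ∀ (a : ℝ × ℝ) (b' : ℝ), ∫ b, I.haar true b * k (I.center - b', a) = 0 :=
    fun a b' => by rw [integral_mul_const, I.integral_haar, zero_mul]
  have h := cancel_of_orthogonal₁ hc hi hm hB I.triple P Q (I.integrable_haar true)
    (I.measurable_haar true) measurable_const I.triple.measurable_coind I.triple.norm_coind_le horth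
  intro full part
  have hf : full = fun p => off P.set Q.set p.1.2 p.2.2 * farInt (fun t => k (t, p.1.2 - p.2.2))
      (I.haar true) (fun _ => I.center) I.triple.ind I.triple.coind p.1.1 p.2.1 :=
    funext fun p => congrArg (off P.set Q.set p.1.2 p.2.2 * ·) (far₁_eq (fun t => k (t, p.1.2 - p.2.2)) I _ _)
  have hp : part = fun R p => farInt (kB k R)
      (I.haar true) (fun _ => I.center) I.triple.ind I.triple.coind p.1 p.2 :=
    funext fun R => funext fun p => far₁_eq (kB k R) I _ _
  rw [hf, hp]
  exact h

lemma cancel₂₃_of_mean (hc : Continuous k) (hi : Integrable k)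
    (hm : ∀ t, ∫ u : ℝ × ℝ, k (t, u) = 0)
    (hB : ∀ f g, Integrable f → Integrable g →
      B f g = ∫ p : R3 × R3, k (p.1 - p.2) * (g p.1 * f p.2)) :
    Cancel₂₃ B (fun x y => k (x - y)) fun I s t => kA k I (s - t) := by
  intro I J Q η
  constructor
  · intro full part
    have hf : full = fun p => off I.set J.set p.1.1 p.2.1 * farInt (fun v => k (p.1.1 - p.2.1, v))
        (Q.haar true η) (fun x => (Q.1.center, x.2)) Q.triple.ind (fun y => Q.1.triple.coind y.1)
        p.1.2 p.2.2 :=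
      funext fun p => congrArg (off I.set J.set p.1.1 p.2.1 * ·) (far₂_eq (fun v => k (p.1.1 - p.2.1, v)) Q η _ _)
    have hp : part = fun R p => farInt (kA k R) (Q.haar true η) (fun x => (Q.1.center, x.2)) Q.triple.ind
        (fun y => Q.1.triple.coind y.1) p.1 p.2 :=
      funext fun R => funext fun p => far₂_eq (kA k R) Q η _ _
    rw [hf, hp]
    refine cancel_of_orthogonal₂₃ hc hi hm hB I J Q.triple (Q.integrable_haar true η)
      (Q.measurable_haar true η) (by fun_prop)
      (Q.1.triple.measurable_coind.comp measurable_fst) (fun b => Q.1.triple.norm_coind_le _) ?_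
    intro a b'
    have := integral_prod_mul (μ := (volume : Measure ℝ)) (ν := (volume : Measure ℝ))
      (Q.1.haar true) fun t => Q.2.haar η t * k (a, (Q.1.center, t) - b')
    rw [Q.1.integral_haar, zero_mul] at this
    rw [← this]
    exact integral_congr_ae (Eventually.of_forall fun b => mul_assoc _ _ _)
  · intro full part
    have hf : full = fun p => off I.set J.set p.1.1 p.2.1 * farInt (fun v => k (p.1.1 - p.2.1, v))
        (Q.haar η true) (fun x => (x.1, Q.2.center)) Q.triple.ind (fun y => Q.2.triple.coind y.2)
        p.1.2 p.2.2 :=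
      funext fun p => congrArg (off I.set J.set p.1.1 p.2.1 * ·) (far₃_eq (fun v => k (p.1.1 - p.2.1, v)) Q η _ _)
    have hp : part = fun R p => farInt (kA k R) (Q.haar η true) (fun x => (x.1, Q.2.center)) Q.triple.ind
        (fun y => Q.2.triple.coind y.2) p.1 p.2 :=
      funext fun R => funext fun p => far₃_eq (kA k R) Q η _ _
    rw [hf, hp]
    refine cancel_of_orthogonal₂₃ hc hi hm hB I J Q.triple (Q.integrable_haar η true)
      (Q.measurable_haar η true) (by fun_prop)
      (Q.2.triple.measurable_coind.comp measurable_snd) (fun b => Q.2.triple.norm_coind_le _) ?_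
    intro a b'
    have := integral_prod_mul (μ := (volume : Measure ℝ)) (ν := (volume : Measure ℝ))
      (fun t => Q.1.haar η t * k (a, (t, Q.2.center) - b')) (Q.2.haar true)
    rw [Q.2.integral_haar, mul_zero] at this
    rw [← this]
    refine integral_congr_ae (Eventually.of_forall fun b => ?_)
    simp only [Rect.haar]
    ring

end

/-! ### Convolution operators with adapted kernels -/

lemma setIntegral_square_neg {X : Type*} [AddGroup X] [MeasureSpace X]
    [SFinite (volume : Measure X)] (E : Set X) (f : X → ℂ) :
    ∫ p in E ×ˢ E, f (-(p.1 - p.2)) = ∫ p in E ×ˢ E, f (p.1 - p.2) := by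
  rw [show (volume : Measure (X × X)) = volume.prod volume from rfl, ← Measure.prod_restrict,
    ← integral_prod_swap]
  simp

lemma kA_neg (k : R3 → ℂ) (I : Intv) (z : ℝ × ℝ) : kA (fun x => k (-x)) I z = kA k I (-z) :=
  setIntegral_square_neg I.set fun t => k (t, -z)

lemma kB_neg (k : R3 → ℂ) (R : Rect) (t : ℝ) : kB (fun x => k (-x)) R t = kB k R (-t) :=
  setIntegral_square_neg R.set fun u => k (-t, u)

/-- A convolution operator with an adapted kernel is a `(log, 1, 1)`-CZZ operator. -/
lemma ZygKernel.isLogCZZWith {C : ℝ} {k : R3 → ℂ} (hk : ZygKernel C k) :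
    IsLogCZZWith C 1 1 (convOp k) := by
  have hc := hk.cont
  obtain ⟨M, hM⟩ := hk.bdd
  have one : |(1 : ℝ)| = 1 := abs_one
  have neg : |(-1 : ℝ)| = 1 := by simp
  have hc' : Continuous fun x => k (-x) := by fun_prop
  have hi' : Integrable fun x => k (-x) := hk.int.comp_neg
  have hm₁ : ∀ z : ℝ × ℝ, ∫ t, k (-(t, z)) = 0 := fun z => by
    rw [← hk.mean₁ (-z)]
    exact integral_neg_eq_self (fun t => k (t, -z)) volume
  have hm₂₃ : ∀ t : ℝ, ∫ u : ℝ × ℝ, k (-(t, u)) = 0 := fun t => by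
    rw [← hk.mean₂₃ (-t)]
    exact integral_neg_eq_self (fun u : ℝ × ℝ => k (-t, u)) volume
  have hB : ∀ f g, Integrable f → Integrable g → pairing (convOp k) f g =
      ∫ p : R3 × R3, k (p.1 - p.2) * (g p.1 * f p.2) := fun f g hf hg =>
    pairing_convOp hc hM hf hg
  have hB' : ∀ f g, Integrable f → Integrable g → pairing (convOp k) g f =
      ∫ p : R3 × R3, k (-(p.1 - p.2)) * (g p.1 * f p.2) := fun f g hf hg =>
    pairing_convOp_transpose hc hM hf hg
  have aK : adj (fun x y : R3 => k (x - y)) = fun x y => k (-(x - y)) := by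
    funext x y; simp [adj]
  have aA : (fun I => adj fun s t => kA k I (s - t)) =
      fun I s t => kA (fun x => k (-x)) I (s - t) := by
    funext I s t; simp [adj, kA_neg]
  have aB : (fun P => adj fun s t => kB k P (s - t)) =
      fun P s t => kB (fun x => k (-x)) P (s - t) := by
    funext P s t; simp [adj, kB_neg]
  refine
    { map_add := fun f hf g hg =>
        convOp_add hc hM (integrable_of_mem_stepFun hf) (integrable_of_mem_stepFun hg)
      map_smul := fun c f _ => convOp_smul c f
      integrable := fun I J P Q => (integrable_convOp hk.int (integrable_box I P)).integrableOn
      kernels := ⟨fun x y => k (x - y), fun I s t => kA k I (s - t), fun R s t => kB k R (s - t),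
        { full_rep := fun I J P Q _ _ => convOp_full_rep hc hM I J P Q
          full_est := ?_
          full_est_adj := ?_
          full_est_adj₁ := ?_
          full_est_adj₂₃ := ?_
          part₁_rep := fun I P Q _ => convOp_part₁_rep hc hM I P Q
          part₁_est := fun I => ?_
          part₁_est_adj := fun I => ?_
          part₂₃_rep := fun I J P _ => convOp_part₂₃_rep hc hM I J P
          part₂₃_est := fun P => hk.czEstimates P
          cancel₁ := cancel₁_of_mean hc hk.int hk.mean₁ hB
          cancel₁_adj := ?_
          cancel₂₃ := cancel₂₃_of_mean hc hk.int hk.mean₂₃ hB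
          cancel₂₃_adj := ?_ }⟩
      weak_boundedness := fun I P _ => ?_ }
  · have h := hk.fullEstimates one one
    simp only [one_mul] at h
    exact h
  · have h := hk.fullEstimates neg neg
    simp only [neg_mul, one_mul, neg_sub] at h
    exact h
  · have h := hk.fullEstimates neg one
    simp only [one_mul, neg_mul, neg_sub] at h
    exact h
  · have h := hk.fullEstimates one neg
    simp only [one_mul, neg_mul, neg_sub] at h
    exact h
  · have h := hk.partialEstimates I one
    simp only [one_mul] at h
    exact h
  · have h := hk.partialEstimates I neg
    simp only [neg_mul, one_mul, neg_sub] at h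
    exact h
  · rw [aK, aB]
    exact cancel₁_of_mean (k := fun x => k (-x)) hc' hi' hm₁ hB'
  · rw [aK, aA]
    exact cancel₂₃_of_mean (k := fun x => k (-x)) hc' hi' hm₂₃ hB'
  · rw [pairing_box' hc hM]
    exact hk.wbp I P

/-! ### Dilations and the kernels of truncated multipliers -/

lemma map_rho_volume {a b : ℝ} (ha : 0 < a) (hb : 0 < b) :
    Measure.map (rho a b) volume = ENNReal.ofReal (a ^ 2 * b ^ 2)⁻¹ • volume := by
  have hab : 0 < a * b := mul_pos ha hb
  have h : rho a b = Prod.map (a * ·) (Prod.map (b * ·) (a * b * ·)) := rfl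
  have m : ∀ c : ℝ, Measurable (c * ·) := fun c => measurable_const_mul c
  rw [h, show (volume : Measure R3) = volume.prod (volume.prod volume) from rfl,
    ← Measure.map_prod_map _ _ (m a) ((m b).prodMap (m (a * b))),
    ← Measure.map_prod_map _ _ (m b) (m (a * b)), Real.map_volume_mul_left ha.ne',
    Real.map_volume_mul_left hb.ne', Real.map_volume_mul_left hab.ne']
  simp only [Measure.prod_smul_left, Measure.prod_smul_right, smul_smul]
  rw [← ENNReal.ofReal_mul (abs_nonneg _), ← ENNReal.ofReal_mul (by positivity)]
  congr 2
  rw [abs_of_pos (by positivity), abs_of_pos (by positivity), abs_of_pos (by positivity)]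
  field_simp

lemma integrable_comp_rho {a b : ℝ} (ha : 0 < a) (hb : 0 < b) {G : R3 → ℂ} (hG : Integrable G) :
    Integrable fun ξ => G (rho a b ξ) := by
  have h := hG.smul_measure (c := ENNReal.ofReal (a ^ 2 * b ^ 2)⁻¹) ENNReal.ofReal_ne_top
  rw [← map_rho_volume ha hb] at h
  exact h.comp_measurable (continuous_rho a b).measurable

lemma integral_comp_rho {a b : ℝ} (ha : 0 < a) (hb : 0 < b) {G : R3 → ℂ} (hG : Integrable G) :
    ∫ ξ, G (rho a b ξ) = (((a ^ 2 * b ^ 2)⁻¹ : ℝ) : ℂ) * ∫ ξ, G ξ := by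
  have hm : AEStronglyMeasurable G (Measure.map (rho a b) volume) := by
    rw [map_rho_volume ha hb]
    exact hG.1.smul_measure _
  rw [← integral_map (continuous_rho a b).aemeasurable hm, map_rho_volume ha hb,
    integral_smul_measure, ENNReal.toReal_ofReal (by positivity), Complex.real_smul]

lemma rho_rho_inv {a b : ℝ} (ha : 0 < a) (hb : 0 < b) (ξ : R3) : rho a b (rho a⁻¹ b⁻¹ ξ) = ξ := by
  simp only [rho]
  refine Prod.ext ?_ (Prod.ext ?_ ?_) <;> field_simp

lemma phase_rho (x η : R3) (a b : ℝ) : phase x (rho a b η) = phase (rho a b x) η := by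
  simp only [phase, rho, dot]
  congr 4
  ring

/-- A dilation of a function dilates its inverse Fourier transform the other way. -/
lemma invFourier_comp_rho_inv {a b : ℝ} (ha : 0 < a) (hb : 0 < b) {G : R3 → ℂ} (hG : Integrable G)
    (x : R3) : invFourier (fun ξ => G (rho a⁻¹ b⁻¹ ξ)) x = sc a b (invFourier G) x := by
  have hi : Integrable fun η => phase (rho a b x) η * G η :=
    hG.bdd_mul (c := 1) (continuous_phase_right _).aestronglyMeasurable
      (Eventually.of_forall fun η => (norm_phase _ _).le)
  have h := integral_comp_rho (inv_pos.2 ha) (inv_pos.2 hb) hi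
  simp only [invFourier_eq, sc]
  rw [show ((a ^ 2 * b ^ 2 : ℝ) : ℂ) = (((a⁻¹ ^ 2 * b⁻¹ ^ 2)⁻¹ : ℝ) : ℂ) by
    congr 1; field_simp]
  refine Eq.trans (integral_congr_ae (Eventually.of_forall fun ξ => ?_)) h
  simp only
  rw [← phase_rho, rho_rho_inv ha hb]

lemma IsResolution.adm {φ₁ : ℝ → ℝ} {φ₂₃ : ℝ × ℝ → ℝ} (h : IsResolution φ₁ φ₂₃) :
    Adm fun ξ => ((φ₁ ξ.1 * φ₂₃ ξ.2 : ℝ) : ℂ) := by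
  refine ⟨?_, fun ξ hξ => ?_⟩
  · exact Complex.ofRealCLM.contDiff.comp
      ((h.smooth₁.comp contDiff_fst).mul (h.smooth₂₃.comp contDiff_snd))
  · by_contra hne
    have hne' : φ₁ ξ.1 * φ₂₃ ξ.2 ≠ 0 := fun h0 => hne (by simp only [h0, Complex.ofReal_zero])
    obtain ⟨h1, h2⟩ := h.supp₁ _ (left_ne_zero_of_mul hne')
    obtain ⟨h3, h4⟩ := h.supp₂₃ _ (right_ne_zero_of_mul hne')
    exact hξ ⟨h1, h2, h3, h4⟩

/-- A piece of the multiplier is a dilated symbol supported in the fixed annulus `K0`. -/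
lemma piece_eq (φ₁ : ℝ → ℝ) (φ₂₃ : ℝ × ℝ → ℝ) (m : R3 → ℂ) (j k : ℤ) :
    piece φ₁ φ₂₃ m j k = fun ξ => (fun η : R3 => ((φ₁ η.1 * φ₂₃ η.2 : ℝ) : ℂ) *
      (m ∘ rho ((2 : ℝ) ^ j) ((2 : ℝ) ^ k)) η) (rho ((2 : ℝ) ^ j)⁻¹ ((2 : ℝ) ^ k)⁻¹ ξ) := by
  funext ξ
  simp only [piece, Function.comp_apply, rho_rho_inv (two_zpow_pos j) (two_zpow_pos k), zpow_neg]

end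

end Zyg


open Zyg in
theorem proposition3p5 :
    ∃ N₀ : ℕ, ∀ N : ℕ, N₀ ≤ N →
      ∀ (φ₁ : ℝ → ℝ) (φ₂₃ : ℝ × ℝ → ℝ), Zyg.IsResolution φ₁ φ₂₃ →
        ∃ C : ℝ, ∀ (m : Zyg.R3 → ℂ), Zyg.IsM1 N m → ∀ J : ℕ × ℕ,
          MeasureTheory.Integrable (Zyg.trunc φ₁ φ₂₃ m J) ∧
          MeasureTheory.Integrable (Zyg.invFourier (Zyg.trunc φ₁ φ₂₃ m J)) ∧
          Zyg.IsLogCZZWith (C * (Zyg.M1norm N m).toReal) 1 1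
            (Zyg.convOp (Zyg.invFourier (Zyg.trunc φ₁ φ₂₃ m J))) := by
  -- twelve derivatives give decay of order four in each of the three variables
  refine ⟨12, fun N hN φ₁ φ₂₃ hφ => ?_⟩
  obtain ⟨C₁, hC₁, hbump⟩ := hφ.adm.isBump 2
  obtain ⟨C₀, hC₀, hmul⟩ := hφ.adm.mul_bddDer 12
  obtain ⟨C₂, hC₂, hsum⟩ := exists_zygKernel_ksum
  refine ⟨C₂ * (C₁ * 64 ^ 12), fun m hm J => ?_⟩
  set μ := (M1norm N m).toReal with hμ
  have hμ0 : 0 ≤ 64 ^ 12 * μ := mul_nonneg (by norm_num) ENNReal.toReal_nonneg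
  set G : ℤ → ℤ → R3 → ℂ := fun j k ξ => ((φ₁ ξ.1 * φ₂₃ ξ.2 : ℝ) : ℂ) *
    (m ∘ rho ((2 : ℝ) ^ j) ((2 : ℝ) ^ k)) ξ with hG
  have hder := fun j k => hm.bddDer hN (two_zpow_pos j) (two_zpow_pos k)
  have hGi : ∀ j k, Integrable (G j k) := fun j k => by
    simpa [hG] using (hmul _ _ hμ0 (hder j k)).integrable_mul (f := fun _ => 1) continuous_const
  have hpi : ∀ j k, Integrable (piece φ₁ φ₂₃ m j k) := fun j k => by
    rw [piece_eq]
    exact integrable_comp_rho (inv_pos.2 (two_zpow_pos j)) (inv_pos.2 (two_zpow_pos k)) (hGi j k)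
  have hker : invFourier (trunc φ₁ φ₂₃ m J) = ksum (Finset.Icc (-(J.1 : ℤ)) J.1)
      (Finset.Icc (-(J.2 : ℤ)) J.2) fun j k => invFourier (G j k) := by
    funext x
    have hph : ∀ j k, Integrable fun ξ => phase x ξ * piece φ₁ φ₂₃ m j k ξ := fun j k =>
      (hpi j k).bdd_mul (c := 1) (continuous_phase_right x).aestronglyMeasurable
        (Filter.Eventually.of_forall fun ξ => (norm_phase _ _).le)
    simp only [invFourier_eq (trunc φ₁ φ₂₃ m J), trunc, Finset.mul_sum, ksum]
    rw [integral_sum_sum _ _ hph]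
    refine Finset.sum_congr rfl fun j _ => Finset.sum_congr rfl fun k _ => ?_
    rw [← invFourier_comp_rho_inv (two_zpow_pos j) (two_zpow_pos k) (hGi j k), ← invFourier_eq,
      piece_eq]
  have hk : ZygKernel (C₂ * (C₁ * 64 ^ 12) * μ) (invFourier (trunc φ₁ φ₂₃ m J)) := by
    rw [hker, mul_assoc, mul_assoc]
    exact hsum _ _ _ _ fun j k => hbump _ _ hμ0 (hder j k)
  exact ⟨integrable_finsetSum _ fun j _ => integrable_finsetSum _ fun k _ => hpi j k, hk.int,
    hk.isLogCZZWith⟩
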